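/- Let $r,n\ge 1$, let $\mathbb K$ be an algebraically closed field whose characteristic does not divide $r$, and let $q\in\mathbb K^{*}$. *Algebras.* The affine Yokonuma–Hecke algebra $\widehat Y_{r,n}^{\mathbb K}$ is the $\mathbb K$-algebra generated by $t_1,\dots,t_n,g_1,\dots,g_{n-1},X_1^{\pm1}$ with relations $g_ig_j=g_jg_i$ ($|i-j|\ge 2$), $g_ig_{i+1}g_i=g_{i+1}g_ig_{i+1}$, $t_it_j=t_jt_i$, $g_it_j=t_{s_i(j)}g_i$ with $s_i=(i,i+1)$, $t_i^r=1$, $g_i^2=1+(q-q^{-1})e_ig_i$ with $e_i=\frac1r\sum_{s=0}^{r-1}t_i^st_{i+1}^{-s}$, $X_1X_1^{-1}=X_1^{-1}X_1=1$, $g_1X_1g_1X_1=X_1g_1X_1g_1$, $g_iX_1=X_1g_i$ ($i\ge 2$), $t_jX_1=X_1t_j$; put $X_{i+1}=g_iX_ig_i$. The affine Hecke algebra $\widehat{\mathcal H}_m^{\mathbb K}$ ($m\ge 0$) of type $A$ is generated by $T_1,\dots,T_{m-1},Y_1^{\pm1},\dots,Y_m^{\pm1}$ with relations $(T_i-q)(T_i+q^{-1})=0$,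 $T_iT_{i+1}T_i=T_{i+1}T_iT_{i+1}$, $T_iT_j=T_jT_i$ ($|i-j|\ge2$), $Y_iY_i^{-1}=Y_i^{-1}Y_i=1$, $Y_iY_j=Y_jY_i$, $T_iY_iT_i=Y_{i+1}$, $T_iY_j=Y_jT_i$ ($j\ne i,i+1$). Let $e\in\mathbb N\cup\{\infty\}$ be the order of $q$, let $\mathbb J=\{0,1,\dots,e-1\}$ if $e<\infty$ and $\mathbb J=\mathbb Z$ if $e=\infty$, and let $\lambda=(\lambda_i)_{i\in\mathbb J}$ be a family of non-negative integers, only finitely many of them nonzero. Put $f_\lambda(x)=\prod_{i\in\mathbb J}(x-q^i)^{\lambda_i}$. Let $Y_{r,n}^{\lambda,\mathbb K}$ be the quotient of $\widehat Y_{r,n}^{\mathbb K}$ by the two-sided ideal generated by $f_\lambda(X_1)$, and for $m\ge1$ let $\mathcal H_m^{\lambda,\mathbb K}$ be the quotient of $\widehat{\mathcal H}_m^{\mathbb K}$ by the two-sided ideal generated by $f_\lambda(Y_1)$; $\mathcal H_0^{\lambda,\mathbb K}=\widehat{\mathcal H}_0^{\mathbb K}=\mathbb K$. For an $\mathcal H_m^{\lambda,\mathbb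 K}$-module $L$ let $\mathrm{ev}_{m,\lambda}^*L$ be its inflation to $\widehat{\mathcal H}_m^{\mathbb K}$. A $Y_{r,n}^{\lambda,\mathbb K}$-module is identified with its inflation to $\widehat Y_{r,n}^{\mathbb K}$. *The modules $S_\mu(L_\cdot)$.* Let $V_1,\dots,V_r$ be a complete set of pairwise non-isomorphic simple modules of the group algebra $\mathbb K[\mathbb Z/r\mathbb Z]$; thus $V_k=\mathbb Kv_k$, and a fixed generator of $\mathbb Z/r\mathbb Z$ acts on $V_k$ as a scalar $\zeta_k$, where $\zeta_1,\dots,\zeta_r$ are the $r$ distinct $r$-th roots of unity in $\mathbb K$. For an $r$-composition $\mu=(\mu_1,\dots,\mu_r)$ of $n$ (non-negative integers with sum $n$), divide $\{1,\dots,n\}$ into consecutive blocks of sizes $\mu_1,\dots,\mu_r$, and let $\widehat Y_{r,\mu}^{\mathbb K}\subseteq\widehat Y_{r,n}^{\mathbb K}$ be the subalgebra generated by all $t_j$, all $X_j^{\pm1}$, and the $g_i$ for which $i$ and $i+1$ lie in the same block. For $\mathcal H_{\mu_k}^{\lambda,\mathbb K}$-modules $L_k$ $(1\le k\le r)$, the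 space $(V_1^{\otimes\mu_1}\otimes \mathrm{ev}_{\mu_1,\lambda}^*L_1)\otimes\cdots\otimes(V_r^{\otimes\mu_r}\otimes \mathrm{ev}_{\mu_r,\lambda}^*L_r)$ is a $\widehat Y_{r,\mu}^{\mathbb K}$-module: for the $a$-th position $j$ of the $k$-th block, $t_j$ acts by the generator of $\mathbb Z/r\mathbb Z$ on the $a$-th tensor factor $V_k$ (that is, as the scalar $\zeta_k$), $X_j^{\pm1}$ acts as $Y_a^{\pm1}$ on $L_k$, and $g_j$ (if $a<\mu_k$) acts as $T_a$ on $L_k$. Put $$S_{\mu}(L_\cdot) :=\mathrm{Ind}_{\widehat{Y}_{r,\mu}^{\mathbb{K}}}^{\widehat{Y}_{r,n}^{\mathbb{K}}}\big((V_{1}^{\otimes \mu_{1}}\otimes \mathrm{ev}_{\mu_1,\lambda}^{*}L_{1})\otimes\cdots\otimes (V_{r}^{\otimes \mu_{r}}\otimes \mathrm{ev}_{\mu_r,\lambda}^{*}L_{r})\big),$$ where $\mathrm{Ind}_B^AN=A\otimes_BN$. **Theorem.** (1) For every $r$-composition $\mu$ of $n$ and all simple $\mathcal H_{\mu_k}^{\lambda,\mathbb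 K}$-modules $L_k$ $(1\le k\le r)$, the action of $\widehat Y_{r,n}^{\mathbb K}$ on $S_\mu(L_\cdot)$ factors through $Y_{r,n}^{\lambda,\mathbb K}$, and $S_\mu(L_\cdot)$ is a simple $Y_{r,n}^{\lambda,\mathbb K}$-module. (2) Every simple $Y_{r,n}^{\lambda,\mathbb K}$-module is isomorphic to $S_\mu(L_\cdot)$ for some $r$-composition $\mu$ of $n$ and some simple $\mathcal H_{\mu_k}^{\lambda,\mathbb K}$-modules $L_k$ $(1\le k\le r)$. (3) These modules are pairwise non-isomorphic: for simple $L_k$, $L_k'$ as above, $S_\mu(L_\cdot)\cong S_{\mu'}(L'_\cdot)$ if and only if $\mu=\mu'$ and $L_k\cong L_k'$ for all $1\le k\le r$. -/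

import Mathlib

open scoped TensorProduct ModuleCat

universe u v w

noncomputable section

namespace YokonumaHecke

/-! ## Affine Hecke algebras and affine Yokonuma-Hecke algebras

Indices start at `0`: what is usually written `t_1, …, t_n`, `g_1, …, g_{n-1}` is here `t_0, …, t_{n-1}`,
`g_0, …, g_{n-2}`, where `g_i` (defined when `i + 1 < n`) belongs to the transposition of the
positions `i` and `i + 1`. -/

/-- Generators `T_i`, `Y_j`, `Y_j⁻¹` of the (extended) affine Hecke algebra of type `A`. -/
inductive HeckeGen (m : ℕ) : Type
  | T (i : ℕ) (h : i + 1 < m) : HeckeGen m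
  | Y (j : Fin m) : HeckeGen m
  | Yinv (j : Fin m) : HeckeGen m

namespace HeckeRel

variable (K : Type u) [Field K] {m : ℕ}

/-- `T_i` in the free algebra. -/
abbrev T (i : ℕ) (h : i + 1 < m) : FreeAlgebra K (HeckeGen m) := FreeAlgebra.ι K (HeckeGen.T i h)
/-- `Y_j` in the free algebra. -/
abbrev Y (j : Fin m) : FreeAlgebra K (HeckeGen m) := FreeAlgebra.ι K (HeckeGen.Y j)
/-- `Y_j⁻¹` in the free algebra. -/
abbrev Yinv (j : Fin m) : FreeAlgebra K (HeckeGen m) := FreeAlgebra.ι K (HeckeGen.Yinv j)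

end HeckeRel

open HeckeRel in
/-- Defining relations of the affine Hecke algebra of type `A`. -/
inductive HeckeRel {K : Type u} [Field K] (q : Kˣ) (m : ℕ) :
    FreeAlgebra K (HeckeGen m) → FreeAlgebra K (HeckeGen m) → Prop
  | quadratic (i : ℕ) (h : i + 1 < m) :
      HeckeRel q m ((T K i h - algebraMap K _ (q : K)) * (T K i h + algebraMap K _ ((q⁻¹ : Kˣ) : K))) 0
  | braid (i : ℕ) (h : i + 1 + 1 < m) :
      HeckeRel q m (T K i (by omega) * T K (i + 1) h * T K i (by omega))
        (T K (i + 1) h * T K i (by omega) * T K (i + 1) h)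
  | far (i j : ℕ) (hi : i + 1 < m) (hj : j + 1 < m) (hij : i + 2 ≤ j ∨ j + 2 ≤ i) :
      HeckeRel q m (T K i hi * T K j hj) (T K j hj * T K i hi)
  | Y_Yinv (j : Fin m) : HeckeRel q m (Y K j * Yinv K j) 1
  | Yinv_Y (j : Fin m) : HeckeRel q m (Yinv K j * Y K j) 1
  | Y_comm (i j : Fin m) : HeckeRel q m (Y K i * Y K j) (Y K j * Y K i)
  | T_Y_T (i : ℕ) (h : i + 1 < m) :
      HeckeRel q m (T K i h * Y K ⟨i, by omega⟩ * T K i h) (Y K ⟨i + 1, h⟩)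
  | T_Y (i : ℕ) (h : i + 1 < m) (j : Fin m) (h1 : (j : ℕ) ≠ i) (h2 : (j : ℕ) ≠ i + 1) :
      HeckeRel q m (T K i h * Y K j) (Y K j * T K i h)

/-- The affine Hecke algebra `Ĥ_m` of type `A` over `K` with parameter `q`. -/
def AffHecke {K : Type u} [Field K] (q : Kˣ) (m : ℕ) : Type u := RingQuot (HeckeRel q m)

instance {K : Type u} [Field K] (q : Kˣ) (m : ℕ) : Ring (AffHecke q m) :=
  inferInstanceAs (Ring (RingQuot (HeckeRel q m)))
instance {K : Type u} [Field K] (q : Kˣ) (m : ℕ) : Algebra K (AffHecke q m) :=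
  inferInstanceAs (Algebra K (RingQuot (HeckeRel q m)))

namespace AffHecke

variable {K : Type u} [Field K] (q : Kˣ) {m : ℕ}

/-- The quotient map from the free algebra. -/
def mk (m : ℕ) : FreeAlgebra K (HeckeGen m) →ₐ[K] AffHecke q m := RingQuot.mkAlgHom K (HeckeRel q m)

/-- `T_i`. -/
def T (i : ℕ) (h : i + 1 < m) : AffHecke q m := mk q m (HeckeRel.T K i h)
/-- `Y_j`. -/
def Y (j : Fin m) : AffHecke q m := mk q m (HeckeRel.Y K j)
/-- `Y_j⁻¹`. -/
def Yinv (j : Fin m) : AffHecke q m := mk q m (HeckeRel.Yinv K j)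

theorem mk_rel {x y : FreeAlgebra K (HeckeGen m)} (h : HeckeRel q m x y) : mk q m x = mk q m y :=
  RingQuot.mkAlgHom_rel K h

end AffHecke

/-- Generators `t_j`, `g_i`, `X_1`, `X_1⁻¹` of the affine Yokonuma-Hecke algebra. -/
inductive YokGen (n : ℕ) : Type
  | t (j : Fin n) : YokGen n
  | g (i : ℕ) (h : i + 1 < n) : YokGen n
  | X (h : 0 < n) : YokGen n
  | Xinv (h : 0 < n) : YokGen n

namespace YokRel

variable (K : Type u) [Field K] {n : ℕ}

/-- `t_j` in the free algebra. -/
abbrev t (j : Fin n) : FreeAlgebra K (YokGen n) := FreeAlgebra.ι K (YokGen.t j)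
/-- `g_i` in the free algebra. -/
abbrev g (i : ℕ) (h : i + 1 < n) : FreeAlgebra K (YokGen n) := FreeAlgebra.ι K (YokGen.g i h)
/-- `X_1` in the free algebra. -/
abbrev X (h : 0 < n) : FreeAlgebra K (YokGen n) := FreeAlgebra.ι K (YokGen.X h)
/-- `X_1⁻¹` in the free algebra. -/
abbrev Xinv (h : 0 < n) : FreeAlgebra K (YokGen n) := FreeAlgebra.ι K (YokGen.Xinv h)
/-- `e_i = (1/r) ∑_{s=0}^{r-1} t_i^s t_{i+1}^{-s}`; as `t_{i+1}^r = 1`, the power `t_{i+1}^{-s}` is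
written `t_{i+1}^{r-s}`. -/
def e (r : ℕ) (i : ℕ) (h : i + 1 < n) : FreeAlgebra K (YokGen n) :=
  (r : K)⁻¹ • ∑ s ∈ Finset.range r, t K ⟨i, by omega⟩ ^ s * t K ⟨i + 1, h⟩ ^ (r - s)

end YokRel

open YokRel in
/-- Defining relations of the affine Yokonuma-Hecke algebra. -/
inductive YokRel {K : Type u} [Field K] (r : ℕ) (q : Kˣ) (n : ℕ) :
    FreeAlgebra K (YokGen n) → FreeAlgebra K (YokGen n) → Prop
  | far (i j : ℕ) (hi : i + 1 < n) (hj : j + 1 < n) (hij : i + 2 ≤ j ∨ j + 2 ≤ i) :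
      YokRel r q n (g K i hi * g K j hj) (g K j hj * g K i hi)
  | braid (i : ℕ) (h : i + 1 + 1 < n) :
      YokRel r q n (g K i (by omega) * g K (i + 1) h * g K i (by omega))
        (g K (i + 1) h * g K i (by omega) * g K (i + 1) h)
  | t_comm (i j : Fin n) : YokRel r q n (t K i * t K j) (t K j * t K i)
  | g_t (i : ℕ) (h : i + 1 < n) (j : Fin n) :
      YokRel r q n (g K i h * t K j) (t K (Equiv.swap ⟨i, by omega⟩ ⟨i + 1, h⟩ j) * g K i h)
  | t_pow (j : Fin n) : YokRel r q n (t K j ^ r) 1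
  | quadratic (i : ℕ) (h : i + 1 < n) :
      YokRel r q n (g K i h ^ 2) (1 + ((q : K) - ((q⁻¹ : Kˣ) : K)) • (e K r i h * g K i h))
  | X_Xinv (h : 0 < n) : YokRel r q n (X K h * Xinv K h) 1
  | Xinv_X (h : 0 < n) : YokRel r q n (Xinv K h * X K h) 1
  | g_X_g_X (h : 0 + 1 < n) :
      YokRel r q n (g K 0 h * X K (by omega) * g K 0 h * X K (by omega))
        (X K (by omega) * g K 0 h * X K (by omega) * g K 0 h)
  | g_X (i : ℕ) (h : i + 1 < n) (hi : 1 ≤ i) :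
      YokRel r q n (g K i h * X K (by omega)) (X K (by omega) * g K i h)
  | t_X (j : Fin n) (h : 0 < n) : YokRel r q n (t K j * X K h) (X K h * t K j)

/-- The affine Yokonuma-Hecke algebra `Ŷ_{r,n}` over `K` with parameter `q`. -/
def AffYok {K : Type u} [Field K] (r : ℕ) (q : Kˣ) (n : ℕ) : Type u := RingQuot (YokRel r q n)

instance {K : Type u} [Field K] (r : ℕ) (q : Kˣ) (n : ℕ) : Ring (AffYok r q n) :=
  inferInstanceAs (Ring (RingQuot (YokRel r q n)))
instance {K : Type u} [Field K] (r : ℕ) (q : Kˣ) (n : ℕ) : Algebra K (AffYok r q n) :=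
  inferInstanceAs (Algebra K (RingQuot (YokRel r q n)))

namespace AffYok

variable {K : Type u} [Field K] (r : ℕ) (q : Kˣ) {n : ℕ}

/-- The quotient map from the free algebra. -/
def mk (n : ℕ) : FreeAlgebra K (YokGen n) →ₐ[K] AffYok r q n := RingQuot.mkAlgHom K (YokRel r q n)

/-- `t_j`. -/
def t (j : Fin n) : AffYok r q n := mk r q n (YokRel.t K j)
/-- `g_i`. -/
def g (i : ℕ) (h : i + 1 < n) : AffYok r q n := mk r q n (YokRel.g K i h)

/-- The elements `X_j`, given by `X_{j+1} = g_j X_j g_j` from the generator `X_1`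
(which has index `0` here). -/
def X : (j : ℕ) → j < n → AffYok r q n
  | 0, h => mk r q n (YokRel.X K h)
  | j + 1, h => g r q j h * X j (by omega) * g r q j h

end AffYok

/-! ## Cyclotomic quotients -/

section Cyclotomic

variable {K : Type u} [Field K]

/-- The index set of the powers of `q`: `{0, …, e - 1}` if `q` has finite order `e`, and `ℤ` if `q`
has infinite order; `i ↦ q ^ i` is a bijection from it onto the set of all powers of `q`. -/
def residues (q : Kˣ) : Set ℤ := {i | orderOf q = 0 ∨ (0 ≤ i ∧ i < (orderOf q : ℤ))}

variable {q : Kˣ}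

/-- The polynomial `f_λ(x) = ∏_i (x - q^i)^{λ_i}`. -/
def cycPoly (lam : residues q →₀ ℕ) : Polynomial K :=
  lam.prod fun i d => (Polynomial.X - Polynomial.C ((q ^ (i : ℤ) : Kˣ) : K)) ^ d

/-- The two-sided ideal of `Ŷ_{r,n}` generated by `f_λ(X_1)`. -/
def yokIdeal (r n : ℕ) (lam : residues q →₀ ℕ) : TwoSidedIdeal (AffYok r q n) :=
  TwoSidedIdeal.span {x | ∃ h : 0 < n, x = Polynomial.aeval (AffYok.X r q 0 h) (cycPoly lam)}

/-- The cyclotomic Yokonuma-Hecke algebra `Y_{r,n}^λ`. -/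
def CycYok (r n : ℕ) (lam : residues q →₀ ℕ) : Type u := (yokIdeal r n lam).ringCon.Quotient

instance (r n : ℕ) (lam : residues q →₀ ℕ) : Ring (CycYok r n lam) :=
  inferInstanceAs (Ring (yokIdeal r n lam).ringCon.Quotient)
instance (r n : ℕ) (lam : residues q →₀ ℕ) : Algebra K (CycYok r n lam) :=
  inferInstanceAs (Algebra K (yokIdeal r n lam).ringCon.Quotient)

/-- The canonical surjection `Ŷ_{r,n} → Y_{r,n}^λ`. -/
def CycYok.proj (r n : ℕ) (lam : residues q →₀ ℕ) : AffYok r q n →ₐ[K] CycYok r n lam :=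
  (yokIdeal r n lam).ringCon.mkₐ K

/-- The two-sided ideal of `Ĥ_m` generated by `f_λ(Y_1)`; for `m = 0` there is no `Y_1`, the
generating set is empty and the ideal is zero. -/
def heckeIdeal (m : ℕ) (lam : residues q →₀ ℕ) : TwoSidedIdeal (AffHecke q m) :=
  TwoSidedIdeal.span {x | ∃ h : 0 < m, x = Polynomial.aeval (AffHecke.Y q ⟨0, h⟩) (cycPoly lam)}

/-- The cyclotomic Hecke algebra `H_m^λ`. -/
def CycHecke (m : ℕ) (lam : residues q →₀ ℕ) : Type u := (heckeIdeal m lam).ringCon.Quotient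

instance (m : ℕ) (lam : residues q →₀ ℕ) : Ring (CycHecke m lam) :=
  inferInstanceAs (Ring (heckeIdeal m lam).ringCon.Quotient)
instance (m : ℕ) (lam : residues q →₀ ℕ) : Algebra K (CycHecke m lam) :=
  inferInstanceAs (Algebra K (heckeIdeal m lam).ringCon.Quotient)

/-- The canonical surjection `ev_{m,λ} : Ĥ_m → H_m^λ`. -/
def CycHecke.ev (m : ℕ) (lam : residues q →₀ ℕ) : AffHecke q m →ₐ[K] CycHecke m lam :=
  (heckeIdeal m lam).ringCon.mkₐ K

end Cyclotomic

/-! ## Parabolic subalgebras -/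

/-- `r`-compositions of `n`: tuples `(μ_1, …, μ_r)` of natural numbers with sum `n`. -/
abbrev Comp (r n : ℕ) : Type := {μ : Fin r → ℕ // ∑ k, μ k = n}

namespace Comp

variable {r n : ℕ} (μ : Comp r n)

/-- The parts of a composition. -/
abbrev part (k : Fin r) : ℕ := μ.1 k

/-- The `a`-th position of the `k`-th block, `μ_1 + ⋯ + μ_{k-1} + a`. -/
def pos : (Σ k : Fin r, Fin (μ.part k)) ≃ Fin n := finSigmaFinEquiv.trans (finCongr μ.2)

/-- `i` and `i + 1` lie in the same block, i.e. the transposition of the two positions lies in the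
Young subgroup. -/
def SameBlock (i : ℕ) (h : i + 1 < n) : Prop :=
  (μ.pos.symm ⟨i, by omega⟩).1 = (μ.pos.symm ⟨i + 1, h⟩).1

end Comp

/-- The subalgebra `Ŷ_{r,μ}` of `Ŷ_{r,n}` generated by all `t_j`, all `X_j` and `X_j⁻¹`, and the `g_i`
for the simple transpositions of the Young subgroup of `μ`. -/
def parabolic {K : Type u} [Field K] {r n : ℕ} (q : Kˣ) (μ : Comp r n) :
    Subalgebra K (AffYok r q n) :=
  Algebra.adjoin K
    ({x | ∃ j, x = AffYok.t r q j} ∪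
     {x | ∃ (j : ℕ) (h : j < n), x = AffYok.X r q j h} ∪
     {x | ∃ (j : ℕ) (h : j < n), x * AffYok.X r q j h = 1 ∧ AffYok.X r q j h * x = 1} ∪
     {x | ∃ (i : ℕ) (h : i + 1 < n), μ.SameBlock i h ∧ x = AffYok.g r q i h})

/-! ## Induction -/

section Induction

variable {K : Type u} [Field K] {A : Type v} [Ring A] [Algebra K A]
  (B : Subalgebra K A) {N : Type w} [AddCommGroup N] [Module K N] (ρ : B →ₐ[K] Module.End K N)

/-- The `A`-submodule of `A ⊗_K N` spanned by all `a b ⊗ z - a ⊗ b z` with `b ∈ B`, where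
`B` acts on `N` through `ρ`. -/
def indRel : Submodule A (A ⊗[K] N) :=
  Submodule.span A {x | ∃ (a : A) (b : B) (z : N), x = (a * (b : A)) ⊗ₜ[K] z - a ⊗ₜ[K] (ρ b z)}

/-- The induced module `Ind_B^A N = A ⊗_B N`, where `N` is the `B`-module given by `ρ`. -/
abbrev Ind : Type max v w := (A ⊗[K] N) ⧸ indRel B ρ

end Induction

/-! ## The module structure on the outer tensor product

To see that the formulas defining the `Ŷ_{r,μ}`-module
`(V_1^{⊗ μ_1} ⊗ L_1) ⊗ ⋯ ⊗ (V_r^{⊗ μ_r} ⊗ L_r)` respect all relations of the subalgebra, this space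
is realised inside a module over the whole algebra `Ŷ_{r,n}`, whose elements are the functions from
the shuffles of type `μ` to the space. -/

section HeckeFacts

variable {K : Type u} [Field K] {q : Kˣ} {m : ℕ}

theorem AffHecke.T_mul_T (i : ℕ) (h : i + 1 < m) :
    AffHecke.T q i h * AffHecke.T q i h =
      1 + ((q : K) - ((q⁻¹ : Kˣ) : K)) • AffHecke.T q i h := by
  have h0 := AffHecke.mk_rel q (HeckeRel.quadratic i h)
  simp only [map_mul, map_sub, map_add, map_zero, AlgHom.commutes] at h0
  change (AffHecke.T q i h - _) * (AffHecke.T q i h + _) = 0 at h0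
  rw [sub_mul, mul_add, mul_add, ← map_mul, Units.mul_inv, map_one,
    ← Algebra.commutes, ← Algebra.smul_def, ← Algebra.smul_def] at h0
  rw [sub_smul]
  rw [← sub_eq_zero, ← h0]
  abel

theorem AffHecke.braid (i : ℕ) (h : i + 1 + 1 < m) :
    AffHecke.T q i (by omega) * AffHecke.T q (i + 1) h * AffHecke.T q i (by omega) =
      AffHecke.T q (i + 1) h * AffHecke.T q i (by omega) * AffHecke.T q (i + 1) h := by
  have h0 := AffHecke.mk_rel q (HeckeRel.braid i h)
  simp only [map_mul] at h0
  exact h0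

theorem AffHecke.far (i j : ℕ) (hi : i + 1 < m) (hj : j + 1 < m)
    (hij : i + 2 ≤ j ∨ j + 2 ≤ i) :
    AffHecke.T q i hi * AffHecke.T q j hj = AffHecke.T q j hj * AffHecke.T q i hi := by
  have h0 := AffHecke.mk_rel q (HeckeRel.far i j hi hj hij)
  simp only [map_mul] at h0
  exact h0

theorem AffHecke.Y_Yinv (j : Fin m) : AffHecke.Y q j * AffHecke.Yinv q j = 1 := by
  have h0 := AffHecke.mk_rel q (HeckeRel.Y_Yinv j)
  simp only [map_mul, map_one] at h0
  exact h0

theorem AffHecke.Yinv_Y (j : Fin m) : AffHecke.Yinv q j * AffHecke.Y q j = 1 := by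
  have h0 := AffHecke.mk_rel q (HeckeRel.Yinv_Y j)
  simp only [map_mul, map_one] at h0
  exact h0

theorem AffHecke.Y_comm (i j : Fin m) :
    AffHecke.Y q i * AffHecke.Y q j = AffHecke.Y q j * AffHecke.Y q i := by
  have h0 := AffHecke.mk_rel q (HeckeRel.Y_comm i j)
  simp only [map_mul] at h0
  exact h0

theorem AffHecke.T_Y_T (i : ℕ) (h : i + 1 < m) :
    AffHecke.T q i h * AffHecke.Y q ⟨i, by omega⟩ * AffHecke.T q i h =
      AffHecke.Y q ⟨i + 1, h⟩ := by
  have h0 := AffHecke.mk_rel q (HeckeRel.T_Y_T i h)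
  simp only [map_mul] at h0
  exact h0

theorem AffHecke.T_Y (i : ℕ) (h : i + 1 < m) (j : Fin m) (h1 : (j : ℕ) ≠ i)
    (h2 : (j : ℕ) ≠ i + 1) :
    AffHecke.T q i h * AffHecke.Y q j = AffHecke.Y q j * AffHecke.T q i h := by
  have h0 := AffHecke.mk_rel q (HeckeRel.T_Y i h j h1 h2)
  simp only [map_mul] at h0
  exact h0

end HeckeFacts

/-- Shuffles of type `μ`: bijections from the positions to the pairs (block, index) which
list the elements of each block in increasing order. -/
abbrev Shuffle {r n : ℕ} (μ : Comp r n) : Type :=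
  {σ : Fin n ≃ (Σ k : Fin r, Fin (μ.part k)) // ∀ k, StrictMono fun a => σ.symm ⟨k, a⟩}

namespace Shuffle

variable {r n : ℕ} {μ : Comp r n}

theorem next (σ : Shuffle μ) {i : ℕ} {h : i + 1 < n}
    (hc : (σ.1 ⟨i, by omega⟩).1 = (σ.1 ⟨i + 1, h⟩).1) :
    ∃ (k : Fin r) (a : ℕ) (ha : a + 1 < μ.part k),
      σ.1 ⟨i, by omega⟩ = ⟨k, a, by omega⟩ ∧ σ.1 ⟨i + 1, h⟩ = ⟨k, a + 1, ha⟩ := by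
  rcases hp : σ.1 ⟨i, by omega⟩ with ⟨k, a⟩
  rcases hp' : σ.1 ⟨i + 1, h⟩ with ⟨k', b⟩
  rw [hp, hp'] at hc
  obtain rfl : k = k' := hc
  have e1 : σ.1.symm ⟨k, a⟩ = ⟨i, by omega⟩ := by rw [← hp]; simp
  have e2 : σ.1.symm ⟨k, b⟩ = ⟨i + 1, h⟩ := by rw [← hp']; simp
  have hab : a < b := by
    rw [← (σ.2 k).lt_iff_lt, e1, e2]; simp [Fin.lt_def]
  have hb : (b : ℕ) = a + 1 := by
    by_contra hne
    have hlt : (a : ℕ) + 1 < b := by have := Fin.lt_def.1 hab; omega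
    have hlt' : (a : ℕ) + 1 < μ.part k := hlt.trans b.2
    have h1 : σ.1.symm ⟨k, a⟩ < σ.1.symm ⟨k, ⟨a + 1, hlt'⟩⟩ :=
      σ.2 k (Fin.lt_def.2 (by simp))
    have h2 : σ.1.symm ⟨k, ⟨a + 1, hlt'⟩⟩ < σ.1.symm ⟨k, b⟩ :=
      σ.2 k (Fin.lt_def.2 hlt)
    rw [e1] at h1
    rw [e2] at h2
    have h1' := Fin.lt_def.1 h1
    have h2' := Fin.lt_def.1 h2
    simp only at h1' h2'
    omega
  refine ⟨k, a, by have := b.2; omega, hp, ?_⟩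
  congr 1
  exact Fin.ext hb

/-- Exchange the entries at the positions `i` and `i + 1` if they lie in different blocks. -/
def swap (i : ℕ) (h : i + 1 < n) (σ : Shuffle μ) : Shuffle μ :=
  if hc : (σ.1 ⟨i, by omega⟩).1 = (σ.1 ⟨i + 1, h⟩).1 then σ else
  ⟨(Equiv.swap ⟨i, by omega⟩ ⟨i + 1, h⟩).trans σ.1, by
    intro k a b hab
    have h0 := σ.2 k hab
    simp only [Equiv.symm_trans_apply, Equiv.symm_swap] at h0 ⊢
    have key : ¬ (σ.1.symm ⟨k, a⟩ = ⟨i, by omega⟩ ∧ σ.1.symm ⟨k, b⟩ = ⟨i + 1, h⟩) := by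
      rintro ⟨h1, h2⟩
      apply hc
      rw [← h1, ← h2]
      simp
    generalize σ.1.symm ⟨k, a⟩ = x at *
    generalize σ.1.symm ⟨k, b⟩ = y at *
    simp only [Equiv.swap_apply_def, Fin.ext_iff, Fin.lt_def] at *
    split_ifs <;> simp_all <;> omega⟩

theorem swap_apply {i : ℕ} {h : i + 1 < n} {σ : Shuffle μ}
    (hc : (σ.1 ⟨i, by omega⟩).1 ≠ (σ.1 ⟨i + 1, h⟩).1) (j : Fin n) :
    (swap i h σ).1 j = σ.1 (Equiv.swap ⟨i, by omega⟩ ⟨i + 1, h⟩ j) := by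
  rw [swap, dif_neg hc]; rfl

end Shuffle

/-- The shuffle in which the blocks appear one after the other. -/
def Shuffle.std {r n : ℕ} (μ : Comp r n) : Shuffle μ :=
  ⟨μ.pos.symm, by
    intro k a b hab
    have := Fin.lt_def.1 hab
    simp only [Equiv.symm_symm, Comp.pos, Equiv.trans_apply, Fin.lt_def, finCongr_apply,
      Fin.val_cast, finSigmaFinEquiv_apply]
    omega⟩

section ShuffleModule

variable {K : Type u} [Field K] {r n : ℕ} {q : Kˣ} {μ : Comp r n}
  {W : Type w} [AddCommGroup W] [Module K W]
  (ζ : Fin r → K) (op : ∀ k, AffHecke q (μ.part k) →ₐ[K] Module.End K W)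

/-- The operator of `T_a` of the block `k`, and `0` if `a` is the last index of the block. -/
def Top (p : Σ k : Fin r, Fin (μ.part k)) : Module.End K W :=
  if h : (p.2 : ℕ) + 1 < μ.part p.1 then op p.1 (AffHecke.T q p.2 h) else 0

/-- The operator of `Y_a` of the block `k`. -/
def Yop (p : Σ k : Fin r, Fin (μ.part k)) : Module.End K W := op p.1 (AffHecke.Y q p.2)

/-- The operator of `Y_a⁻¹` of the block `k`. -/
def Yiop (p : Σ k : Fin r, Fin (μ.part k)) : Module.End K W := op p.1 (AffHecke.Yinv q p.2)

/-- `t_j` on functions on shuffles. -/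
def tS (j : Fin n) : Module.End K (Shuffle μ → W) where
  toFun f σ := ζ (σ.1 j).1 • f σ
  map_add' f f' := by ext σ; simp
  map_smul' c f := by ext σ; exact smul_comm _ _ _

open Classical in
/-- `g_i` on functions on shuffles. -/
def gS (i : ℕ) (h : i + 1 < n) : Module.End K (Shuffle μ → W) where
  toFun f σ := if (σ.1 ⟨i, by omega⟩).1 = (σ.1 ⟨i + 1, h⟩).1 then
    Top op (σ.1 ⟨i, by omega⟩) (f σ) else f (σ.swap i h)
  map_add' f f' := by ext σ; simp only [Pi.add_apply]; split_ifs <;> simp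
  map_smul' c f := by ext σ; simp only [Pi.smul_apply]; split_ifs <;> simp

/-- `X_j` on functions on shuffles. -/
def XS (j : Fin n) : Module.End K (Shuffle μ → W) where
  toFun f σ := Yop op (σ.1 j) (f σ)
  map_add' f f' := by ext σ; simp
  map_smul' c f := by ext σ; simp

/-- `X_j⁻¹` on functions on shuffles. -/
def XiS (j : Fin n) : Module.End K (Shuffle μ → W) where
  toFun f σ := Yiop op (σ.1 j) (f σ)
  map_add' f f' := by ext σ; simp
  map_smul' c f := by ext σ; simp

theorem tS_apply (j : Fin n) (f : Shuffle μ → W) (σ : Shuffle μ) :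
    tS (K := K) ζ j f σ = ζ (σ.1 j).1 • f σ := rfl

theorem XS_apply (j : Fin n) (f : Shuffle μ → W) (σ : Shuffle μ) :
    XS op j f σ = Yop op (σ.1 j) (f σ) := rfl

theorem XiS_apply (j : Fin n) (f : Shuffle μ → W) (σ : Shuffle μ) :
    XiS op j f σ = Yiop op (σ.1 j) (f σ) := rfl

theorem gS_same {i : ℕ} {h : i + 1 < n} {σ : Shuffle μ} (f : Shuffle μ → W)
    (hc : (σ.1 ⟨i, by omega⟩).1 = (σ.1 ⟨i + 1, h⟩).1) :
    gS op i h f σ = Top op (σ.1 ⟨i, by omega⟩) (f σ) := if_pos hc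

theorem gS_diff {i : ℕ} {h : i + 1 < n} {σ : Shuffle μ} (f : Shuffle μ → W)
    (hc : (σ.1 ⟨i, by omega⟩).1 ≠ (σ.1 ⟨i + 1, h⟩).1) :
    gS op i h f σ = f (σ.swap i h) := if_neg hc

theorem tS_pow (j : Fin n) (s : ℕ) (f : Shuffle μ → W) (σ : Shuffle μ) :
    (tS (K := K) ζ j ^ s) f σ = ζ (σ.1 j).1 ^ s • f σ := by
  induction s generalizing f with
  | zero => simp
  | succ s ih => rw [pow_succ, Module.End.mul_apply, ih, tS_apply, smul_smul, pow_succ]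

open Classical in
theorem sum_roots {r : ℕ} (hr : (r : K) ≠ 0) {a b : K} (ha : a ^ r = 1) (hb : b ^ r = 1) :
    (r : K)⁻¹ * ∑ s ∈ Finset.range r, a ^ s * b ^ (r - s) = if a = b then 1 else 0 := by
  split_ifs with hab
  · subst hab
    have : ∀ s ∈ Finset.range r, a ^ s * a ^ (r - s) = 1 := by
      intro s hs
      have := Finset.mem_range.1 hs
      rw [← pow_add, Nat.add_sub_cancel' this.le, ha]
    rw [Finset.sum_congr rfl this]
    simp [hr]
  · have h1 := (Commute.all a b).geom_sum₂_mul r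
    rw [ha, hb, sub_self] at h1
    have h2 := (mul_eq_zero.1 h1).resolve_right (sub_ne_zero.2 hab)
    have : ∑ s ∈ Finset.range r, a ^ s * b ^ (r - s) =
        b * ∑ s ∈ Finset.range r, a ^ s * b ^ (r - 1 - s) := by
      rw [Finset.mul_sum]
      refine Finset.sum_congr rfl fun s hs => ?_
      have := Finset.mem_range.1 hs
      rw [show r - s = (r - 1 - s) + 1 by omega, pow_succ]
      ring
    rw [this, h2]; simp

section Relations

variable {op}

theorem Top_succ {k : Fin r} {a : ℕ} (ha : a + 1 < μ.part k) :
    Top op ⟨k, a, by omega⟩ = op k (AffHecke.T q a ha) := dif_pos ha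

theorem swap_same_iff {i : ℕ} {h : i + 1 < n} {σ : Shuffle μ}
    (hc : (σ.1 ⟨i, by omega⟩).1 ≠ (σ.1 ⟨i + 1, h⟩).1) :
    ((σ.swap i h).1 ⟨i, by omega⟩).1 ≠ ((σ.swap i h).1 ⟨i + 1, h⟩).1 := by
  rw [Shuffle.swap_apply hc, Shuffle.swap_apply hc]
  simpa using hc.symm

theorem swap_swap {i : ℕ} {h : i + 1 < n} {σ : Shuffle μ}
    (hc : (σ.1 ⟨i, by omega⟩).1 ≠ (σ.1 ⟨i + 1, h⟩).1) :
    (σ.swap i h).swap i h = σ := by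
  apply Subtype.ext; apply Equiv.ext; intro j
  rw [Shuffle.swap_apply (swap_same_iff hc), Shuffle.swap_apply hc]
  simp

theorem Top_comm_Top (hop : ∀ k l, k ≠ l → ∀ x y, Commute (op k x) (op l y))
    {k l : Fin r} {a b : ℕ} (ha : a + 1 < μ.part k) (hb : b + 1 < μ.part l)
    (h : k = l → a + 2 ≤ b ∨ b + 2 ≤ a) :
    Commute (Top op ⟨k, a, by omega⟩) (Top op ⟨l, b, by omega⟩) := by
  rw [Top_succ ha, Top_succ hb]
  by_cases hkl : k = l
  · subst hkl
    change _ * _ = _ * _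
    rw [← map_mul, ← map_mul, AffHecke.far _ _ _ _ (h rfl)]
  · exact hop _ _ hkl _ _

theorem Top_comm_Yop (hop : ∀ k l, k ≠ l → ∀ x y, Commute (op k x) (op l y))
    {k l : Fin r} {a : ℕ} {b : Fin (μ.part l)} (ha : a + 1 < μ.part k)
    (h : k = l → (b : ℕ) ≠ a ∧ (b : ℕ) ≠ a + 1) :
    Commute (Top op ⟨k, a, by omega⟩) (Yop op ⟨l, b⟩) := by
  rw [Top_succ ha]
  by_cases hkl : k = l
  · subst hkl
    change _ * op k _ = op k _ * _
    rw [← map_mul, ← map_mul, AffHecke.T_Y _ _ _ (h rfl).1 (h rfl).2]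
  · exact hop _ _ hkl _ _

theorem Yop_comm_Yop (hop : ∀ k l, k ≠ l → ∀ x y, Commute (op k x) (op l y))
    (p p' : Σ k : Fin r, Fin (μ.part k)) :
    Commute (Yop op p) (Yop op p') := by
  obtain ⟨k, a⟩ := p
  obtain ⟨l, b⟩ := p'
  by_cases hkl : k = l
  · subst hkl
    change op k _ * op k _ = op k _ * op k _
    rw [← map_mul, ← map_mul, AffHecke.Y_comm]
  · exact hop _ _ hkl _ _

theorem gS_far (hop : ∀ k l, k ≠ l → ∀ x y, Commute (op k x) (op l y))
    (i j : ℕ) (hi : i + 1 < n) (hj : j + 1 < n) (hij : i + 2 ≤ j ∨ j + 2 ≤ i) :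
    gS op i hi * gS op j hj = gS op j hj * gS op i hi := by
  refine LinearMap.ext fun f => funext fun σ => ?_
  simp only [Module.End.mul_apply]
  have e1 : ∀ x : Fin n, x = ⟨j, by omega⟩ ∨ x = ⟨j + 1, hj⟩ →
      Equiv.swap (⟨i, by omega⟩ : Fin n) ⟨i + 1, hi⟩ x = x := by
    rintro x (rfl | rfl) <;> apply Equiv.swap_apply_of_ne_of_ne <;> simp only [ne_eq, Fin.ext_iff] <;> omega
  have e2 : ∀ x : Fin n, x = ⟨i, by omega⟩ ∨ x = ⟨i + 1, hi⟩ →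
      Equiv.swap (⟨j, by omega⟩ : Fin n) ⟨j + 1, hj⟩ x = x := by
    rintro x (rfl | rfl) <;> apply Equiv.swap_apply_of_ne_of_ne <;> simp only [ne_eq, Fin.ext_iff] <;> omega
  by_cases hci : (σ.1 ⟨i, by omega⟩).1 = (σ.1 ⟨i + 1, hi⟩).1 <;>
  by_cases hcj : (σ.1 ⟨j, by omega⟩).1 = (σ.1 ⟨j + 1, hj⟩).1
  · rw [gS_same _ _ hci, gS_same _ _ hcj, gS_same _ _ hcj, gS_same _ _ hci]
    obtain ⟨k, a, ha, h1, h2⟩ := σ.next hci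
    obtain ⟨l, b, hb, h3, h4⟩ := σ.next hcj
    rw [h1, h3]
    refine LinearMap.congr_fun (Top_comm_Top hop ha hb ?_).eq (f σ)
    rintro rfl
    have n1 : a ≠ b := by
      rintro rfl
      have := σ.1.injective (h1.trans h3.symm)
      simp only [Fin.mk.injEq] at this; omega
    have n2 : a + 1 ≠ b := by
      rintro rfl
      have := σ.1.injective (h2.trans h3.symm)
      simp only [Fin.mk.injEq] at this; omega
    have n3 : b + 1 ≠ a := by
      rintro rfl
      have := σ.1.injective (h1.trans h4.symm)
      simp only [Fin.mk.injEq] at this; omega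
    omega
  · have hci' : ((σ.swap j hj).1 ⟨i, by omega⟩).1 = ((σ.swap j hj).1 ⟨i + 1, hi⟩).1 := by
      rw [Shuffle.swap_apply hcj, Shuffle.swap_apply hcj, e2 _ (by simp), e2 _ (by simp), hci]
    rw [gS_same _ _ hci, gS_diff _ _ hcj, gS_diff _ _ hcj, gS_same _ _ hci',
      Shuffle.swap_apply hcj, e2 _ (by simp)]
  · have hcj' : ((σ.swap i hi).1 ⟨j, by omega⟩).1 = ((σ.swap i hi).1 ⟨j + 1, hj⟩).1 := by
      rw [Shuffle.swap_apply hci, Shuffle.swap_apply hci, e1 _ (by simp), e1 _ (by simp), hcj]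
    rw [gS_same _ _ hcj, gS_diff _ _ hci, gS_diff _ _ hci, gS_same _ _ hcj',
      Shuffle.swap_apply hci, e1 _ (by simp)]
  · have hci' : ((σ.swap j hj).1 ⟨i, by omega⟩).1 ≠ ((σ.swap j hj).1 ⟨i + 1, hi⟩).1 := by
      rw [Shuffle.swap_apply hcj, Shuffle.swap_apply hcj, e2 _ (by simp), e2 _ (by simp)]
      exact hci
    have hcj' : ((σ.swap i hi).1 ⟨j, by omega⟩).1 ≠ ((σ.swap i hi).1 ⟨j + 1, hj⟩).1 := by
      rw [Shuffle.swap_apply hci, Shuffle.swap_apply hci, e1 _ (by simp), e1 _ (by simp)]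
      exact hcj
    rw [gS_diff _ _ hci, gS_diff _ _ hcj', gS_diff _ _ hcj, gS_diff _ _ hci']
    congr 1
    apply Subtype.ext; apply Equiv.ext; intro x
    rw [Shuffle.swap_apply hcj', Shuffle.swap_apply hci, Shuffle.swap_apply hci',
      Shuffle.swap_apply hcj]
    congr 1
    by_cases hx : x = ⟨j, by omega⟩ ∨ x = ⟨j + 1, hj⟩
    · rw [e1 x hx]
      rcases hx with rfl | rfl
      · rw [Equiv.swap_apply_left, e1 _ (by simp)]
      · rw [Equiv.swap_apply_right, e1 _ (by simp)]
    · simp only [not_or] at hx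
      rw [Equiv.swap_apply_of_ne_of_ne hx.1 hx.2]
      by_cases hx' : x = ⟨i, by omega⟩ ∨ x = ⟨i + 1, hi⟩
      · rcases hx' with rfl | rfl
        · rw [Equiv.swap_apply_left, e2 _ (by simp)]
        · rw [Equiv.swap_apply_right, e2 _ (by simp)]
      · simp only [not_or] at hx'
        rw [Equiv.swap_apply_of_ne_of_ne hx'.1 hx'.2, Equiv.swap_apply_of_ne_of_ne hx.1 hx.2]

theorem gS_braid (i : ℕ) (h : i + 1 + 1 < n) :
    gS op i (by omega) * gS op (i + 1) h * gS op i (by omega) =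
      gS op (i + 1) h * gS op i (by omega) * gS op (i + 1) h := by
  refine LinearMap.ext fun f => funext fun σ => ?_
  simp only [Module.End.mul_apply]
  have h' : i + 1 < n := by omega
  -- positions
  have sl : ∀ τ : Shuffle μ, (τ.1 ⟨i, by omega⟩).1 ≠ (τ.1 ⟨i + 1, h'⟩).1 →
      (τ.swap i h').1 ⟨i, by omega⟩ = τ.1 ⟨i + 1, h'⟩ ∧
      (τ.swap i h').1 ⟨i + 1, h'⟩ = τ.1 ⟨i, by omega⟩ ∧
      (τ.swap i h').1 ⟨i + 1 + 1, h⟩ = τ.1 ⟨i + 1 + 1, h⟩ := by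
    intro τ hc
    refine ⟨?_, ?_, ?_⟩
    · rw [Shuffle.swap_apply hc, Equiv.swap_apply_left]
    · rw [Shuffle.swap_apply hc, Equiv.swap_apply_right]
    · rw [Shuffle.swap_apply hc, Equiv.swap_apply_of_ne_of_ne] <;> simp [Fin.ext_iff]; omega
  have sr : ∀ τ : Shuffle μ, (τ.1 ⟨i + 1, h'⟩).1 ≠ (τ.1 ⟨i + 1 + 1, h⟩).1 →
      (τ.swap (i + 1) h).1 ⟨i, by omega⟩ = τ.1 ⟨i, by omega⟩ ∧
      (τ.swap (i + 1) h).1 ⟨i + 1, h'⟩ = τ.1 ⟨i + 1 + 1, h⟩ ∧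
      (τ.swap (i + 1) h).1 ⟨i + 1 + 1, h⟩ = τ.1 ⟨i + 1, h'⟩ := by
    intro τ hc
    refine ⟨?_, ?_, ?_⟩
    · rw [Shuffle.swap_apply hc, Equiv.swap_apply_of_ne_of_ne] <;> simp [Fin.ext_iff]; omega
    · rw [Shuffle.swap_apply hc, Equiv.swap_apply_left]
    · rw [Shuffle.swap_apply hc, Equiv.swap_apply_right]
  by_cases h01 : (σ.1 ⟨i, by omega⟩).1 = (σ.1 ⟨i + 1, h'⟩).1
  · by_cases h12 : (σ.1 ⟨i + 1, h'⟩).1 = (σ.1 ⟨i + 1 + 1, h⟩).1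
    · rw [gS_same _ _ h01, gS_same _ _ h12, gS_same _ _ h01, gS_same _ _ h12, gS_same _ _ h01,
        gS_same _ _ h12]
      obtain ⟨k, a, ha, e0, e1⟩ := σ.next h01
      obtain ⟨l, b, hb, e2, e3⟩ := σ.next h12
      rw [e1] at e2
      obtain rfl : k = l := congrArg Sigma.fst e2
      obtain rfl : a + 1 = b := by
        have := eq_of_heq (Sigma.mk.inj_iff.1 e2).2
        simpa using this
      rw [e0, e1, Top_succ ha, Top_succ hb]
      simp only [← Module.End.mul_apply, ← map_mul]
      rw [← mul_assoc, ← mul_assoc, AffHecke.braid]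
    · have c1 := sr σ h12
      have h02 : (σ.1 ⟨i, by omega⟩).1 ≠ (σ.1 ⟨i + 1 + 1, h⟩).1 := by rw [h01]; exact h12
      have d1 : ((σ.swap (i + 1) h).1 ⟨i, by omega⟩).1 ≠ ((σ.swap (i + 1) h).1 ⟨i + 1, h'⟩).1 := by
        rw [c1.1, c1.2.1]; exact h02
      have c2 := sl _ d1
      have d2 : (((σ.swap (i + 1) h).swap i h').1 ⟨i + 1, h'⟩).1 =
          (((σ.swap (i + 1) h).swap i h').1 ⟨i + 1 + 1, h⟩).1 := by
        rw [c2.2.1, c2.2.2, c1.1, c1.2.2]; exact h01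
      rw [gS_same _ _ h01, gS_diff _ _ h12, gS_diff _ _ d1,
        gS_diff _ _ h12, gS_diff _ _ d1, gS_same _ _ d2, c2.2.1, c1.1]
  · by_cases h12 : (σ.1 ⟨i + 1, h'⟩).1 = (σ.1 ⟨i + 1 + 1, h⟩).1
    · have c1 := sl σ h01
      have h02 : (σ.1 ⟨i, by omega⟩).1 ≠ (σ.1 ⟨i + 1 + 1, h⟩).1 := by rw [← h12]; exact h01
      have d1 : ((σ.swap i h').1 ⟨i + 1, h'⟩).1 ≠ ((σ.swap i h').1 ⟨i + 1 + 1, h⟩).1 := by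
        rw [c1.2.1, c1.2.2]; exact h02
      have c2 := sr _ d1
      have d2 : (((σ.swap i h').swap (i + 1) h).1 ⟨i, by omega⟩).1 =
          (((σ.swap i h').swap (i + 1) h).1 ⟨i + 1, h'⟩).1 := by
        rw [c2.1, c2.2.1, c1.1, c1.2.2]; exact h12
      rw [gS_diff _ _ h01, gS_diff _ _ d1, gS_same _ _ d2,
        gS_same _ _ h12, gS_diff _ _ h01, gS_diff _ _ d1, c2.1, c1.1]
    · have c1 := sl σ h01
      have c1' := sr σ h12
      by_cases h02 : (σ.1 ⟨i, by omega⟩).1 = (σ.1 ⟨i + 1 + 1, h⟩).1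
      · have d1 : ((σ.swap i h').1 ⟨i + 1, h'⟩).1 = ((σ.swap i h').1 ⟨i + 1 + 1, h⟩).1 := by
          rw [c1.2.1, c1.2.2]; exact h02
        have d1' : ((σ.swap (i + 1) h).1 ⟨i, by omega⟩).1 =
            ((σ.swap (i + 1) h).1 ⟨i + 1, h'⟩).1 := by
          rw [c1'.1, c1'.2.1]; exact h02
        rw [gS_diff _ _ h01, gS_same _ _ d1, gS_diff _ _ (swap_same_iff h01), swap_swap h01,
          gS_diff _ _ h12, gS_same _ _ d1', gS_diff _ _ (swap_same_iff h12), swap_swap h12,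
          c1.2.1, c1'.1]
      · have d1 : ((σ.swap i h').1 ⟨i + 1, h'⟩).1 ≠ ((σ.swap i h').1 ⟨i + 1 + 1, h⟩).1 := by
          rw [c1.2.1, c1.2.2]; exact h02
        have d1' : ((σ.swap (i + 1) h).1 ⟨i, by omega⟩).1 ≠
            ((σ.swap (i + 1) h).1 ⟨i + 1, h'⟩).1 := by
          rw [c1'.1, c1'.2.1]; exact h02
        have c2 := sr _ d1
        have c2' := sl _ d1'
        have d2 : (((σ.swap i h').swap (i + 1) h).1 ⟨i, by omega⟩).1 ≠
            (((σ.swap i h').swap (i + 1) h).1 ⟨i + 1, h'⟩).1 := by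
          rw [c2.1, c2.2.1, c1.1, c1.2.2]; exact h12
        have d2' : (((σ.swap (i + 1) h).swap i h').1 ⟨i + 1, h'⟩).1 ≠
            (((σ.swap (i + 1) h).swap i h').1 ⟨i + 1 + 1, h⟩).1 := by
          rw [c2'.2.1, c2'.2.2, c1'.1, c1'.2.2]; exact h01
        rw [gS_diff _ _ h01, gS_diff _ _ d1, gS_diff _ _ d2,
          gS_diff _ _ h12, gS_diff _ _ d1', gS_diff _ _ d2']
        congr 1
        have c3 := sl _ d2
        have c3' := sr _ d2'
        apply Subtype.ext; apply Equiv.ext; intro x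
        by_cases x0 : x = ⟨i, by omega⟩
        · rw [x0, c3.1, c3'.1, c2.2.1, c1.2.2, c2'.1, c1'.2.1]
        by_cases x1 : x = ⟨i + 1, h'⟩
        · rw [x1, c3.2.1, c3'.2.1, c2.1, c1.1, c2'.2.2, c1'.2.2]
        by_cases x2 : x = ⟨i + 1 + 1, h⟩
        · rw [x2, c3.2.2, c3'.2.2, c2.2.2, c1.2.1, c2'.2.1, c1'.1]
        rw [Shuffle.swap_apply d2, Shuffle.swap_apply d1, Shuffle.swap_apply h01,
          Shuffle.swap_apply d2', Shuffle.swap_apply d1', Shuffle.swap_apply h12]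
        simp only [Equiv.swap_apply_of_ne_of_ne x0 x1, Equiv.swap_apply_of_ne_of_ne x1 x2]

theorem gS_tS (i : ℕ) (h : i + 1 < n) (j : Fin n) :
    gS op i h * tS ζ j = tS ζ (Equiv.swap ⟨i, by omega⟩ ⟨i + 1, h⟩ j) * gS op i h := by
  refine LinearMap.ext fun f => funext fun σ => ?_
  simp only [Module.End.mul_apply]
  by_cases hc : (σ.1 ⟨i, by omega⟩).1 = (σ.1 ⟨i + 1, h⟩).1
  · rw [tS_apply, gS_same _ _ hc, gS_same _ _ hc, tS_apply, map_smul]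
    congr 2
    by_cases x0 : j = ⟨i, by omega⟩
    · rw [x0, Equiv.swap_apply_left, hc]
    by_cases x1 : j = ⟨i + 1, h⟩
    · rw [x1, Equiv.swap_apply_right, hc]
    rw [Equiv.swap_apply_of_ne_of_ne x0 x1]
  · rw [tS_apply, gS_diff _ _ hc, gS_diff _ _ hc, tS_apply, Shuffle.swap_apply hc]

theorem gS_sq (hr : (r : K) ≠ 0) (hζ : Function.Injective ζ) (hζr : ∀ k, ζ k ^ r = 1)
    (i : ℕ) (h : i + 1 < n) :
    gS op i h ^ 2 = 1 + ((q : K) - ((q⁻¹ : Kˣ) : K)) •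
      (((r : K)⁻¹ • ∑ s ∈ Finset.range r,
        tS ζ ⟨i, by omega⟩ ^ s * tS ζ ⟨i + 1, h⟩ ^ (r - s)) * gS op i h) := by
  refine LinearMap.ext fun f => funext fun σ => ?_
  have he : ∀ f' : Shuffle μ → W, ((r : K)⁻¹ • ∑ s ∈ Finset.range r,
      (tS (K := K) ζ ⟨i, by omega⟩ : Module.End K (Shuffle μ → W)) ^ s *
        tS (K := K) ζ ⟨i + 1, h⟩ ^ (r - s) : Module.End K (Shuffle μ → W)) f' σ =
      ((r : K)⁻¹ * ∑ s ∈ Finset.range r,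
        ζ (σ.1 ⟨i, by omega⟩).1 ^ s * ζ (σ.1 ⟨i + 1, h⟩).1 ^ (r - s)) • f' σ := by
    intro f'
    rw [LinearMap.smul_apply, Pi.smul_apply, LinearMap.sum_apply, Finset.sum_apply, mul_smul,
      Finset.sum_smul]
    congr 1
    refine Finset.sum_congr rfl fun s _ => ?_
    rw [Module.End.mul_apply, tS_pow, tS_pow, smul_smul]
  rw [sq, LinearMap.add_apply, Pi.add_apply, LinearMap.smul_apply, Pi.smul_apply,
    Module.End.mul_apply, Module.End.mul_apply, he, sum_roots hr (hζr _) (hζr _)]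
  by_cases hc : (σ.1 ⟨i, by omega⟩).1 = (σ.1 ⟨i + 1, h⟩).1
  · rw [if_pos (by rw [hc]), gS_same _ _ hc, gS_same _ _ hc, one_smul, Module.End.one_apply]
    obtain ⟨k, a, ha, e0, -⟩ := σ.next hc
    rw [e0, Top_succ ha, ← Module.End.mul_apply, ← map_mul, AffHecke.T_mul_T]
    simp
  · rw [if_neg (fun h' => hc (hζ h')), gS_diff _ _ hc, gS_diff _ _ (swap_same_iff hc),
      swap_swap hc]
    simp

theorem XS_XiS (j : Fin n) : XS op j * XiS op j = 1 := by
  refine LinearMap.ext fun f => funext fun σ => ?_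
  rw [Module.End.mul_apply, XS_apply, XiS_apply, Yop, Yiop, ← Module.End.mul_apply, ← map_mul,
    AffHecke.Y_Yinv, map_one]
  rfl

theorem XiS_XS (j : Fin n) : XiS op j * XS op j = 1 := by
  refine LinearMap.ext fun f => funext fun σ => ?_
  rw [Module.End.mul_apply, XiS_apply, XS_apply, Yop, Yiop, ← Module.End.mul_apply, ← map_mul,
    AffHecke.Yinv_Y, map_one]
  rfl

theorem gS_XS_gS (i : ℕ) (h : i + 1 < n) :
    gS op i h * XS op ⟨i, by omega⟩ * gS op i h = XS op ⟨i + 1, h⟩ := by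
  refine LinearMap.ext fun f => funext fun σ => ?_
  simp only [Module.End.mul_apply]
  by_cases hc : (σ.1 ⟨i, by omega⟩).1 = (σ.1 ⟨i + 1, h⟩).1
  · rw [gS_same _ _ hc, XS_apply, gS_same _ _ hc, XS_apply]
    obtain ⟨k, a, ha, e0, e1⟩ := σ.next hc
    rw [e0, e1, Top_succ ha]
    simp only [Yop]
    rw [← AffHecke.T_Y_T, map_mul, map_mul]
    rfl
  · rw [gS_diff _ _ hc, XS_apply, gS_diff _ _ (swap_same_iff hc), swap_swap hc, XS_apply,
      Shuffle.swap_apply hc, Equiv.swap_apply_left]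

theorem XS_comm (hop : ∀ k l, k ≠ l → ∀ x y, Commute (op k x) (op l y)) (i j : Fin n) :
    XS op i * XS op j = XS op j * XS op i := by
  refine LinearMap.ext fun f => funext fun σ => ?_
  exact LinearMap.congr_fun (Yop_comm_Yop hop (σ.1 i) (σ.1 j)).eq (f σ)

theorem gS_XS (hop : ∀ k l, k ≠ l → ∀ x y, Commute (op k x) (op l y))
    (i : ℕ) (h : i + 1 < n) (j : Fin n) (h0 : (j : ℕ) ≠ i) (h1 : (j : ℕ) ≠ i + 1) :
    gS op i h * XS op j = XS op j * gS op i h := by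
  refine LinearMap.ext fun f => funext fun σ => ?_
  simp only [Module.End.mul_apply]
  by_cases hc : (σ.1 ⟨i, by omega⟩).1 = (σ.1 ⟨i + 1, h⟩).1
  · rw [gS_same _ _ hc, XS_apply, XS_apply, gS_same _ _ hc]
    obtain ⟨k, a, ha, e0, e1⟩ := σ.next hc
    rcases e2 : σ.1 j with ⟨l, b⟩
    rw [e0]
    refine LinearMap.congr_fun (Top_comm_Yop hop ha ?_).eq (f σ)
    rintro rfl
    constructor
    · intro hb
      have e3 : σ.1 ⟨i, by omega⟩ = σ.1 j := by
        rw [e0, e2]; congr 1; exact Fin.ext hb.symm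
      exact h0 (congrArg Fin.val (σ.1.injective e3)).symm
    · intro hb
      have e3 : σ.1 ⟨i + 1, h⟩ = σ.1 j := by
        rw [e1, e2]; congr 1; exact Fin.ext hb.symm
      exact h1 (congrArg Fin.val (σ.1.injective e3)).symm
  · rw [gS_diff _ _ hc, XS_apply, XS_apply, gS_diff _ _ hc, Shuffle.swap_apply hc,
      Equiv.swap_apply_of_ne_of_ne]
    · simpa [Fin.ext_iff] using h0
    · simpa [Fin.ext_iff] using h1

theorem tS_XS (i j : Fin n) : tS ζ i * XS op j = XS op j * tS ζ i := by
  refine LinearMap.ext fun f => funext fun σ => ?_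
  simp [Module.End.mul_apply, tS_apply, XS_apply]

end Relations

/-- Values of the generators. -/
def genS : YokGen n → Module.End K (Shuffle μ → W)
  | .t j => tS ζ j
  | .g i h => gS op i h
  | .X h => XS op ⟨0, h⟩
  | .Xinv h => XiS op ⟨0, h⟩

theorem genS_rel (hr : (r : K) ≠ 0) (hζ : Function.Injective ζ) (hζr : ∀ k, ζ k ^ r = 1)
    (hop : ∀ k l, k ≠ l → ∀ x y, Commute (op k x) (op l y))
    ⦃x y : FreeAlgebra K (YokGen n)⦄ (h : YokRel r q n x y) :
    FreeAlgebra.lift K (genS ζ op) x = FreeAlgebra.lift K (genS ζ op) y := by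
  cases h with
  | far i j hi hj hij =>
    simpa [genS] using gS_far hop i j hi hj hij
  | braid i h => simpa [genS] using gS_braid i h
  | t_comm i j =>
    simp only [map_mul, FreeAlgebra.lift_ι_apply, genS]
    refine LinearMap.ext fun f => funext fun σ => ?_
    simp only [Module.End.mul_apply, tS_apply]
    exact smul_comm _ _ _
  | g_t i h j => simpa [genS] using gS_tS ζ i h j
  | t_pow j =>
    simp only [map_pow, map_one, FreeAlgebra.lift_ι_apply, genS]
    refine LinearMap.ext fun f => funext fun σ => ?_
    rw [tS_pow, hζr]; simp
  | quadratic i h =>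
    simp only [map_pow, map_one, map_add, map_mul, map_smul, map_sum, YokRel.e,
      FreeAlgebra.lift_ι_apply, genS]
    exact gS_sq ζ hr hζ hζr i h
  | X_Xinv h => simpa [genS] using XS_XiS (op := op) ⟨0, h⟩
  | Xinv_X h => simpa [genS] using XiS_XS (op := op) ⟨0, h⟩
  | g_X_g_X h =>
    simp only [map_mul, FreeAlgebra.lift_ι_apply, genS]
    have h1 := gS_XS_gS (op := op) 0 h
    rw [h1, XS_comm hop, ← h1]
    simp only [mul_assoc]
  | g_X i h hi =>
    simp only [map_mul, FreeAlgebra.lift_ι_apply, genS]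
    exact gS_XS hop i h _ (by simp; omega) (by simp)
  | t_X j h => simpa [genS] using tS_XS ζ j ⟨0, h⟩

end ShuffleModule

open Classical in
/-- The functions supported at the standard shuffle. -/
def stdIncl (K : Type u) [Field K] {r n : ℕ} (μ : Comp r n) (W : Type w) [AddCommGroup W] [Module K W] :
    W →ₗ[K] (Shuffle μ → W) := LinearMap.single K (fun _ => W) (Shuffle.std μ)

/-- Evaluation at the standard shuffle. -/
def stdEval (K : Type u) [Field K] {r n : ℕ} (μ : Comp r n) (W : Type w) [AddCommGroup W] [Module K W] :
    (Shuffle μ → W) →ₗ[K] W := LinearMap.proj (Shuffle.std μ)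

section ParabolicRep

variable {K : Type u} [Field K] {r n : ℕ} {q : Kˣ} {μ : Comp r n}
  {W : Type w} [AddCommGroup W] [Module K W]
  {ζ : Fin r → K} {op : ∀ k, AffHecke q (μ.part k) →ₐ[K] Module.End K W}
  (hr : (r : K) ≠ 0) (hζ : Function.Injective ζ) (hζr : ∀ k, ζ k ^ r = 1)
  (hop : ∀ k l, k ≠ l → ∀ x y, Commute (op k x) (op l y))

/-- The action of `Ŷ_{r,n}` on the functions on shuffles. -/
def shuffleRep : AffYok r q n →ₐ[K] Module.End K (Shuffle μ → W) :=
  RingQuot.liftAlgHom K ⟨FreeAlgebra.lift K (genS ζ op), genS_rel ζ op hr hζ hζr hop⟩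

theorem shuffleRep_mk (x : FreeAlgebra K (YokGen n)) :
    shuffleRep hr hζ hζr hop (AffYok.mk r q n x) = FreeAlgebra.lift K (genS ζ op) x :=
  RingQuot.liftAlgHom_mkAlgHom_apply K _ _ x

theorem shuffleRep_t (j : Fin n) : shuffleRep hr hζ hζr hop (AffYok.t r q j) = tS ζ j :=
  (shuffleRep_mk ..).trans (FreeAlgebra.lift_ι_apply ..)

theorem shuffleRep_g (i : ℕ) (h : i + 1 < n) :
    shuffleRep hr hζ hζr hop (AffYok.g r q i h) = gS op i h :=
  (shuffleRep_mk ..).trans (FreeAlgebra.lift_ι_apply ..)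

theorem shuffleRep_X (j : ℕ) (h : j < n) :
    shuffleRep hr hζ hζr hop (AffYok.X r q j h) = XS op ⟨j, h⟩ := by
  induction j with
  | zero => exact (shuffleRep_mk ..).trans (FreeAlgebra.lift_ι_apply ..)
  | succ j ih => rw [AffYok.X, map_mul, map_mul, shuffleRep_g, ih, gS_XS_gS]

theorem stdEval_stdIncl (w : W) : stdEval K μ W (stdIncl K μ W w) = w := by
  simp [stdEval, stdIncl]

theorem stdIncl_diag (Φ : Module.End K (Shuffle μ → W)) (c : Shuffle μ → Module.End K W)
    (h : ∀ f, Φ f (Shuffle.std μ) = c (Shuffle.std μ) (f (Shuffle.std μ)))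
    (h' : ∀ σ, σ ≠ Shuffle.std μ → ∀ w, Φ (stdIncl K μ W w) σ = 0) (w : W) :
    Φ (stdIncl K μ W w) = stdIncl K μ W (c (Shuffle.std μ) w) := by
  classical
  funext σ
  by_cases hσ : σ = Shuffle.std μ
  · subst hσ
    rw [h]
    simp [stdIncl]
  · rw [h' σ hσ]
    simp [stdIncl, hσ]

theorem stdIncl_ne {σ : Shuffle μ} (h : σ ≠ Shuffle.std μ) (w : W) :
    stdIncl K μ W w σ = 0 := by
  classical
  simp [stdIncl, h]

theorem tS_stdIncl (j : Fin n) (w : W) :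
    tS ζ j (stdIncl K μ W w) = stdIncl K μ W (ζ (μ.pos.symm j).1 • w) :=
  stdIncl_diag _ (fun σ => ζ (σ.1 j).1 • 1) (fun f => tS_apply ..)
    (fun σ hσ w => by rw [tS_apply, stdIncl_ne hσ, smul_zero]) w

theorem XS_stdIncl (j : Fin n) (w : W) :
    XS op j (stdIncl K μ W w) = stdIncl K μ W (Yop op (μ.pos.symm j) w) :=
  stdIncl_diag _ (fun σ => Yop op (σ.1 j)) (fun f => XS_apply ..)
    (fun σ hσ w => by rw [XS_apply, stdIncl_ne hσ, map_zero]) w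

theorem XiS_stdIncl (j : Fin n) (w : W) :
    XiS op j (stdIncl K μ W w) = stdIncl K μ W (Yiop op (μ.pos.symm j) w) :=
  stdIncl_diag _ (fun σ => Yiop op (σ.1 j)) (fun f => XiS_apply ..)
    (fun σ hσ w => by rw [XiS_apply, stdIncl_ne hσ, map_zero]) w

theorem gS_stdIncl (i : ℕ) (h : i + 1 < n) (hb : μ.SameBlock i h) (w : W) :
    gS op i h (stdIncl K μ W w) = stdIncl K μ W (Top op (μ.pos.symm ⟨i, by omega⟩) w) := by
  refine stdIncl_diag _ (fun σ => Top op (σ.1 ⟨i, by omega⟩)) (fun f => gS_same op f hb)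
    (fun σ hσ w => ?_) w
  by_cases hc : (σ.1 ⟨i, by omega⟩).1 = (σ.1 ⟨i + 1, h⟩).1
  · rw [gS_same _ _ hc, stdIncl_ne hσ, map_zero]
  · rw [gS_diff _ _ hc]
    refine stdIncl_ne (fun h0 => ?_) w
    have h1 := swap_same_iff hc
    rw [h0] at h1
    exact h1 hb

theorem parabolic_stable (b : AffYok r q n) (hb : b ∈ parabolic q μ) :
    ∃ u : Module.End K W, ∀ w,
      shuffleRep hr hζ hζr hop b (stdIncl K μ W w) = stdIncl K μ W (u w) := by
  induction hb using Algebra.adjoin_induction with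
  | mem x hx =>
    obtain ((⟨j, rfl⟩ | ⟨j, h, rfl⟩) | ⟨j, h, h1, h2⟩) | ⟨i, h, hs, rfl⟩ := hx
    · exact ⟨ζ (μ.pos.symm j).1 • 1, fun w => by rw [shuffleRep_t]; exact tS_stdIncl j w⟩
    · exact ⟨_, fun w => by rw [shuffleRep_X]; exact XS_stdIncl _ w⟩
    · refine ⟨Yiop op (μ.pos.symm ⟨j, h⟩), fun w => ?_⟩
      have e1 := congrArg (shuffleRep hr hζ hζr hop) h1
      rw [map_mul, map_one, shuffleRep_X] at e1
      have e2 : shuffleRep hr hζ hζr hop x = XiS op ⟨j, h⟩ :=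
        left_inv_eq_right_inv e1 (XS_XiS _)
      rw [e2]
      exact XiS_stdIncl _ w
    · exact ⟨_, fun w => by rw [shuffleRep_g]; exact gS_stdIncl i h hs w⟩
  | algebraMap c =>
    exact ⟨algebraMap K _ c, fun w => by
      rw [AlgHom.commutes, Module.algebraMap_end_apply, Module.algebraMap_end_apply, map_smul]⟩
  | add x y _ _ hx hy =>
    obtain ⟨u, hu⟩ := hx
    obtain ⟨v, hv⟩ := hy
    exact ⟨u + v, fun w => by
      rw [map_add, LinearMap.add_apply, hu, hv, LinearMap.add_apply, map_add]⟩
  | mul x y _ _ hx hy =>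
    obtain ⟨u, hu⟩ := hx
    obtain ⟨v, hv⟩ := hy
    exact ⟨u * v, fun w => by
      rw [map_mul, Module.End.mul_apply, hv, hu, Module.End.mul_apply]⟩

theorem shuffleRep_stdIncl (b : parabolic q μ) (w : W) :
    shuffleRep hr hζ hζr hop b (stdIncl K μ W w) =
      stdIncl K μ W (stdEval K μ W (shuffleRep hr hζ hζr hop b (stdIncl K μ W w))) := by
  obtain ⟨u, hu⟩ := parabolic_stable hr hζ hζr hop b b.2
  rw [hu, stdEval_stdIncl]

/-- Given commuting actions `op k` of the affine Hecke algebras `Ĥ_{μ_k}` on `W`, this is the action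
of `Ŷ_{r,μ}` on `W` in which, at the `a`-th position of the `k`-th block, `t`, `X`, `g` act as the
scalar `ζ_k`, as `Y_a` of `Ĥ_{μ_k}`, and as `T_a` of `Ĥ_{μ_k}`; see `parabolicRep_t`, `parabolicRep_X`
and `parabolicRep_g`. -/
def parabolicRep : parabolic q μ →ₐ[K] Module.End K W :=
  AlgHom.ofLinearMap
    { toFun := fun b => stdEval K μ W ∘ₗ shuffleRep hr hζ hζr hop b ∘ₗ stdIncl K μ W
      map_add' := fun b b' => by ext w; simp
      map_smul' := fun c b => by ext w; simp }
    (by ext w; simp [stdEval_stdIncl])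
    (fun b b' => by
      ext w
      simp only [LinearMap.coe_mk, AddHom.coe_mk, LinearMap.comp_apply, MulMemClass.coe_mul, map_mul,
        Module.End.mul_apply]
      rw [shuffleRep_stdIncl hr hζ hζr hop b' w, stdEval_stdIncl])

theorem parabolicRep_apply (b : parabolic q μ) (w : W) :
    parabolicRep hr hζ hζr hop b w =
      stdEval K μ W (shuffleRep hr hζ hζr hop b (stdIncl K μ W w)) := rfl

theorem parabolicRep_t (k : Fin r) (a : Fin (μ.part k))
    (hmem : AffYok.t r q (μ.pos ⟨k, a⟩) ∈ parabolic q μ) :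
    parabolicRep hr hζ hζr hop ⟨_, hmem⟩ = ζ k • 1 := by
  ext w
  rw [parabolicRep_apply, shuffleRep_t, tS_stdIncl, stdEval_stdIncl]
  simp

theorem parabolicRep_X (k : Fin r) (a : Fin (μ.part k))
    (hmem : AffYok.X r q (μ.pos ⟨k, a⟩) (μ.pos ⟨k, a⟩).2 ∈ parabolic q μ) :
    parabolicRep hr hζ hζr hop ⟨_, hmem⟩ = op k (AffHecke.Y q a) := by
  ext w
  rw [parabolicRep_apply, shuffleRep_X, XS_stdIncl, stdEval_stdIncl, Fin.eta, Equiv.symm_apply_apply]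
  rfl

theorem parabolicRep_g (k : Fin r) (a : ℕ) (ha : a + 1 < μ.part k)
    (h : (μ.pos ⟨k, a, by omega⟩ : ℕ) + 1 < n)
    (hmem : AffYok.g r q (μ.pos ⟨k, a, by omega⟩) h ∈ parabolic q μ) :
    parabolicRep hr hζ hζr hop ⟨_, hmem⟩ = op k (AffHecke.T q a ha) := by
  have hs : μ.pos ⟨k, a + 1, ha⟩ = ⟨(μ.pos ⟨k, a, by omega⟩ : ℕ) + 1, h⟩ := by
    apply Fin.ext
    simp only [Comp.pos, Equiv.trans_apply, finCongr_apply, Fin.val_cast, finSigmaFinEquiv_apply]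
    omega
  have hb : μ.SameBlock (μ.pos ⟨k, a, by omega⟩) h := by
    rw [Comp.SameBlock, ← hs]
    simp
  ext w
  rw [parabolicRep_apply, shuffleRep_g, gS_stdIncl _ _ hb, stdEval_stdIncl]
  simp [Top_succ ha]

end ParabolicRep

/-! ## Outer tensor products and the modules `S_μ(L.)` -/

section Outer

variable {K : Type u} [Field K] {r : ℕ} (L : Fin r → Type w) [∀ k, AddCommGroup (L k)]
  [∀ k, Module K (L k)]

/-- An endomorphism of the `k`-th factor, acting on the tensor product. -/
def factorEnd (k : Fin r) : Module.End K (L k) →ₐ[K] Module.End K (⨂[K] k, L k) :=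
  AlgHom.ofLinearMap
    { toFun := fun u => PiTensorProduct.map (Function.update (fun _ => LinearMap.id) k u)
      map_add' := fun u v => PiTensorProduct.map_update_add _ k u v
      map_smul' := fun c u => PiTensorProduct.map_update_smul _ k c u }
    (by
      change PiTensorProduct.map (Function.update (fun _ => LinearMap.id) k LinearMap.id) = 1
      rw [Function.update_eq_self k (fun j => (LinearMap.id : L j →ₗ[K] L j))]
      exact PiTensorProduct.map_id)
    (fun u v => by
      change PiTensorProduct.map _ = PiTensorProduct.map _ * PiTensorProduct.map _
      rw [← PiTensorProduct.map_mul]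
      congr 1
      funext j
      by_cases h : j = k
      · subst h; simp
      · simp [h]; rfl)

theorem factorEnd_tprod (k : Fin r) (u : Module.End K (L k)) (z : ∀ k, L k) :
    factorEnd L k u (PiTensorProduct.tprod K z) =
      PiTensorProduct.tprod K (Function.update z k (u (z k))) := by
  change PiTensorProduct.map _ _ = _
  rw [PiTensorProduct.map_tprod]
  congr 1
  funext j
  by_cases h : j = k
  · subst h; simp
  · simp [h]

theorem factorEnd_commute (k l : Fin r) (h : k ≠ l) (u : Module.End K (L k))
    (v : Module.End K (L l)) : Commute (factorEnd L k u) (factorEnd L l v) := by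
  change PiTensorProduct.map _ * PiTensorProduct.map _ =
    PiTensorProduct.map _ * PiTensorProduct.map _
  rw [← PiTensorProduct.map_mul, ← PiTensorProduct.map_mul]
  congr 1
  funext j
  by_cases hk : j = k
  · subst hk; simp [h]; rfl
  · by_cases hl : j = l
    · subst hl; simp [hk]; rfl
    · simp [hk, hl]

end Outer

section SimpleModules

variable {K : Type u} [Field K] {r n : ℕ} {q : Kˣ}

/-- The `Ŷ_{r,μ}`-module `(V_1^{⊗ μ_1} ⊗ L_1) ⊗ ⋯ ⊗ (V_r^{⊗ μ_r} ⊗ L_r)`, for `Ĥ_{μ_k}`-modules `L_k`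
given by algebra homomorphisms `ρ_k`. Here `V_k = K` is the one-dimensional module of the cyclic group
of order `r` on which the chosen generator acts as the root of unity `ζ_k`, so that `V_k^{⊗ μ_k} ⊗ L_k`
is `L_k` with each `t_j` acting as the scalar `ζ_k`. -/
def outerRep (hr : (r : K) ≠ 0) (ζ : Fin r ≃ rootsOfUnity r K) (μ : Comp r n)
    (L : Fin r → Type w) [∀ k, AddCommGroup (L k)] [∀ k, Module K (L k)]
    (ρ : ∀ k, AffHecke q (μ.part k) →ₐ[K] Module.End K (L k)) :
    parabolic q μ →ₐ[K] Module.End K (⨂[K] k, L k) :=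
  parabolicRep (ζ := fun k => ((ζ k : Kˣ) : K)) (op := fun k => (factorEnd L k).comp (ρ k)) hr
    (fun _ _ h => ζ.injective (Subtype.ext (Units.ext h)))
    (fun k => (mem_rootsOfUnity' r _).1 (ζ k).2)
    (fun k l h _ _ => factorEnd_commute L k l h _ _)

/-- The `Ĥ_m`-module `ev^* L` inflated from the `H_m^λ`-module `L`, as an algebra homomorphism. -/
def inflation {m : ℕ} {lam : residues q →₀ ℕ} (L : ModuleCat.{w} (CycHecke m lam)) :
    AffHecke q m →ₐ[K] Module.End K L :=
  (Algebra.lsmul K K (L : Type w)).comp (CycHecke.ev m lam)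

/-- The `Ŷ_{r,n}`-module `S_μ(L.)`, induced from `Ŷ_{r,μ}`. -/
abbrev SMod (hr : (r : K) ≠ 0) (ζ : Fin r ≃ rootsOfUnity r K) {lam : residues q →₀ ℕ}
    (μ : Comp r n) (L : ∀ k, ModuleCat.{w} (CycHecke (μ.part k) lam)) : Type max u w :=
  Ind (parabolic q μ) (outerRep hr ζ μ (fun k => (L k : Type w)) (fun k => inflation (L k)))

end SimpleModules

end YokonumaHecke

end

open YokonumaHecke

/-! The elements `t_j` commute and satisfy `t_j ^ r = 1`. Since `r` is invertible and `K` contains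
all `r`-th roots of unity, modules can be studied through weight spaces indexed by colourings `c` of
the positions by `r` colours. The generator `g_i` carries the weight `c` to `c ∘ s_i`. By
orthogonality of roots of unity, `e_i` acts on the weight space of `c` as `1` if `c i = c (i+1)` and
as `0` otherwise. So `g_i` satisfies the Hecke relation at equal colours, while at different colours
`g_i ^ 2 = 1` and `g_i` merely permutes weight spaces and the `X_j`. Sorting a colouring by such
involutions shows that everything is controlled by the weight spaces of increasing colourings. An
increasing colouring is the same as a composition `μ`, and on its weight space the algebras
`Ĥ_{μ_k}` act and commute with each other.

The induced module is therefore compared with the explicit module of functions on shuffles. The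
comparison map is onto because delta functions can be sorted. Injectivity (`indToShuffle_injective`)
is obtained without a basis theorem for `Ŷ_{r,n}`: by `Reach.g`, the vectors obtained from `1 ⊗ W`
by applying `g_i` at ascents only are already stable under all generators up to linear span, and
none of them returns to the increasing colouring except the elements of `1 ⊗ W` themselves.

Simplicity of `S_μ(L.)`: a nonzero submodule contains an increasing weight vector, hence meets the
copy of `⨂ L_k` at the standard shuffle, and `⨂ L_k` is irreducible by Burnside's theorem. This
needs the `L_k` to be finite-dimensional, which follows from `finiteDimensional_cycHecke`. The
relation `f_λ(X_1) = 0` holds because the first position of a shuffle is always the first entry of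
its block.

Completeness: a simple module has a nonzero increasing weight space. It is irreducible under the
commuting block algebras (`wtOp_irreducible`), the relation `f_λ(Y_1) = 0` holds in each block
(`aeval_wtOp_Y`), and the space is an outer tensor product of simple modules
(`exists_outerTensor_equiv`). Frobenius reciprocity then gives a nonzero map from `S_μ(L.)` between
irreducible modules.

Separation: the weights that occur determine `μ`, the standard weight space recovers `⨂ L_k`, and
the outer tensor product recovers each `L_k` by slicing and Schur's lemma. -/

noncomputable section

namespace YokonumaHecke

/-! ### Consequences of the defining relations of `Ŷ_{r,n}` -/

namespace AffYok

variable {K : Type u} [Field K] {r : ℕ} {q : Kˣ} {n : ℕ}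

theorem mk_rel {x y : FreeAlgebra K (YokGen n)} (h : YokRel r q n x y) :
    mk r q n x = mk r q n y :=
  RingQuot.mkAlgHom_rel K h

theorem mk_surjective : Function.Surjective (mk (K := K) r q n) :=
  RingQuot.mkAlgHom_surjective K _

/-- The inverse of `X_1`. -/
def Xinv0 (h : 0 < n) : AffYok r q n := mk r q n (YokRel.Xinv K h)

/-- The element `e_i` of the affine Yokonuma-Hecke algebra. -/
def e (i : ℕ) (h : i + 1 < n) : AffYok r q n :=
  (r : K)⁻¹ • ∑ s ∈ Finset.range r, t r q ⟨i, by omega⟩ ^ s * t r q ⟨i + 1, h⟩ ^ (r - s)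

theorem far (i j : ℕ) (hi : i + 1 < n) (hj : j + 1 < n) (hij : i + 2 ≤ j ∨ j + 2 ≤ i) :
    g r q i hi * g r q j hj = g r q j hj * g r q i hi := by
  have h0 := mk_rel (YokRel.far (K := K) (r := r) (q := q) i j hi hj hij)
  simp only [map_mul] at h0
  exact h0

theorem braid (i : ℕ) (h : i + 1 + 1 < n) :
    g r q i (by omega) * g r q (i + 1) h * g r q i (by omega) =
      g r q (i + 1) h * g r q i (by omega) * g r q (i + 1) h := by
  have h0 := mk_rel (YokRel.braid (K := K) (r := r) (q := q) i h)
  simp only [map_mul] at h0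
  exact h0

theorem t_comm (i j : Fin n) : t r q i * t r q j = t r q j * t r q i := by
  have h0 := mk_rel (YokRel.t_comm (K := K) (r := r) (q := q) i j)
  simp only [map_mul] at h0
  exact h0

theorem g_t (i : ℕ) (h : i + 1 < n) (j : Fin n) :
    g r q i h * t r q j = t r q (Equiv.swap ⟨i, by omega⟩ ⟨i + 1, h⟩ j) * g r q i h := by
  have h0 := mk_rel (YokRel.g_t (K := K) (r := r) (q := q) i h j)
  simp only [map_mul] at h0
  exact h0

theorem t_pow (j : Fin n) : t r q j ^ r = 1 := by
  have h0 := mk_rel (YokRel.t_pow (K := K) (r := r) (q := q) j)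
  simp only [map_pow, map_one] at h0
  exact h0

theorem g_sq (i : ℕ) (h : i + 1 < n) :
    g r q i h * g r q i h = 1 + ((q : K) - ((q⁻¹ : Kˣ) : K)) • (e i h * g r q i h) := by
  have h0 := mk_rel (YokRel.quadratic (r := r) (q := q) i h)
  simp only [map_pow, map_one, map_add, map_mul, map_smul, map_sum, YokRel.e, sq] at h0
  exact h0

theorem X0_Xinv0 (h : 0 < n) : X r q 0 h * Xinv0 h = 1 := by
  have h0 := mk_rel (YokRel.X_Xinv (r := r) (q := q) h)
  simp only [map_mul, map_one] at h0
  exact h0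

theorem Xinv0_X0 (h : 0 < n) : Xinv0 h * X r q 0 h = 1 := by
  have h0 := mk_rel (YokRel.Xinv_X (r := r) (q := q) h)
  simp only [map_mul, map_one] at h0
  exact h0

theorem g_X_g_X (h : 0 + 1 < n) :
    g r q 0 h * X r q 0 (by omega) * g r q 0 h * X r q 0 (by omega) =
      X r q 0 (by omega) * g r q 0 h * X r q 0 (by omega) * g r q 0 h := by
  have h0 := mk_rel (YokRel.g_X_g_X (r := r) (q := q) h)
  simp only [map_mul] at h0
  exact h0

theorem g_X0 (i : ℕ) (h : i + 1 < n) (hi : 1 ≤ i) :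
    Commute (g r q i h) (X r q 0 (by omega)) := by
  have h0 := mk_rel (YokRel.g_X (r := r) (q := q) i h hi)
  simp only [map_mul] at h0
  exact h0

theorem t_X0 (j : Fin n) (h : 0 < n) : Commute (t r q j) (X r q 0 h) := by
  have h0 := mk_rel (YokRel.t_X (r := r) (q := q) j h)
  simp only [map_mul] at h0
  exact h0

theorem X_succ (j : ℕ) (h : j + 1 < n) :
    X r q (j + 1) h = g r q j h * X r q j (by omega) * g r q j h := rfl

theorem g_commute_X_of_lt (i j : ℕ) (hi : i + 1 < n) (hij : j < i) :
    Commute (g r q i hi) (X r q j (by omega)) := by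
  induction j with
  | zero => exact g_X0 i hi hij
  | succ j ih =>
    have h1 : Commute (g r q i hi) (g r q j (by omega)) := far _ _ _ _ (by omega)
    exact (h1.mul_right (ih (by omega))).mul_right h1

/-- The essential case is `j = i + 2`, where `X_{i+2} = g_{i+1} g_i X_i g_i g_{i+1}`: the braid
relation turns `g_i` on the left into `g_{i+1}` next to `X_i`, which commutes with it, and a second
braid relation brings `g_i` out on the right. For larger `j` the outer factors `g_{j-1}` commute
with `g_i`. -/
theorem g_commute_X_of_gt (i j : ℕ) (hj : j < n) (hij : i + 2 ≤ j) :
    Commute (g r q i (by omega)) (X r q j hj) := by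
  induction j with
  | zero => omega
  | succ j ih =>
    rcases Nat.lt_or_ge j (i + 2) with h | h
    · obtain rfl : j = i + 1 := by omega
      have hb := braid (r := r) (q := q) i (by omega)
      have hc := g_commute_X_of_lt (r := r) (q := q) (i + 1) i hj (by omega)
      rw [X_succ, X_succ]
      generalize g r q i _ = a at *
      generalize g r q (i + 1) _ = b at *
      generalize X r q i _ = x at *
      change a * (b * (a * x * a) * b) = b * (a * x * a) * b * a
      calc a * (b * (a * x * a) * b) = (a * b * a) * x * a * b := by noncomm_ring
        _ = b * a * (b * x) * a * b := by rw [hb]; noncomm_ring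
        _ = b * a * x * (b * a * b) := by rw [hc.eq]; noncomm_ring
        _ = b * (a * x * a) * b * a := by rw [← hb]; noncomm_ring
    · have h1 : Commute (g r q i (by omega)) (g r q j hj) := far _ _ _ _ (by omega)
      exact (h1.mul_right (ih (by omega) h)).mul_right h1

theorem g_commute_X (i j : ℕ) (hi : i + 1 < n) (hj : j < n) (h0 : j ≠ i) (h1 : j ≠ i + 1) :
    Commute (g r q i hi) (X r q j hj) := by
  rcases Nat.lt_or_ge j i with h | h
  · exact g_commute_X_of_lt i j hi h
  · exact g_commute_X_of_gt i j hj (by omega)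

/-- Only the passage to `X_1` (index from `0`) needs the four-term relation; each later `g_j`
commutes with `X_0`. -/
theorem X0_commute_X (j : ℕ) (hj : j < n) : Commute (X r q 0 (by omega)) (X r q j hj) := by
  induction j with
  | zero => exact Commute.refl _
  | succ j ih =>
    rcases Nat.eq_zero_or_pos j with rfl | h
    · have h0 := g_X_g_X (r := r) (q := q) hj
      rw [X_succ]
      change _ * (_ * _ * _) = _ * _ * _ * _
      rw [h0]
      noncomm_ring
    · have h1 := (g_X0 (r := r) (q := q) j hj h).symm
      exact (h1.mul_right (ih (by omega))).mul_right h1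

theorem X_commute_X (i j : ℕ) (hi : i < n) (hj : j < n) : Commute (X r q i hi) (X r q j hj) := by
  wlog hij : i ≤ j generalizing i j
  · exact (this j i hj hi (by omega)).symm
  induction i with
  | zero => exact X0_commute_X j hj
  | succ i ih =>
    rcases Nat.lt_or_ge j (i + 2) with h | h
    · obtain rfl : j = i + 1 := by omega
      exact Commute.refl _
    · have h1 := g_commute_X_of_gt (r := r) (q := q) i j hj h
      exact (h1.mul_left (ih (by omega) (by omega))).mul_left h1

/-- Moving `t_i` through the two factors `g_j` of `X_{j+1}` applies the same transposition twice to
its index, so it comes out unchanged. -/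
theorem t_commute_X (i : Fin n) (j : ℕ) (hj : j < n) : Commute (t r q i) (X r q j hj) := by
  induction j generalizing i with
  | zero => exact t_X0 i hj
  | succ j ih =>
    have h1 := fun k => g_t (r := r) (q := q) j hj k
    have h2 := h1 (Equiv.swap ⟨j, by omega⟩ ⟨j + 1, hj⟩ i)
    have h3 := h1 i
    have h4 := ih (Equiv.swap ⟨j, by omega⟩ ⟨j + 1, hj⟩ i) (by omega)
    rw [Equiv.swap_apply_self] at h2
    rw [X_succ]
    change _ * (_ * _ * _) = _ * _ * _ * _
    rw [mul_assoc _ (g r q j hj) (t r q i), h3, ← mul_assoc, ← mul_assoc, ← h2,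
      mul_assoc _ (t _ _ _) (X _ _ _ _), h4.eq]
    noncomm_ring

/-- Substitute `s ↦ r - s`; the boundary terms `s = 0` and `s = r` agree because `t ^ r = 1`. This
symmetry is what makes `g_i` commute with `e_i`. -/
theorem t_pow_sum (i j : Fin n) :
    ∑ s ∈ Finset.range r, t r q i ^ s * t r q j ^ (r - s) =
      ∑ s ∈ Finset.range r, t r q j ^ s * t r q i ^ (r - s) := by
  rcases r with _ | r
  · simp
  rw [Finset.sum_range_succ', Finset.sum_range_succ', ← Finset.sum_range_reflect]
  congr 1
  · refine Finset.sum_congr rfl fun s hs => ?_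
    have := Finset.mem_range.1 hs
    rw [show r - 1 - s + 1 = r + 1 - (s + 1) by omega,
      show r + 1 - (r + 1 - (s + 1)) = s + 1 by omega]
    exact ((show Commute (t (r + 1) q i) (t (r + 1) q j) from t_comm i j).pow_pow _ _)
  · simp [t_pow]

theorem g_commute_e (i : ℕ) (h : i + 1 < n) : Commute (g r q i h) (e i h) := by
  have hp : ∀ (j : Fin n) (s : ℕ), g r q i h * t r q j ^ s =
      t r q (Equiv.swap ⟨i, by omega⟩ ⟨i + 1, h⟩ j) ^ s * g r q i h := by
    intro j s
    exact (show SemiconjBy (g r q i h) (t r q j) _ from g_t i h j).pow_right s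
  change _ * _ = _ * _
  rw [e, mul_smul_comm, smul_mul_assoc]
  nth_rewrite 2 [t_pow_sum]
  rw [Finset.mul_sum, Finset.sum_mul]
  congr 1
  refine Finset.sum_congr rfl fun s _ => ?_
  rw [← mul_assoc, hp, mul_assoc, hp, ← mul_assoc, Equiv.swap_apply_left, Equiv.swap_apply_right]

/-- The quadratic relation reads `g_i (g_i - (q - q⁻¹) e_i) = 1`, and `e_i` commutes with `g_i`. -/
theorem isUnit_g (i : ℕ) (h : i + 1 < n) : IsUnit (g r q i h) := by
  have h0 := g_sq (r := r) (q := q) i h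
  have h1 := g_commute_e (r := r) (q := q) i h
  set c := (q : K) - ((q⁻¹ : Kˣ) : K)
  refine isUnit_iff_exists.2 ⟨g r q i h - c • e i h, ?_, ?_⟩
  · rw [mul_sub, h0, mul_smul_comm, h1.eq]; abel
  · rw [sub_mul, h0, smul_mul_assoc]; abel

theorem isUnit_X (j : ℕ) (h : j < n) : IsUnit (X r q j h) := by
  induction j with
  | zero => exact isUnit_iff_exists.2 ⟨_, X0_Xinv0 h, Xinv0_X0 h⟩
  | succ j ih => exact ((isUnit_g j h).mul (ih (by omega))).mul (isUnit_g j h)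

/-- The elements `X_j⁻¹`. -/
def Xinv (j : ℕ) (h : j < n) : AffYok r q n := ((isUnit_X (r := r) (q := q) j h).unit⁻¹ : _)

theorem X_Xinv (j : ℕ) (h : j < n) : X r q j h * Xinv j h = 1 :=
  (isUnit_X j h).mul_val_inv

theorem Xinv_X (j : ℕ) (h : j < n) : Xinv j h * X r q j h = 1 :=
  (isUnit_X j h).val_inv_mul

theorem Xinv_zero (h : 0 < n) : (Xinv 0 h : AffYok r q n) = Xinv0 h :=
  left_inv_eq_right_inv (Xinv_X 0 h) (X0_Xinv0 h)

theorem commute_Xinv {a : AffYok r q n} {j : ℕ} {h : j < n} (ha : Commute a (X r q j h)) :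
    Commute a (Xinv j h) :=
  Commute.units_inv_right (u := (isUnit_X (r := r) (q := q) j h).unit) ha

/-- Closure of a property of elements under the generators of `Ŷ_{r,n}`. -/
theorem induction {p : AffYok r q n → Prop} (ht : ∀ j, p (t r q j)) (hg : ∀ i h, p (g r q i h))
    (hX : ∀ h, p (X r q 0 h)) (hXi : ∀ h, p (Xinv0 h)) (hc : ∀ c : K, p (algebraMap K _ c))
    (hadd : ∀ a b, p a → p b → p (a + b)) (hmul : ∀ a b, p a → p b → p (a * b))
    (a : AffYok r q n) : p a := by
  obtain ⟨a, rfl⟩ := mk_surjective a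
  induction a with
  | grade0 c => rw [AlgHom.commutes]; exact hc c
  | grade1 x =>
    cases x with
    | t j => exact ht j
    | g i h => exact hg i h
    | X h => exact hX h
    | Xinv h => exact hXi h
  | mul a b ha hb => rw [map_mul]; exact hmul _ _ ha hb
  | add a b ha hb => rw [map_add]; exact hadd _ _ ha hb

end AffYok

/-! ### Induction over the generators of `Ĥ_m` -/

namespace AffHecke

variable {K : Type u} [Field K] {q : Kˣ} {m : ℕ}

theorem mk_surjective : Function.Surjective (mk (K := K) q m) :=
  RingQuot.mkAlgHom_surjective K _

/-- Closure of a property of elements under the generators of `Ĥ_m`. -/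
theorem induction {p : AffHecke q m → Prop} (hT : ∀ i h, p (T q i h)) (hY : ∀ j, p (Y q j))
    (hYi : ∀ j, p (Yinv q j)) (hc : ∀ c : K, p (algebraMap K _ c))
    (hadd : ∀ a b, p a → p b → p (a + b)) (hmul : ∀ a b, p a → p b → p (a * b))
    (a : AffHecke q m) : p a := by
  obtain ⟨a, rfl⟩ := mk_surjective a
  induction a with
  | grade0 c => rw [AlgHom.commutes]; exact hc c
  | grade1 x =>
    cases x with
    | T i h => exact hT i h
    | Y h => exact hY h
    | Yinv h => exact hYi h
  | mul a b ha hb => rw [map_mul]; exact hmul _ _ ha hb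
  | add a b ha hb => rw [map_add]; exact hadd _ _ ha hb

end AffHecke

/-! ## Colourings of the positions -/

section Colourings

variable {r n : ℕ}

/-- The transposition of the positions `i` and `i + 1`. -/
abbrev adj (i : ℕ) (h : i + 1 < n) : Equiv.Perm (Fin n) := Equiv.swap ⟨i, by omega⟩ ⟨i + 1, h⟩

theorem adj_of_ne {i j : ℕ} {h : i + 1 < n} {hj : j < n} (h0 : j ≠ i) (h1 : j ≠ i + 1) :
    adj i h ⟨j, hj⟩ = ⟨j, hj⟩ :=
  Equiv.swap_apply_of_ne_of_ne (by simpa [Fin.ext_iff] using h0) (by simpa [Fin.ext_iff] using h1)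

theorem adj_left {i : ℕ} {h : i + 1 < n} : adj i h ⟨i, by omega⟩ = ⟨i + 1, h⟩ :=
  Equiv.swap_apply_left _ _

theorem adj_right {i : ℕ} {h : i + 1 < n} : adj i h ⟨i + 1, h⟩ = ⟨i, by omega⟩ :=
  Equiv.swap_apply_right _ _

theorem comp_adj_adj {α : Type*} (c : Fin n → α) (i : ℕ) (h : i + 1 < n) :
    (c ∘ adj i h) ∘ adj i h = c := by
  funext j
  simp

theorem comp_adj_far {α : Type*} (c : Fin n → α) (i j : ℕ) (hi : i + 1 < n) (hj : j + 1 < n)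
    (hij : i + 2 ≤ j ∨ j + 2 ≤ i) : (c ∘ adj i hi) ∘ adj j hj = (c ∘ adj j hj) ∘ adj i hi := by
  funext x
  obtain ⟨x, hx⟩ := x
  simp only [Function.comp_apply]
  congr 1
  by_cases h1 : x = i
  · subst h1
    rw [adj_of_ne (i := j) (j := x) (by omega) (by omega), adj_left,
      adj_of_ne (i := j) (j := x + 1) (by omega) (by omega)]
  by_cases h2 : x = i + 1
  · subst h2
    rw [adj_of_ne (i := j) (j := i + 1) (by omega) (by omega), adj_right,
      adj_of_ne (i := j) (j := i) (by omega) (by omega)]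
  rw [adj_of_ne (i := i) h1 h2]
  by_cases h3 : x = j
  · subst h3
    rw [adj_left, adj_of_ne (by omega) (by omega)]
  by_cases h4 : x = j + 1
  · subst h4
    rw [adj_right, adj_of_ne (by omega) (by omega)]
  rw [adj_of_ne h3 h4, adj_of_ne h1 h2]

theorem comp_adj_braid {α : Type*} (c : Fin n → α) (i : ℕ) (h : i + 1 + 1 < n) :
    ((c ∘ adj i (by omega)) ∘ adj (i + 1) h) ∘ adj i (by omega) =
      ((c ∘ adj (i + 1) h) ∘ adj i (by omega)) ∘ adj (i + 1) h := by
  funext x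
  obtain ⟨x, hx⟩ := x
  simp only [Function.comp_apply]
  congr 1
  by_cases h1 : x = i
  · subst h1
    rw [adj_left, adj_left, adj_of_ne (i := x) (by omega) (by omega),
      adj_of_ne (i := x + 1) (j := x) (by omega) (by omega), adj_left, adj_left]
  by_cases h2 : x = i + 1
  · subst h2
    rw [adj_right, adj_left, adj_of_ne (i := i + 1) (j := i) (by omega) (by omega), adj_left,
      adj_of_ne (i := i) (by omega) (by omega), adj_right]
  by_cases h3 : x = i + 1 + 1
  · subst h3
    rw [adj_of_ne (i := i) (j := i + 1 + 1) (by omega) (by omega), adj_right, adj_right,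
      adj_of_ne (i := i + 1) (j := i) (by omega) (by omega)]
  simp [adj_of_ne, h1, h2, h3]

/-- A height on colourings which decreases when a descent is removed. -/
def ht (c : Fin n → Fin r) : ℕ := ∑ j : Fin n, (n - (j : ℕ)) * (c j : ℕ)

/-- Only two terms of the weighted sum change, and the difference of the heights is `c (i+1) - c i`.
The sums are compared in `ℤ` to avoid truncated subtraction. -/
theorem ht_lt {c : Fin n → Fin r} {i : ℕ} {h : i + 1 < n}
    (hc : c ⟨i, by omega⟩ < c ⟨i + 1, h⟩) : ht c < ht (c ∘ adj i h) := by
  have e : ht (c ∘ adj i h) = ∑ j : Fin n, (n - (adj i h j : ℕ)) * (c j : ℕ) := by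
    rw [ht, ← Equiv.sum_comp (adj i h)]
    simp
  have e2 : (ht (c ∘ adj i h) : ℤ) - ht c =
      ∑ j : Fin n, (((j : ℕ) : ℤ) - (adj i h j : ℕ)) * (c j : ℕ) := by
    rw [e, ht, Nat.cast_sum, Nat.cast_sum, ← Finset.sum_sub_distrib]
    refine Finset.sum_congr rfl fun j _ => ?_
    rw [Nat.cast_mul, Nat.cast_mul, Nat.cast_sub j.2.le, Nat.cast_sub (Fin.is_lt _).le]
    ring
  rw [Fintype.sum_eq_add (⟨i, by omega⟩ : Fin n) ⟨i + 1, h⟩ (by simp)] at e2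
  · rw [adj_left, adj_right] at e2
    have := Fin.lt_def.1 hc
    push_cast at e2
    have e3 : (ht (c ∘ adj i h) : ℤ) - ht c =
      ((c ⟨i + 1, h⟩ : ℕ) : ℤ) - (c ⟨i, by omega⟩ : ℕ) := by rw [e2]; ring
    omega
  · rintro j ⟨h1, h2⟩
    rw [adj, Equiv.swap_apply_of_ne_of_ne h1 h2]
    simp

theorem ht_gt {c : Fin n → Fin r} {i : ℕ} {h : i + 1 < n}
    (hc : c ⟨i + 1, h⟩ < c ⟨i, by omega⟩) : ht (c ∘ adj i h) < ht c := by
  have := ht_lt (c := c ∘ adj i h) (i := i) (h := h) (by simpa using hc)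
  rwa [comp_adj_adj] at this

theorem exists_descent {c : Fin n → Fin r} (hc : ¬ Monotone c) :
    ∃ (i : ℕ) (h : i + 1 < n), c ⟨i + 1, h⟩ < c ⟨i, by omega⟩ := by
  by_contra! hcon
  apply hc
  rcases n with _ | n
  · intro a; exact a.elim0
  · exact Fin.monotone_iff_le_succ.2 fun i => hcon i (by omega)

end Colourings

/-! ## Weight spaces -/

section Weights

variable {K : Type u} [Field K] {r n : ℕ} {q : Kˣ} {M : Type w} [AddCommGroup M] [Module K M]
  (ρ : AffYok r q n →ₐ[K] Module.End K M) (ζ : Fin r → K)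

/-- The joint eigenspace on which each `t_j` acts as the scalar `ζ (c j)`. -/
def wtSpace (c : Fin n → Fin r) : Submodule K M where
  carrier := {m | ∀ j, ρ (AffYok.t r q j) m = ζ (c j) • m}
  add_mem' ha hb j := by rw [map_add, ha j, hb j, smul_add]
  zero_mem' j := by simp
  smul_mem' a m hm j := by rw [map_smul, hm j, smul_comm]

variable {ρ ζ}

theorem g_mem_wtSpace {c : Fin n → Fin r} {m : M} (hm : m ∈ wtSpace ρ ζ c) (i : ℕ)
    (h : i + 1 < n) : ρ (AffYok.g r q i h) m ∈ wtSpace ρ ζ (c ∘ adj i h) := by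
  intro j
  have h1 := AffYok.g_t (r := r) (q := q) i h (adj i h j)
  rw [Equiv.swap_apply_self] at h1
  rw [← Module.End.mul_apply, ← map_mul, ← h1, map_mul, Module.End.mul_apply, hm, map_smul]
  rfl

theorem g_mem_wtSpace_same {c : Fin n → Fin r} {m : M} (hm : m ∈ wtSpace ρ ζ c) {i : ℕ}
    {h : i + 1 < n} (hc : c ⟨i, by omega⟩ = c ⟨i + 1, h⟩) :
    ρ (AffYok.g r q i h) m ∈ wtSpace ρ ζ c := by
  have h1 := g_mem_wtSpace hm i h
  convert h1 using 2
  funext j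
  rw [Function.comp_apply]
  by_cases h2 : j = ⟨i, by omega⟩
  · rw [h2, adj_left, hc]
  by_cases h3 : j = ⟨i + 1, h⟩
  · rw [h3, adj_right, hc]
  rw [adj, Equiv.swap_apply_of_ne_of_ne h2 h3]

theorem mem_wtSpace_of_commute {c : Fin n → Fin r} {m : M} (hm : m ∈ wtSpace ρ ζ c)
    {a : AffYok r q n} (ha : ∀ j, Commute (AffYok.t r q j) a) : ρ a m ∈ wtSpace ρ ζ c := by
  intro j
  rw [← Module.End.mul_apply, ← map_mul, (ha j).eq, map_mul, Module.End.mul_apply, hm, map_smul]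

theorem X_mem_wtSpace {c : Fin n → Fin r} {m : M} (hm : m ∈ wtSpace ρ ζ c) (j : ℕ) (h : j < n) :
    ρ (AffYok.X r q j h) m ∈ wtSpace ρ ζ c :=
  mem_wtSpace_of_commute hm fun i => AffYok.t_commute_X i j h

theorem Xinv_mem_wtSpace {c : Fin n → Fin r} {m : M} (hm : m ∈ wtSpace ρ ζ c) (j : ℕ)
    (h : j < n) : ρ (AffYok.Xinv j h) m ∈ wtSpace ρ ζ c :=
  mem_wtSpace_of_commute hm fun i => AffYok.commute_Xinv (AffYok.t_commute_X i j h)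

theorem Xinv_X_apply (j : ℕ) (h : j < n) (m : M) :
    ρ (AffYok.Xinv j h) (ρ (AffYok.X r q j h) m) = m := by
  rw [← Module.End.mul_apply, ← map_mul, AffYok.Xinv_X, map_one, Module.End.one_apply]

theorem X_Xinv_apply (j : ℕ) (h : j < n) (m : M) :
    ρ (AffYok.X r q j h) (ρ (AffYok.Xinv j h) m) = m := by
  rw [← Module.End.mul_apply, ← map_mul, AffYok.X_Xinv, map_one, Module.End.one_apply]

theorem t_pow_apply {c : Fin n → Fin r} {m : M} (hm : m ∈ wtSpace ρ ζ c) (j : Fin n) (s : ℕ) :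
    ρ (AffYok.t r q j ^ s) m = ζ (c j) ^ s • m := by
  induction s with
  | zero => simp
  | succ s ih => rw [pow_succ', map_mul, Module.End.mul_apply, ih, map_smul, hm, smul_smul,
      pow_succ]

-- Orthogonality of the `r`-th roots of unity. This dichotomy separates the Hecke behaviour of `g_i`
-- at equal colours from the involutive behaviour at different colours.
open Classical in
theorem e_apply (hr : (r : K) ≠ 0) (hζ : Function.Injective ζ) (hζr : ∀ k, ζ k ^ r = 1)
    {c : Fin n → Fin r} {m : M} (hm : m ∈ wtSpace ρ ζ c) (i : ℕ) (h : i + 1 < n) :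
    ρ (AffYok.e i h) m = if c ⟨i, by omega⟩ = c ⟨i + 1, h⟩ then m else 0 := by
  have h1 := sum_roots hr (hζr (c ⟨i, by omega⟩)) (hζr (c ⟨i + 1, h⟩))
  rw [AffYok.e, map_smul, map_sum, LinearMap.smul_apply, LinearMap.sum_apply]
  have h2 : ∀ s ∈ Finset.range r, ρ (AffYok.t r q ⟨i, by omega⟩ ^ s *
      AffYok.t r q ⟨i + 1, h⟩ ^ (r - s)) m =
      (ζ (c ⟨i, by omega⟩) ^ s * ζ (c ⟨i + 1, h⟩) ^ (r - s)) • m := by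
    intro s _
    rw [map_mul, Module.End.mul_apply, t_pow_apply hm, map_smul, t_pow_apply hm, smul_smul,
      mul_comm]
  rw [Finset.sum_congr rfl h2, ← Finset.sum_smul, smul_smul, h1, hζ.eq_iff]
  split_ifs <;> simp

/-- The `e_i`-term of the quadratic relation vanishes on the weight `c ∘ s_i`. Hence `g_i`
identifies the weight spaces of `c` and `c ∘ s_i`, and a vector can be recovered after sorting. -/
theorem g_g_diff (hr : (r : K) ≠ 0) (hζ : Function.Injective ζ) (hζr : ∀ k, ζ k ^ r = 1)
    {c : Fin n → Fin r} {m : M} (hm : m ∈ wtSpace ρ ζ c) {i : ℕ} {h : i + 1 < n}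
    (hc : c ⟨i, by omega⟩ ≠ c ⟨i + 1, h⟩) :
    ρ (AffYok.g r q i h) (ρ (AffYok.g r q i h) m) = m := by
  classical
  rw [← Module.End.mul_apply, ← map_mul, AffYok.g_sq, map_add, map_one, map_smul, map_mul,
    LinearMap.add_apply, LinearMap.smul_apply, Module.End.mul_apply,
    e_apply hr hζ hζr (g_mem_wtSpace hm i h), if_neg]
  · simp
  · simpa using hc.symm

theorem g_g_same (hr : (r : K) ≠ 0) (hζ : Function.Injective ζ) (hζr : ∀ k, ζ k ^ r = 1)
    {c : Fin n → Fin r} {m : M} (hm : m ∈ wtSpace ρ ζ c) {i : ℕ} {h : i + 1 < n}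
    (hc : c ⟨i, by omega⟩ = c ⟨i + 1, h⟩) :
    ρ (AffYok.g r q i h) (ρ (AffYok.g r q i h) m) =
      m + ((q : K) - ((q⁻¹ : Kˣ) : K)) • ρ (AffYok.g r q i h) m := by
  classical
  rw [← Module.End.mul_apply, ← map_mul, AffYok.g_sq, map_add, map_one, map_smul, map_mul,
    LinearMap.add_apply, LinearMap.smul_apply, Module.End.mul_apply,
    e_apply hr hζ hζr (g_mem_wtSpace hm i h), if_pos]
  · simp
  · simpa using hc.symm

/-- With `g_i ^ 2 = 1` on the relevant weight spaces, `X_{i+1} = g_i X_i g_i` becomes plain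
conjugation: `g_i` permutes the `X_j` without the correction terms of the Bernstein relations. -/
theorem X_g_diff (hr : (r : K) ≠ 0) (hζ : Function.Injective ζ) (hζr : ∀ k, ζ k ^ r = 1)
    {c : Fin n → Fin r} {m : M} (hm : m ∈ wtSpace ρ ζ c) {i : ℕ} {h : i + 1 < n}
    (hc : c ⟨i, by omega⟩ ≠ c ⟨i + 1, h⟩) (j : Fin n) :
    ρ (AffYok.X r q j j.2) (ρ (AffYok.g r q i h) m) =
      ρ (AffYok.g r q i h) (ρ (AffYok.X r q (adj i h j) (Fin.is_lt _)) m) := by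
  obtain ⟨j, hj⟩ := j
  by_cases h1 : j = i
  · subst h1
    have h2 := X_mem_wtSpace (g_mem_wtSpace hm j h) j hj
    have h3 := g_g_diff hr hζ hζr h2 (i := j) (h := h) (by simpa using hc.symm)
    rw [adj_left]
    simp only [AffYok.X_succ, map_mul, Module.End.mul_apply]
    exact h3.symm
  by_cases h2 : j = i + 1
  · subst h2
    rw [adj_right]
    simp only [AffYok.X_succ, map_mul, Module.End.mul_apply]
    rw [g_g_diff hr hζ hζr hm hc]
  rw [adj_of_ne h1 h2]
  simp only [← Module.End.mul_apply, ← map_mul]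
  rw [(AffYok.g_commute_X i j h hj h1 h2).eq]

theorem Xinv_g_diff (hr : (r : K) ≠ 0) (hζ : Function.Injective ζ) (hζr : ∀ k, ζ k ^ r = 1)
    {c : Fin n → Fin r} {m : M} (hm : m ∈ wtSpace ρ ζ c) {i : ℕ} {h : i + 1 < n}
    (hc : c ⟨i, by omega⟩ ≠ c ⟨i + 1, h⟩) (j : Fin n) :
    ρ (AffYok.Xinv j j.2) (ρ (AffYok.g r q i h) m) =
      ρ (AffYok.g r q i h) (ρ (AffYok.Xinv (adj i h j) (Fin.is_lt _)) m) := by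
  have h1 := X_g_diff hr hζ hζr (Xinv_mem_wtSpace hm (adj i h j) (Fin.is_lt _)) hc j
  rw [X_Xinv_apply] at h1
  rw [← h1, Xinv_X_apply]

/-- A subspace stable under the generators is stable under `Ŷ_{r,n}`. -/
theorem stable_of_generators {P : Submodule K M}
    (ht : ∀ j, ∀ m ∈ P, ρ (AffYok.t r q j) m ∈ P)
    (hg : ∀ i h, ∀ m ∈ P, ρ (AffYok.g r q i h) m ∈ P)
    (hX : ∀ j h, ∀ m ∈ P, ρ (AffYok.X r q j h) m ∈ P)
    (hXi : ∀ j h, ∀ m ∈ P, ρ (AffYok.Xinv j h) m ∈ P) (a : AffYok r q n) :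
    ∀ m ∈ P, ρ a m ∈ P := by
  induction a using AffYok.induction with
  | ht j => exact ht j
  | hg i h => exact hg i h
  | hX h => exact hX 0 h
  | hXi h => rw [← AffYok.Xinv_zero]; exact hXi 0 h
  | hc c => intro m hm; rw [AlgHom.commutes]; exact P.smul_mem _ hm
  | hadd a b ha hb => intro m hm; rw [map_add]; exact P.add_mem (ha m hm) (hb m hm)
  | hmul a b ha hb => intro m hm; rw [map_mul]; exact ha _ (hb m hm)

/-- Linear factors are split off `p` as long as the cofactor still kills `m`; the first cofactor
that does not produces an eigenvector. No finiteness of `M` is needed, and since the eigenvector is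
a polynomial in `T` applied to `m`, it stays in every `T`-stable subspace containing `m`. -/
theorem exists_eigenvector_aeval [IsAlgClosed K] (T : Module.End K M) (p : Polynomial K)
    (hp : p ≠ 0) {m : M} (hm : m ≠ 0) (hpm : Polynomial.aeval T p m = 0) :
    ∃ (s : Polynomial K) (a : K), Polynomial.aeval T s m ≠ 0 ∧
      T (Polynomial.aeval T s m) = a • Polynomial.aeval T s m := by
  induction hd : p.natDegree using Nat.strong_induction_on generalizing p with
  | _ d ih =>
  have h0 : p.degree ≠ 0 := by
    intro h0
    rw [Polynomial.eq_C_of_degree_eq_zero h0, Polynomial.aeval_C,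
      Module.algebraMap_end_apply] at hpm
    rcases smul_eq_zero.1 hpm with h | h
    · rw [Polynomial.eq_C_of_degree_eq_zero h0, h, map_zero] at hp
      exact hp rfl
    · exact hm h
  obtain ⟨a, ha⟩ := IsAlgClosed.exists_root p h0
  obtain ⟨s, rfl⟩ := Polynomial.dvd_iff_isRoot.2 ha
  have hs : s ≠ 0 := right_ne_zero_of_mul hp
  by_cases h1 : Polynomial.aeval T s m = 0
  · refine ih s.natDegree ?_ s hs h1 rfl
    rw [← hd, Polynomial.natDegree_mul (Polynomial.X_sub_C_ne_zero a) hs,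
      Polynomial.natDegree_X_sub_C]
    omega
  · refine ⟨s, a, h1, ?_⟩
    rw [map_mul, Module.End.mul_apply, map_sub, Polynomial.aeval_X, Polynomial.aeval_C,
      LinearMap.sub_apply, Module.algebraMap_end_apply, sub_eq_zero] at hpm
    exact hpm

/-- The positions are treated one at a time. The new eigenvector is a polynomial in `t_j` applied to
the old one, so the eigenvalues already arranged for the other, commuting `t_i` persist. -/
theorem exists_mem_wtSpace [IsAlgClosed K] (hr : (r : K) ≠ 0)
    (hs : ∀ x : K, x ^ r = 1 → ∃ k, ζ k = x)
    {P : Submodule K M} (hP : P ≠ ⊥) (ht : ∀ j, ∀ m ∈ P, ρ (AffYok.t r q j) m ∈ P) :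
    ∃ c : Fin n → Fin r, ∃ m ∈ P, m ≠ 0 ∧ m ∈ wtSpace ρ ζ c := by
  have hr0 : r ≠ 0 := by rintro rfl; simp at hr
  have : ∀ s : Finset (Fin n), ∃ c : Fin n → Fin r, ∃ m ∈ P, m ≠ 0 ∧
      ∀ j ∈ s, ρ (AffYok.t r q j) m = ζ (c j) • m := by
    intro s
    induction s using Finset.induction_on with
    | empty =>
      obtain ⟨m, hm, h0⟩ := P.ne_bot_iff.1 hP
      -- No position is constrained yet, so any colour will do; one exists because `r ≠ 0`.
      exact ⟨fun _ => ⟨0, by omega⟩, m, hm, h0, by simp⟩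
    | insert j s hj ih =>
      obtain ⟨c, m, hm, h0, hms⟩ := ih
      obtain ⟨p, a, h1, h2⟩ := exists_eigenvector_aeval (ρ (AffYok.t r q j))
        (Polynomial.X ^ r - 1) (Polynomial.X_pow_sub_C_ne_zero (by omega) 1) h0
        (by rw [map_sub, map_pow, Polynomial.aeval_X, map_one, ← map_pow, AffYok.t_pow, map_one,
              sub_self, LinearMap.zero_apply])
      have hpow : ∀ k : ℕ, (ρ (AffYok.t r q j) ^ k)
          (Polynomial.aeval (ρ (AffYok.t r q j)) p m) =
          a ^ k • Polynomial.aeval (ρ (AffYok.t r q j)) p m := by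
        intro k
        induction k with
        | zero => simp
        | succ k ih => rw [pow_succ', Module.End.mul_apply, ih, map_smul, h2, smul_smul, pow_succ]
      have ha : a ^ r = 1 := by
        have h3 := hpow r
        rw [← map_pow, AffYok.t_pow, map_one, Module.End.one_apply] at h3
        have h4 : (a ^ r - 1) • Polynomial.aeval (ρ (AffYok.t r q j)) p m = 0 := by
          rw [sub_smul, ← h3, one_smul, sub_self]
        exact sub_eq_zero.1 ((smul_eq_zero.1 h4).resolve_right h1)
      obtain ⟨k, rfl⟩ := hs a ha
      refine ⟨Function.update c j k, _, ?_, h1, ?_⟩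
      · clear h1 h2 hpow
        induction p using Polynomial.induction_on' with
        | add p p' h h' => rw [map_add]; exact P.add_mem h h'
        | monomial d a =>
          rw [Polynomial.aeval_monomial, Module.End.mul_apply, Module.algebraMap_end_apply]
          refine P.smul_mem _ ?_
          clear a ha
          induction d with
          | zero => simpa using hm
          | succ d ih => rw [pow_succ', Module.End.mul_apply]; exact ht _ _ ih
      · intro i hi
        by_cases hij : i = j
        · subst hij
          rw [Function.update_self, h2]
        · rw [Function.update_of_ne hij]
          have h3 : Commute (ρ (AffYok.t r q i)) (Polynomial.aeval (ρ (AffYok.t r q j)) p) := by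
            have h4 : Polynomial.aeval (ρ (AffYok.t r q j)) p =
              ρ (Polynomial.aeval (AffYok.t r q j) p) := Polynomial.aeval_algHom_apply _ _ _
            rw [h4]
            refine Commute.map ?_ ρ
            have h5 : Commute (AffYok.t r q i) (AffYok.t r q j) := AffYok.t_comm i j
            clear h1 h2 hpow h4
            induction p using Polynomial.induction_on' with
            | add p p' h h' => rw [map_add]; exact h.add_right h'
            | monomial d a =>
              rw [Polynomial.aeval_monomial]
              exact (Algebra.commute_algebraMap_right _ _).mul_right (h5.pow_right d)
          rw [← Module.End.mul_apply, h3.eq, Module.End.mul_apply,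
            hms i ((Finset.mem_insert.1 hi).resolve_left hij), map_smul]
  obtain ⟨c, m, hm, h0, h1⟩ := this Finset.univ
  exact ⟨c, m, hm, h0, fun j => h1 j (Finset.mem_univ j)⟩

/-- Each stable nonzero subspace contains a weight vector with increasing colouring. -/
theorem exists_mem_wtSpace_monotone [IsAlgClosed K] (hr : (r : K) ≠ 0)
    (hζ : Function.Injective ζ) (hζr : ∀ k, ζ k ^ r = 1) (hs : ∀ x : K, x ^ r = 1 → ∃ k, ζ k = x)
    {P : Submodule K M} (hP : P ≠ ⊥) (hst : ∀ a, ∀ m ∈ P, ρ a m ∈ P) :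
    ∃ c : Fin n → Fin r, Monotone c ∧ ∃ m ∈ P, m ≠ 0 ∧ m ∈ wtSpace ρ ζ c := by
  obtain ⟨c, m, hm, h0, hc⟩ := exists_mem_wtSpace (n := n) hr hs hP fun j m hm => hst _ m hm
  induction hd : ht c using Nat.strong_induction_on generalizing c m with
  | _ d ih =>
  subst hd
  by_cases hmon : Monotone c
  · exact ⟨c, hmon, m, hm, h0, hc⟩
  -- Applying `g_i` at a descent lowers the height and cannot kill the vector, as `g_i` is an
  -- involution there.
  · obtain ⟨i, h, hlt⟩ := exists_descent hmon
    refine ih _ (ht_gt hlt) (c ∘ adj i h) _ (hst (AffYok.g r q i h) m hm) ?_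
      (g_mem_wtSpace hc i h) rfl
    intro h1
    apply h0
    rw [← g_g_diff hr hζ hζr hc hlt.ne', h1, map_zero]

variable (ρ) in
open Classical in
/-- The projection to a weight space is given by an element of `Ŷ_{r,n}`. -/
theorem exists_projection (hr : (r : K) ≠ 0) (hζ : Function.Injective ζ)
    (hζr : ∀ k, ζ k ^ r = 1) (c : Fin n → Fin r) :
    ∃ a : AffYok r q n, ∀ c', ∀ m ∈ wtSpace ρ ζ c', ρ a m = if c' = c then m else 0 := by
  have : ∀ s : Finset (Fin n), ∃ a : AffYok r q n, ∀ c', ∀ m ∈ wtSpace ρ ζ c',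
      ρ a m = if ∀ j ∈ s, c' j = c j then m else 0 := by
    intro s
    induction s using Finset.induction_on with
    | empty => exact ⟨1, by simp⟩
    | insert j s _ ih =>
      obtain ⟨a, ha⟩ := ih
      -- The new factor is the character idempotent of `t_j` for the eigenvalue `ζ (c j)`, with `ζ
      -- (c j) ^ (-s)` written as `ζ (c j) ^ (r - s)`.
      refine ⟨a * ((r : K)⁻¹ • ∑ s ∈ Finset.range r, ζ (c j) ^ (r - s) • AffYok.t r q j ^ s),
        fun c' m hm => ?_⟩
      have h1 : ρ ((r : K)⁻¹ • ∑ s ∈ Finset.range r, ζ (c j) ^ (r - s) • AffYok.t r q j ^ s) m =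
          if c' j = c j then m else 0 := by
        have h2 := sum_roots hr (hζr (c' j)) (hζr (c j))
        rw [hζ.eq_iff] at h2
        rw [map_smul, map_sum, LinearMap.smul_apply, LinearMap.sum_apply]
        have h3 : ∀ s ∈ Finset.range r, ρ (ζ (c j) ^ (r - s) • AffYok.t r q j ^ s) m =
            (ζ (c' j) ^ s * ζ (c j) ^ (r - s)) • m := by
          intro s _
          rw [map_smul, LinearMap.smul_apply, t_pow_apply hm, smul_smul, mul_comm]
        rw [Finset.sum_congr rfl h3, ← Finset.sum_smul, smul_smul, h2]
        split_ifs <;> simp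
      rw [map_mul, Module.End.mul_apply, h1]
      simp only [Finset.forall_mem_insert]
      by_cases h4 : c' j = c j
      · rw [if_pos h4, ha c' m hm]
        simp [h4]
      · simp [h4]
  obtain ⟨a, ha⟩ := this Finset.univ
  refine ⟨a, fun c' m hm => ?_⟩
  rw [ha c' m hm]
  simp [funext_iff]

end Weights

/-! ## Moving a subspace through the weight spaces -/

section Reach

variable {K : Type u} [Field K] {r n : ℕ} {q : Kˣ} {M : Type w} [AddCommGroup M] [Module K M]

/-- The vectors obtained from a subspace `N` of weight `c₀` by applying `g_i` at ascents. -/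
inductive Reach (ρ : AffYok r q n →ₐ[K] Module.End K M) (N : Submodule K M) (c₀ : Fin n → Fin r) :
    (Fin n → Fin r) → M → Prop
  | base {m : M} (h : m ∈ N) : Reach ρ N c₀ c₀ m
  | step {c : Fin n → Fin r} {m : M} (i : ℕ) (h : i + 1 < n)
      (hc : c ⟨i, by omega⟩ < c ⟨i + 1, h⟩) (hm : Reach ρ N c₀ c m) :
      Reach ρ N c₀ (c ∘ adj i h) (ρ (AffYok.g r q i h) m)

variable {ρ : AffYok r q n →ₐ[K] Module.End K M} {ζ : Fin r → K} {N : Submodule K M}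
  {c₀ : Fin n → Fin r}

theorem Reach.mem_wtSpace (hN : N ≤ wtSpace ρ ζ c₀) {c : Fin n → Fin r} {m : M}
    (hm : Reach ρ N c₀ c m) : m ∈ wtSpace ρ ζ c := by
  induction hm with
  | base h => exact hN h
  | step i h hc _ ih => exact g_mem_wtSpace ih i h

/-- Applying `g_i` at a descent, for a vector known to be reached from below. -/
theorem Reach.down (hr : (r : K) ≠ 0) (hζ : Function.Injective ζ) (hζr : ∀ k, ζ k ^ r = 1)
    (hN : N ≤ wtSpace ρ ζ c₀) {c : Fin n → Fin r} {m : M} (hm : Reach ρ N c₀ c m) {i : ℕ}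
    {h : i + 1 < n} (hc : c ⟨i, by omega⟩ < c ⟨i + 1, h⟩) :
    Reach ρ N c₀ ((c ∘ adj i h) ∘ adj i h) (ρ (AffYok.g r q i h) (ρ (AffYok.g r q i h) m)) := by
  rw [comp_adj_adj, g_g_diff hr hζ hζr (hm.mem_wtSpace hN) hc.ne]
  exact hm

/-- The heart of the comparison with the induced module: vectors reached by ascents alone are stable
under every `g_j`. Induction on the height, looking at the last step `g_i m`, where `m` has
colouring `c` with `c i < c (i+1)`. For distant `i`, `j` the generators commute; for `i = j`, `g_i ^
2 m = m`. For `j = i + 1`, let `a < b`, `d` be the colours at `i`, `i+1`, `i+2`. If `a < d`, then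
`g_j` is again an ascent. If `d ≤ a`, then `c` has a descent at `j`, so `m = g_j g_j m`, and the
braid relation gives `g_j g_i m = g_i g_j g_i (g_j m)`. The vector `g_j m` has smaller height than
`g_i m`, so induction allows the inner `g_i`, after which `g_j` and then `g_i` act at ascents. The
case `i = j + 1` is the mirror image. -/
theorem Reach.g (hr : (r : K) ≠ 0) (hζ : Function.Injective ζ) (hζr : ∀ k, ζ k ^ r = 1)
    (hN : N ≤ wtSpace ρ ζ c₀) (hc₀ : Monotone c₀)
    (hg : ∀ (i : ℕ) (h : i + 1 < n), c₀ ⟨i, by omega⟩ = c₀ ⟨i + 1, h⟩ →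
      ∀ m ∈ N, ρ (AffYok.g r q i h) m ∈ N)
    {c : Fin n → Fin r} {m : M} (hm : Reach ρ N c₀ c m) (j : ℕ) (hj : j + 1 < n) :
    (c ⟨j, by omega⟩ = c ⟨j + 1, hj⟩ → Reach ρ N c₀ c (ρ (AffYok.g r q j hj) m)) ∧
    (c ⟨j, by omega⟩ ≠ c ⟨j + 1, hj⟩ →
      Reach ρ N c₀ (c ∘ adj j hj) (ρ (AffYok.g r q j hj) m)) := by
  induction hd : ht c using Nat.strong_induction_on generalizing c m j with
  | _ d ih =>
  subst hd
  cases hm with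
  | base h =>
    refine ⟨fun hc => .base (hg j hj hc m h), fun hc => ?_⟩
    -- In an increasing colouring two different neighbouring colours form an ascent.
    exact .step j hj (lt_of_le_of_ne (hc₀ (by simp [Fin.le_def])) hc) (.base h)
  | @step c m i hi hc hm =>
    have hlt := ht_lt hc
    have hwt := hm.mem_wtSpace hN
    have gg : ∀ (a b : ℕ) (ha : a + 1 < n) (hb : b + 1 < n) (x : M), (a + 2 ≤ b ∨ b + 2 ≤ a) →
        ρ (AffYok.g r q a ha) (ρ (AffYok.g r q b hb) x) =
        ρ (AffYok.g r q b hb) (ρ (AffYok.g r q a ha) x) := by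
      intro a b ha hb x hab
      simp only [← Module.End.mul_apply, ← map_mul, AffYok.far a b ha hb hab]
    have ggg : ∀ (a : ℕ) (ha : a + 1 + 1 < n) (x : M),
        ρ (AffYok.g r q a (by omega)) (ρ (AffYok.g r q (a + 1) ha)
          (ρ (AffYok.g r q a (by omega)) x)) =
        ρ (AffYok.g r q (a + 1) ha) (ρ (AffYok.g r q a (by omega))
          (ρ (AffYok.g r q (a + 1) ha) x)) := by
      intro a ha x
      simp only [← Module.End.mul_apply, ← map_mul, ← mul_assoc, AffYok.braid a ha]
    by_cases hij : i + 2 ≤ j ∨ j + 2 ≤ i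
    · -- commuting generators
      have e1 : (c ∘ adj i hi) ⟨j, by omega⟩ = c ⟨j, by omega⟩ := by
        rw [Function.comp_apply, adj_of_ne (by omega) (by omega)]
      have e2 : (c ∘ adj i hi) ⟨j + 1, hj⟩ = c ⟨j + 1, hj⟩ := by
        rw [Function.comp_apply, adj_of_ne (by omega) (by omega)]
      have e3 : (c ∘ adj j hj) ⟨i, by omega⟩ = c ⟨i, by omega⟩ := by
        rw [Function.comp_apply, adj_of_ne (by omega) (by omega)]
      have e4 : (c ∘ adj j hj) ⟨i + 1, hi⟩ = c ⟨i + 1, hi⟩ := by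
        rw [Function.comp_apply, adj_of_ne (by omega) (by omega)]
      have h1 := ih _ hlt hm j hj rfl
      rw [e1, e2, gg j i _ _ _ (by omega), comp_adj_far c i j hi hj hij]
      exact ⟨fun h => .step i hi hc (h1.1 h), fun h => .step i hi (by rw [e3, e4]; exact hc) (h1.2 h)⟩
    rcases Nat.lt_trichotomy i j with hlt' | rfl | hlt'
    · obtain rfl : j = i + 1 := by omega
      have e0 : (c ∘ adj i hi) ⟨i + 1, hi⟩ = c ⟨i, by omega⟩ := by
        rw [Function.comp_apply, adj_right]
      have e1 : (c ∘ adj i hi) ⟨i + 1 + 1, hj⟩ = c ⟨i + 1 + 1, hj⟩ := by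
        rw [Function.comp_apply, adj_of_ne (by omega) (by omega)]
      have f0 : (c ∘ adj (i + 1) hj) ⟨i, by omega⟩ = c ⟨i, by omega⟩ := by
        rw [Function.comp_apply, adj_of_ne (by omega) (by omega)]
      have f1 : (c ∘ adj (i + 1) hj) ⟨i + 1, hi⟩ = c ⟨i + 1 + 1, hj⟩ := by
        rw [Function.comp_apply, adj_left]
      have f2 : (c ∘ adj (i + 1) hj) ⟨i + 1 + 1, hj⟩ = c ⟨i + 1, hi⟩ := by
        rw [Function.comp_apply, adj_right]
      rw [e0, e1]
      -- the vector with `g_j` applied first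
      have key : c ⟨i + 1 + 1, hj⟩ < c ⟨i + 1, hi⟩ →
          Reach ρ N c₀ (c ∘ adj (i + 1) hj) (ρ (AffYok.g r q (i + 1) hj) m) ∧
          ht (c ∘ adj (i + 1) hj) < ht (c ∘ adj i hi) ∧
          ρ (AffYok.g r q (i + 1) hj) (ρ (AffYok.g r q i hi) m) =
            ρ (AffYok.g r q i hi) (ρ (AffYok.g r q (i + 1) hj) (ρ (AffYok.g r q i hi)
              (ρ (AffYok.g r q (i + 1) hj) m))) := by
        intro h
        refine ⟨(ih _ hlt hm (i + 1) hj rfl).2 h.ne', (ht_gt h).trans hlt, ?_⟩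
        rw [ggg, g_g_diff hr hζ hζr hwt h.ne']
      constructor
      · intro h
        obtain ⟨k1, k2, k3⟩ := key (by rw [← h]; exact hc)
        rw [k3]
        have h2 := (ih _ k2 k1 i hi rfl).1 (by rw [f0, f1, h])
        have h3 := Reach.step (i + 1) hj (by rw [f1, f2, ← h]; exact hc) h2
        rw [comp_adj_adj] at h3
        exact .step i hi hc h3
      · intro h
        rcases lt_or_gt_of_ne h with h | h
        · exact .step (i + 1) hj (by rw [e0, e1]; exact h) (.step i hi hc hm)
        · obtain ⟨k1, k2, k3⟩ := key (h.trans hc)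
          rw [k3]
          have h2 := (ih _ k2 k1 i hi rfl).2 (by rw [f0, f1]; exact h.ne')
          have h3 := Reach.step (i + 1) hj (by
            simp only [Function.comp_apply, adj_right]
            rw [adj_of_ne (i := i) (by omega) (by omega), adj_right,
              adj_of_ne (i := i + 1) (by omega) (by omega)]
            exact hc) h2
          have h4 := Reach.step i hi (by
            simp only [Function.comp_apply, adj_left]
            rw [adj_of_ne (i := i + 1) (j := i) (by omega) (by omega), adj_left, adj_left,
              adj_of_ne (i := i) (by omega) (by omega), adj_right]
            exact h.trans hc) h3
          rw [← comp_adj_braid, comp_adj_adj] at h4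
          exact h4
    · refine ⟨fun h => absurd h ?_, fun _ => hm.down hr hζ hζr hN hc⟩
      simpa using hc.ne'
    · obtain rfl : i = j + 1 := by omega
      have e0 : (c ∘ adj (j + 1) hi) ⟨j, by omega⟩ = c ⟨j, by omega⟩ := by
        rw [Function.comp_apply, adj_of_ne (by omega) (by omega)]
      have e1 : (c ∘ adj (j + 1) hi) ⟨j + 1, hj⟩ = c ⟨j + 1 + 1, hi⟩ := by
        rw [Function.comp_apply, adj_left]
      have f0 : (c ∘ adj j hj) ⟨j, by omega⟩ = c ⟨j + 1, hj⟩ := by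
        rw [Function.comp_apply, adj_left]
      have f1 : (c ∘ adj j hj) ⟨j + 1, hj⟩ = c ⟨j, by omega⟩ := by
        rw [Function.comp_apply, adj_right]
      have f2 : (c ∘ adj j hj) ⟨j + 1 + 1, hi⟩ = c ⟨j + 1 + 1, hi⟩ := by
        rw [Function.comp_apply, adj_of_ne (by omega) (by omega)]
      rw [e0, e1]
      -- Mirror image of the previous case: now `c` has a descent at `j`, so `m = g_j g_j m`, and
      -- the braid relation is used in the other direction.
      have key : c ⟨j + 1, hj⟩ < c ⟨j, by omega⟩ →
          Reach ρ N c₀ (c ∘ adj j hj) (ρ (AffYok.g r q j hj) m) ∧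
          ht (c ∘ adj j hj) < ht (c ∘ adj (j + 1) hi) ∧
          ρ (AffYok.g r q j hj) (ρ (AffYok.g r q (j + 1) hi) m) =
            ρ (AffYok.g r q (j + 1) hi) (ρ (AffYok.g r q j hj) (ρ (AffYok.g r q (j + 1) hi)
              (ρ (AffYok.g r q j hj) m))) := by
        intro h
        refine ⟨(ih _ hlt hm j hj rfl).2 h.ne', (ht_gt h).trans hlt, ?_⟩
        rw [← ggg, g_g_diff hr hζ hζr hwt h.ne']
      constructor
      · intro h
        obtain ⟨k1, k2, k3⟩ := key (by rw [h]; exact hc)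
        rw [k3]
        have h2 := (ih _ k2 k1 (j + 1) hi rfl).1 (by rw [f1, f2, h])
        have h3 := Reach.step j hj (by rw [f0, f1, h]; exact hc) h2
        rw [comp_adj_adj] at h3
        exact .step (j + 1) hi hc h3
      · intro h
        rcases lt_or_gt_of_ne h with h | h
        · exact .step j hj (by rw [e0, e1]; exact h) (.step (j + 1) hi hc hm)
        · obtain ⟨k1, k2, k3⟩ := key (hc.trans h)
          rw [k3]
          have h2 := (ih _ k2 k1 (j + 1) hi rfl).2 (by rw [f1, f2]; exact h.ne')
          have h3 := Reach.step j hj (by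
            simp only [Function.comp_apply, adj_left]
            rw [adj_of_ne (i := j + 1) (by omega) (by omega), adj_left,
              adj_of_ne (i := j) (j := j + 1 + 1) (by omega) (by omega)]
            exact hc) h2
          have h4 := Reach.step (j + 1) hi (by
            simp only [Function.comp_apply, adj_right]
            rw [adj_of_ne (i := j + 1) (j := j) (by omega) (by omega), adj_left,
              adj_of_ne (i := j) (j := j + 1 + 1) (by omega) (by omega), adj_right, adj_right]
            exact hc.trans h) h3
          rw [comp_adj_braid, comp_adj_adj] at h4
          exact h4

/-- Every step is taken at different colours, so `X_j` passes through it with a permuted index until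
it acts on `N`. -/
theorem Reach.X (hr : (r : K) ≠ 0) (hζ : Function.Injective ζ) (hζr : ∀ k, ζ k ^ r = 1)
    (hN : N ≤ wtSpace ρ ζ c₀)
    (hX : ∀ (j : ℕ) (h : j < n), ∀ m ∈ N, ρ (AffYok.X r q j h) m ∈ N)
    {c : Fin n → Fin r} {m : M} (hm : Reach ρ N c₀ c m) (j : Fin n) :
    Reach ρ N c₀ c (ρ (AffYok.X r q j j.2) m) := by
  induction hm generalizing j with
  | base h => exact .base (hX _ _ _ h)
  | step i h hc hm ih =>
    rw [X_g_diff hr hζ hζr (hm.mem_wtSpace hN) hc.ne]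
    exact .step i h hc (ih _)

theorem Reach.Xinv (hr : (r : K) ≠ 0) (hζ : Function.Injective ζ) (hζr : ∀ k, ζ k ^ r = 1)
    (hN : N ≤ wtSpace ρ ζ c₀)
    (hX : ∀ (j : ℕ) (h : j < n), ∀ m ∈ N, ρ (AffYok.Xinv j h) m ∈ N)
    {c : Fin n → Fin r} {m : M} (hm : Reach ρ N c₀ c m) (j : Fin n) :
    Reach ρ N c₀ c (ρ (AffYok.Xinv j j.2) m) := by
  induction hm generalizing j with
  | base h => exact .base (hX _ _ _ h)
  | step i h hc hm ih =>
    rw [Xinv_g_diff hr hζ hζr (hm.mem_wtSpace hN) hc.ne]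
    exact .step i h hc (ih _)

/-- A step at an ascent leaves a descent behind, so an increasing colouring can only come from the
base. Thus the reached part of the module contains nothing beyond `N` at increasing colourings. -/
theorem Reach.mem_of_monotone {c : Fin n → Fin r} {m : M}
    (hm : Reach ρ N c₀ c m) (hc : Monotone c) : m ∈ N := by
  cases hm with
  | base h => exact h
  | @step c m i h hlt hm =>
    have := hc (show (⟨i, by omega⟩ : Fin n) ≤ ⟨i + 1, h⟩ by simp [Fin.le_def])
    simp only [Function.comp_apply, adj_left, adj_right] at this
    exact absurd hlt this.not_gt

variable (ρ N c₀) in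
/-- The subspace spanned by the vectors reached at the colouring `c`. -/
def reachSpan (c : Fin n → Fin r) : Submodule K M := Submodule.span K {m | Reach ρ N c₀ c m}

theorem reachSpan_le_wtSpace (hN : N ≤ wtSpace ρ ζ c₀) (c : Fin n → Fin r) :
    reachSpan ρ N c₀ c ≤ wtSpace ρ ζ c :=
  Submodule.span_le.2 fun _ hm => Reach.mem_wtSpace hN hm

theorem map_mem_reachSpan {c c' : Fin n → Fin r} (T : Module.End K M)
    (hT : ∀ m, Reach ρ N c₀ c m → Reach ρ N c₀ c' (T m)) {m : M} (hm : m ∈ reachSpan ρ N c₀ c) :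
    T m ∈ reachSpan ρ N c₀ c' := by
  have : reachSpan ρ N c₀ c ≤ (reachSpan ρ N c₀ c').comap T :=
    Submodule.span_le.2 fun m hm => Submodule.subset_span (hT m hm)
  exact this hm

/-- If `N` generates the module, the module is the sum of the subspaces spanned by the
reached vectors. -/
theorem iSup_reachSpan (hr : (r : K) ≠ 0) (hζ : Function.Injective ζ) (hζr : ∀ k, ζ k ^ r = 1)
    (hN : N ≤ wtSpace ρ ζ c₀) (hc₀ : Monotone c₀)
    (hg : ∀ (i : ℕ) (h : i + 1 < n), c₀ ⟨i, by omega⟩ = c₀ ⟨i + 1, h⟩ →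
      ∀ m ∈ N, ρ (AffYok.g r q i h) m ∈ N)
    (hX : ∀ (j : ℕ) (h : j < n), ∀ m ∈ N, ρ (AffYok.X r q j h) m ∈ N)
    (hXi : ∀ (j : ℕ) (h : j < n), ∀ m ∈ N, ρ (AffYok.Xinv j h) m ∈ N)
    (hgen : ∀ P : Submodule K M, (∀ a, ∀ m ∈ P, ρ a m ∈ P) → N ≤ P → P = ⊤) :
    ⨆ c, reachSpan ρ N c₀ c = ⊤ := by
  have aux : ∀ T : Module.End K M, (∀ c, ∃ c', ∀ m ∈ reachSpan ρ N c₀ c,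
      T m ∈ reachSpan ρ N c₀ c') → ∀ m ∈ ⨆ c, reachSpan ρ N c₀ c,
      T m ∈ ⨆ c, reachSpan ρ N c₀ c := by
    intro T hT
    have : ⨆ c, reachSpan ρ N c₀ c ≤ (⨆ c, reachSpan ρ N c₀ c).comap T := by
      refine iSup_le fun c m hm => ?_
      obtain ⟨c', hc'⟩ := hT c
      exact Submodule.mem_iSup_of_mem c' (hc' m hm)
    exact fun m hm => this hm
  refine hgen _ (stable_of_generators ?_ ?_ ?_ ?_) ?_
  · refine fun j => aux _ fun c => ⟨c, fun m hm => ?_⟩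
    rw [reachSpan_le_wtSpace hN c hm j]
    exact Submodule.smul_mem _ _ hm
  · refine fun j hj => aux _ fun c => ?_
    by_cases hc : c ⟨j, by omega⟩ = c ⟨j + 1, hj⟩
    · exact ⟨c, fun m => map_mem_reachSpan _ fun m hm =>
        (hm.g hr hζ hζr hN hc₀ hg j hj).1 hc⟩
    · exact ⟨_, fun m => map_mem_reachSpan _ fun m hm =>
        (hm.g hr hζ hζr hN hc₀ hg j hj).2 hc⟩
  · exact fun j hj => aux _ fun c => ⟨c, fun m => map_mem_reachSpan _ fun m hm =>
      hm.X hr hζ hζr hN hX ⟨j, hj⟩⟩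
  · exact fun j hj => aux _ fun c => ⟨c, fun m => map_mem_reachSpan _ fun m hm =>
      hm.Xinv hr hζ hζr hN hXi ⟨j, hj⟩⟩
  · exact fun m hm => Submodule.mem_iSup_of_mem c₀ (Submodule.subset_span (.base hm))

/-- An intertwiner which is injective on `N` is injective on the vectors reached from `N`. -/
theorem eq_zero_of_mem_reachSpan (hr : (r : K) ≠ 0) (hζ : Function.Injective ζ)
    (hζr : ∀ k, ζ k ^ r = 1) (hN : N ≤ wtSpace ρ ζ c₀) (hc₀ : Monotone c₀)
    (hg : ∀ (i : ℕ) (h : i + 1 < n), c₀ ⟨i, by omega⟩ = c₀ ⟨i + 1, h⟩ →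
      ∀ m ∈ N, ρ (AffYok.g r q i h) m ∈ N)
    {M' : Type v} [AddCommGroup M'] [Module K M'] (ρ' : AffYok r q n →ₐ[K] Module.End K M')
    (Φ : M →ₗ[K] M') (hΦ : ∀ a m, Φ (ρ a m) = ρ' a (Φ m)) (hinj : ∀ m ∈ N, Φ m = 0 → m = 0)
    (c : Fin n → Fin r) {m : M} (hm : m ∈ reachSpan ρ N c₀ c) (h0 : Φ m = 0) : m = 0 := by
  induction hd : ht c using Nat.strong_induction_on generalizing c m with
  | _ d ih =>
  subst hd
  by_cases hc : Monotone c
  · have : reachSpan ρ N c₀ c ≤ N :=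
      Submodule.span_le.2 fun m hm => Reach.mem_of_monotone hm hc
    exact hinj m (this hm) h0
  -- Move `m` to lower height by `g_i`, apply the induction hypothesis there, and return by the same
  -- involution.
  · obtain ⟨i, h, hlt⟩ := exists_descent hc
    have h1 : ρ (AffYok.g r q i h) m ∈ reachSpan ρ N c₀ (c ∘ adj i h) :=
      map_mem_reachSpan _ (fun m hm => (hm.g hr hζ hζr hN hc₀ hg i h).2 hlt.ne') hm
    have h2 := ih _ (ht_gt hlt) _ h1 (by rw [hΦ, h0, map_zero]) rfl
    rw [← g_g_diff hr hζ hζr (reachSpan_le_wtSpace hN c hm) hlt.ne', h2, map_zero]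

end Reach

/-! ## The universal property of induction -/

section Induction

variable {K : Type u} [Field K] {A : Type v} [Ring A] [Algebra K A]
  {B : Subalgebra K A} {N : Type*} [AddCommGroup N] [Module K N] {ρ : B →ₐ[K] Module.End K N}
  {M : Type*} [AddCommGroup M] [Module K M] (τ : A →ₐ[K] Module.End K M) (θ : N →ₗ[K] M)
  (hθ : ∀ (b : B) z, τ b (θ z) = θ (ρ b z))

/-- The map from the induced module extending a `B`-linear map. -/
def indLift : Ind B ρ →ₗ[K] M :=
  letI Ψ : (A ⊗[K] N) →ₗ[K] M :=
    TensorProduct.lift ((LinearMap.lcomp K M θ) ∘ₗ τ.toLinearMap)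
  Submodule.liftQ ((indRel B ρ).restrictScalars K) Ψ (by
    have hΨ : ∀ (a : A) (x : A ⊗[K] N), Ψ (a • x) = τ a (Ψ x) := by
      intro a x
      induction x with
      | zero => simp
      | add x y hx hy => rw [smul_add, map_add, hx, hy, map_add, map_add]
      | tmul b w => simp [Ψ, TensorProduct.smul_tmul']
    intro x hx
    rw [LinearMap.mem_ker]
    induction (hx : x ∈ indRel B ρ) using Submodule.span_induction with
    | mem x h =>
      obtain ⟨a, b, z, rfl⟩ := h
      rw [map_sub, sub_eq_zero]
      simp only [Ψ, TensorProduct.lift.tmul, LinearMap.comp_apply, AlgHom.toLinearMap_apply,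
        LinearMap.lcomp_apply, map_mul, Module.End.mul_apply, hθ]
    | zero => exact map_zero _
    | add x y _ _ hx hy => rw [map_add, hx, hy, add_zero]
    | smul a x _ hx => rw [hΨ, hx, map_zero])

theorem indLift_mk (a : A) (z : N) :
    indLift τ θ hθ (Submodule.Quotient.mk (a ⊗ₜ[K] z)) = τ a (θ z) := rfl

theorem indLift_smul (a : A) (x : Ind B ρ) :
    indLift τ θ hθ (a • x) = τ a (indLift τ θ hθ x) := by
  obtain ⟨x, rfl⟩ := Submodule.Quotient.mk_surjective _ x
  induction x with
  | zero => rw [Submodule.Quotient.mk_zero, smul_zero, map_zero, map_zero]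
  | add x y hx hy => rw [Submodule.Quotient.mk_add, smul_add, map_add, hx, hy, map_add, map_add]
  | tmul b z =>
    rw [← Submodule.Quotient.mk_smul, TensorProduct.smul_tmul', smul_eq_mul, indLift_mk,
      indLift_mk, map_mul, Module.End.mul_apply]

end Induction

/-! ## Functions on shuffles -/

namespace Comp

variable {r n : ℕ} (μ : Comp r n)

theorem val_pos_succ (k : Fin r) (a : ℕ) (h : a + 1 < μ.part k) :
    (μ.pos ⟨k, a + 1, h⟩ : ℕ) = μ.pos ⟨k, a, by omega⟩ + 1 := by
  simp only [Comp.pos, Equiv.trans_apply, finCongr_apply, Fin.val_cast, finSigmaFinEquiv_apply]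
  omega

theorem pos_succ_lt (k : Fin r) (a : ℕ) (h : a + 1 < μ.part k) :
    (μ.pos ⟨k, a, by omega⟩ : ℕ) + 1 < n := by
  rw [← val_pos_succ μ k a h]
  exact Fin.is_lt _

theorem pos_succ (k : Fin r) (a : ℕ) (h : a + 1 < μ.part k) :
    μ.pos ⟨k, a + 1, h⟩ = ⟨μ.pos ⟨k, a, by omega⟩ + 1, μ.pos_succ_lt k a h⟩ :=
  Fin.ext (μ.val_pos_succ k a h)

theorem sameBlock_pos (k : Fin r) (a : ℕ) (h : a + 1 < μ.part k) :
    μ.SameBlock (μ.pos ⟨k, a, by omega⟩) (μ.pos_succ_lt k a h) := by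
  rw [Comp.SameBlock, ← pos_succ μ k a h]
  simp

end Comp

namespace Shuffle

variable {r n : ℕ} {μ : Comp r n}

/-- The colouring of the positions by the blocks of a shuffle. -/
def col (σ : Shuffle μ) : Fin n → Fin r := fun j => (σ.1 j).1

theorem col_std : (std μ).col = fun j => (μ.pos.symm j).1 := rfl

/-- A strictly increasing enumeration is determined by its range, here the set of positions of
colour `k`. Consequently a shuffle is determined by its colouring. -/
theorem eq_of_mem_block {σ τ : Shuffle μ} (k : Fin r)
    (h : ∀ j, σ.col j = k ↔ τ.col j = k) (a : Fin (μ.part k)) :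
    σ.1.symm ⟨k, a⟩ = τ.1.symm ⟨k, a⟩ := by
  have hr : ∀ ρ : Shuffle μ, Set.range (fun a => ρ.1.symm ⟨k, a⟩) = {j | ρ.col j = k} := by
    intro ρ
    ext j
    constructor
    · rintro ⟨a, rfl⟩
      simp [col]
    · intro hj
      rcases hp : ρ.1 j with ⟨k', b⟩
      have : k' = k := by
        have : ρ.col j = k := hj
        rw [col, hp] at this
        exact this
      subst this
      exact ⟨b, (Equiv.symm_apply_eq _).2 hp.symm⟩
  have : (fun a => σ.1.symm ⟨k, a⟩) = fun a => τ.1.symm ⟨k, a⟩ := by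
    refine (σ.2 k).range_inj (τ.2 k) |>.1 ?_
    rw [hr, hr]
    ext j
    exact h j
  exact congrFun this a

theorem col_injective : Function.Injective (col (μ := μ)) := by
  intro σ τ h
  apply Subtype.ext
  rw [← σ.1.symm_symm, ← τ.1.symm_symm]
  congr 1
  apply Equiv.ext
  rintro ⟨k, a⟩
  exact eq_of_mem_block k (fun j => by rw [h]) a

theorem monotone_col_std : Monotone (std μ).col := by
  intro i j hij
  rcases hp : μ.pos.symm i with ⟨k, a⟩
  rcases hp' : μ.pos.symm j with ⟨l, b⟩
  simp only [col_std, hp, hp']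
  by_contra! hlt
  have hi : i = μ.pos ⟨k, a⟩ := by rw [← hp]; simp
  have hj : j = μ.pos ⟨l, b⟩ := by rw [← hp']; simp
  rw [hi, hj, Fin.le_def] at hij
  simp only [Comp.pos, Equiv.trans_apply, finCongr_apply, Fin.val_cast,
    finSigmaFinEquiv_apply] at hij
  -- If block `l` precedes block `k`, it ends no later than block `k` starts. The partial sums over
  -- `Fin` are rewritten as sums over ranges of `ℕ`, extended by zero, so that they can be compared
  -- by inclusion.
  have h1 : ∑ i : Fin (l : ℕ), μ.part (Fin.castLE l.2.le i) + μ.part l ≤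
      ∑ i : Fin (k : ℕ), μ.part (Fin.castLE k.2.le i) := by
    have e : ∀ m : Fin r, ∑ i : Fin (m : ℕ), μ.part (Fin.castLE m.2.le i) =
        ∑ i ∈ Finset.range m, if h : i < r then μ.part ⟨i, h⟩ else 0 := by
      intro m
      rw [Finset.sum_range]
      refine Finset.sum_congr rfl fun i _ => ?_
      rw [dif_pos (i.2.trans m.2)]
      rfl
    have e' : μ.part l = if h : (l : ℕ) < r then μ.part ⟨l, h⟩ else 0 := by rw [dif_pos l.2]
    rw [e, e, e', ← Finset.sum_range_succ]
    refine Finset.sum_le_sum_of_subset (Finset.range_mono ?_)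
    exact Fin.lt_def.1 hlt
  have := b.2
  omega

/-- The colouring of `σ` is a rearrangement of the standard one, and a finite family has only one
increasing rearrangement. -/
theorem eq_std_of_monotone {σ : Shuffle μ} (h : Monotone σ.col) : σ = std μ := by
  apply col_injective
  have h1 : σ.col = (std μ).col ∘ (σ.1.trans μ.pos) := by
    funext j
    simp [col, std]
  rw [h1] at h ⊢
  exact Tuple.unique_monotone (τ := 1) h monotone_col_std

theorem col_swap {σ : Shuffle μ} {i : ℕ} {h : i + 1 < n}
    (hc : σ.col ⟨i, by omega⟩ ≠ σ.col ⟨i + 1, h⟩) :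
    (σ.swap i h).col = σ.col ∘ adj i h := by
  funext j
  rw [col, swap_apply hc]
  rfl

end Shuffle

section ShuffleModule

variable {K : Type u} [Field K] {r n : ℕ} {q : Kˣ} {μ : Comp r n}
  {W : Type w} [AddCommGroup W] [Module K W]
  {ζ : Fin r → K} {op : ∀ k, AffHecke q (μ.part k) →ₐ[K] Module.End K W}
  (hr : (r : K) ≠ 0) (hζ : Function.Injective ζ) (hζr : ∀ k, ζ k ^ r = 1)
  (hop : ∀ k l, k ≠ l → ∀ x y, Commute (op k x) (op l y))

/-- At the shuffle `σ` the operator of `t_j` is the scalar `ζ (σ.col j)`. With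
`Shuffle.col_injective`, a weight vector is supported at no more than one shuffle, so weight spaces
of the function module are copies of `W` or zero. -/
theorem col_eq_of_mem_wtSpace {c : Fin n → Fin r} {f : Shuffle μ → W}
    (hf : f ∈ wtSpace (shuffleRep hr hζ hζr hop) ζ c) {σ : Shuffle μ} (hσ : f σ ≠ 0) :
    σ.col = c := by
  funext j
  have h1 := congrFun (hf j) σ
  rw [shuffleRep_t, tS_apply, Pi.smul_apply] at h1
  have h2 : (ζ (σ.1 j).1 - ζ (c j)) • f σ = 0 := by rw [sub_smul, h1, sub_self]
  exact hζ (sub_eq_zero.1 ((smul_eq_zero.1 h2).resolve_right hσ))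

theorem eq_stdIncl_of_mem_wtSpace {f : Shuffle μ → W}
    (hf : f ∈ wtSpace (shuffleRep hr hζ hζr hop) ζ (Shuffle.std μ).col) :
    f = stdIncl K μ W (f (Shuffle.std μ)) := by
  classical
  funext σ
  by_cases hσ : σ = Shuffle.std μ
  · subst hσ
    simp [stdIncl]
  · rw [stdIncl_ne hσ]
    by_contra h0
    exact hσ (Shuffle.col_injective (col_eq_of_mem_wtSpace hr hζ hζr hop hf h0))

theorem stdIncl_mem_wtSpace (w : W) :
    stdIncl K μ W w ∈ wtSpace (shuffleRep hr hζ hζr hop) ζ (Shuffle.std μ).col := by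
  intro j
  rw [shuffleRep_t, tS_stdIncl, map_smul]
  rfl

open Classical in
/-- The functions supported at the standard shuffle generate all functions. -/
theorem eq_top_of_stdIncl_mem {P : Submodule K (Shuffle μ → W)}
    (hP : ∀ a, ∀ f ∈ P, shuffleRep hr hζ hζr hop a f ∈ P) (hs : ∀ w, stdIncl K μ W w ∈ P) :
    P = ⊤ := by
  have key : ∀ (σ : Shuffle μ) (w : W), Pi.single σ w ∈ P := by
    intro σ w
    induction hd : ht σ.col using Nat.strong_induction_on generalizing σ with
    | _ d ih =>
    subst hd
    by_cases hc : Monotone σ.col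
    · rw [Shuffle.eq_std_of_monotone hc]
      exact hs w
    -- The delta function at `σ` is `g_i` applied to the delta function at the shuffle with this
    -- descent removed.
    · obtain ⟨i, h, hlt⟩ := exists_descent hc
      have hc := Shuffle.col_swap hlt.ne'
      have h1 := hP (AffYok.g r q i h) _ (ih _ (by rw [hc]; exact ht_gt hlt) (σ.swap i h) rfl)
      convert h1 using 1
      funext τ
      rw [shuffleRep_g]
      have hss : (σ.swap i h).swap i h = σ := swap_swap hlt.ne'
      by_cases hτ : τ.col ⟨i, by omega⟩ = τ.col ⟨i + 1, h⟩
      · rw [gS_same _ _ hτ, Pi.single_eq_of_ne, Pi.single_eq_of_ne, map_zero]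
        · rintro rfl
          rw [hc, Function.comp_apply, Function.comp_apply, adj_left, adj_right] at hτ
          exact hlt.ne hτ
        · rintro rfl
          exact hlt.ne' hτ
      · rw [gS_diff _ _ hτ]
        by_cases he : τ = σ
        · subst he
          rw [Pi.single_eq_same, Pi.single_eq_same]
        · rw [Pi.single_eq_of_ne he, Pi.single_eq_of_ne]
          intro he'
          apply he
          rw [← hss, ← he', swap_swap hτ]
  refine eq_top_iff.2 fun f _ => ?_
  rw [← Finset.univ_sum_single f]
  exact P.sum_mem fun σ _ => key σ (f σ)

/-- The map from the induced module to the functions on shuffles. -/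
def indToShuffle : Ind (parabolic q μ) (parabolicRep hr hζ hζr hop) →ₗ[K] (Shuffle μ → W) :=
  indLift (shuffleRep hr hζ hζr hop) (stdIncl K μ W) (shuffleRep_stdIncl hr hζ hζr hop)

theorem indToShuffle_smul (a : AffYok r q n)
    (x : Ind (parabolic q μ) (parabolicRep hr hζ hζr hop)) :
    indToShuffle hr hζ hζr hop (a • x) =
      shuffleRep hr hζ hζr hop a (indToShuffle hr hζ hζr hop x) :=
  indLift_smul _ _ _ a x

/-- The generating subspace `1 ⊗ W` of the induced module. -/
def indIncl : W →ₗ[K] Ind (parabolic q μ) (parabolicRep hr hζ hζr hop) :=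
  ((Submodule.mkQ (indRel (parabolic q μ) (parabolicRep hr hζ hζr hop))).restrictScalars K) ∘ₗ
    TensorProduct.mk K (AffYok r q n) W 1

theorem indIncl_apply (w : W) :
    indIncl hr hζ hζr hop w = Submodule.Quotient.mk ((1 : AffYok r q n) ⊗ₜ[K] w) := rfl

theorem smul_indIncl (a : AffYok r q n) (w : W) :
    a • indIncl hr hζ hζr hop w = Submodule.Quotient.mk (a ⊗ₜ[K] w) := by
  rw [indIncl_apply, ← Submodule.Quotient.mk_smul, TensorProduct.smul_tmul', smul_eq_mul, mul_one]

theorem parabolic_smul_indIncl (b : parabolic q μ) (w : W) :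
    (b : AffYok r q n) • indIncl hr hζ hζr hop w =
      indIncl hr hζ hζr hop (parabolicRep hr hζ hζr hop b w) := by
  rw [smul_indIncl, indIncl_apply, Submodule.Quotient.eq]
  refine Submodule.subset_span ⟨1, b, w, ?_⟩
  rw [one_mul]

theorem indToShuffle_mk (a : AffYok r q n) (w : W) :
    indToShuffle hr hζ hζr hop (Submodule.Quotient.mk (a ⊗ₜ[K] w)) =
      shuffleRep hr hζ hζr hop a (stdIncl K μ W w) := rfl

theorem indToShuffle_indIncl (w : W) :
    indToShuffle hr hζ hζr hop (indIncl hr hζ hζr hop w) = stdIncl K μ W w := by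
  rw [indIncl_apply, indToShuffle_mk, map_one, Module.End.one_apply]

theorem eq_top_of_indIncl_mem
    {P : Submodule K (Ind (parabolic q μ) (parabolicRep hr hζ hζr hop))}
    (hP : ∀ a : AffYok r q n, ∀ x ∈ P, a • x ∈ P) (hs : ∀ w, indIncl hr hζ hζr hop w ∈ P) :
    P = ⊤ := by
  refine eq_top_iff.2 fun x _ => ?_
  obtain ⟨x, rfl⟩ := Submodule.Quotient.mk_surjective _ x
  induction x with
  | zero => rw [Submodule.Quotient.mk_zero]; exact P.zero_mem
  | add x y hx hy =>
    rw [Submodule.Quotient.mk_add]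
    exact P.add_mem (hx trivial) (hy trivial)
  | tmul b w => rw [← smul_indIncl]; exact hP _ _ (hs w)

theorem AffYok.t_mem_parabolic (j : Fin n) : AffYok.t r q j ∈ parabolic q μ :=
  Algebra.subset_adjoin (.inl (.inl (.inl ⟨j, rfl⟩)))

theorem AffYok.X_mem_parabolic (j : ℕ) (h : j < n) : AffYok.X r q j h ∈ parabolic q μ :=
  Algebra.subset_adjoin (.inl (.inl (.inr ⟨j, h, rfl⟩)))

theorem AffYok.Xinv_mem_parabolic (j : ℕ) (h : j < n) :
    (AffYok.Xinv j h : AffYok r q n) ∈ parabolic q μ :=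
  Algebra.subset_adjoin (.inl (.inr ⟨j, h, AffYok.Xinv_X j h, AffYok.X_Xinv j h⟩))

theorem AffYok.g_mem_parabolic {i : ℕ} {h : i + 1 < n} (hs : μ.SameBlock i h) :
    AffYok.g r q i h ∈ parabolic q μ :=
  Algebra.subset_adjoin (.inr ⟨i, h, hs, rfl⟩)

/-- The subspace `1 ⊗ W` lies in the standard weight space and generates the induced module, so the
module is the sum of the spans of vectors reached from it. The map is visibly injective on `1 ⊗ W`,
hence on each of these spans by sorting, and components of different weights cannot cancel in the
target. -/
theorem indToShuffle_injective : Function.Injective (indToShuffle hr hζ hζr hop) := by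
  set I := Ind (parabolic q μ) (parabolicRep hr hζ hζr hop)
  let ρ : AffYok r q n →ₐ[K] Module.End K I := Algebra.lsmul K K I
  let N : Submodule K I := LinearMap.range (indIncl hr hζ hζr hop)
  have hpar : ∀ b ∈ parabolic q μ, ∀ m ∈ N, ρ b m ∈ N := by
    rintro b hb _ ⟨w, rfl⟩
    exact ⟨_, (parabolic_smul_indIncl hr hζ hζr hop ⟨b, hb⟩ w).symm⟩
  have hN : N ≤ wtSpace ρ ζ (Shuffle.std μ).col := by
    rintro _ ⟨w, rfl⟩ j
    change AffYok.t r q j • indIncl hr hζ hζr hop w = _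
    rw [parabolic_smul_indIncl hr hζ hζr hop ⟨_, AffYok.t_mem_parabolic j⟩ w, ← map_smul,
      parabolicRep_apply, shuffleRep_t, tS_stdIncl, stdEval_stdIncl]
    rfl
  have hc₀ := Shuffle.monotone_col_std (μ := μ)
  have hg : ∀ (i : ℕ) (h : i + 1 < n), (Shuffle.std μ).col ⟨i, by omega⟩ =
      (Shuffle.std μ).col ⟨i + 1, h⟩ → ∀ m ∈ N, ρ (AffYok.g r q i h) m ∈ N :=
    fun i h hc => hpar _ (AffYok.g_mem_parabolic hc)
  have htop := iSup_reachSpan hr hζ hζr hN hc₀ hg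
    (fun j h => hpar _ (AffYok.X_mem_parabolic j h))
    (fun j h => hpar _ (AffYok.Xinv_mem_parabolic j h))
    (fun P hP hNP => eq_top_of_indIncl_mem hr hζ hζr hop hP fun w => hNP ⟨w, rfl⟩)
  have hΦ : ∀ a m, indToShuffle hr hζ hζr hop (ρ a m) =
      shuffleRep hr hζ hζr hop a (indToShuffle hr hζ hζr hop m) :=
    indToShuffle_smul hr hζ hζr hop
  have hinj : ∀ m ∈ N, indToShuffle hr hζ hζr hop m = 0 → m = 0 := by
    rintro _ ⟨w, rfl⟩ h0
    rw [indToShuffle_indIncl] at h0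
    have := congrArg (stdEval K μ W) h0
    rw [stdEval_stdIncl, map_zero] at this
    rw [this, map_zero]
  rw [injective_iff_map_eq_zero]
  intro x hx
  have hx' : x ∈ ⨆ c, reachSpan ρ N (Shuffle.std μ).col c := by rw [htop]; trivial
  obtain ⟨f, hf, rfl⟩ := (Submodule.mem_iSup_iff_exists_finsupp _ _).1 hx'
  refine Finset.sum_eq_zero fun c hc => ?_
  refine eq_zero_of_mem_reachSpan hr hζ hζr hN hc₀ hg _ _ hΦ hinj c (hf c) ?_
  -- Functions of different weights have disjoint supports, so evaluating the vanishing sum at a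
  -- shuffle of colouring `c` isolates the component of weight `c`.
  have hwt : ∀ c', indToShuffle hr hζ hζr hop (f c') ∈
      wtSpace (shuffleRep hr hζ hζr hop) ζ c' := by
    intro c' j
    rw [← hΦ, reachSpan_le_wtSpace hN c' (hf c') j, map_smul]
  funext τ
  by_contra h0
  obtain rfl := col_eq_of_mem_wtSpace hr hζ hζr hop (hwt c) h0
  apply h0
  have h1 := congrFun hx τ
  rw [Finsupp.sum, map_sum, Finset.sum_apply, Finset.sum_eq_single τ.col] at h1
  · exact h1
  · intro c' _ hne
    by_contra h2
    exact hne (col_eq_of_mem_wtSpace hr hζ hζr hop (hwt c') h2).symm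
  · exact fun h => absurd hc h

theorem indToShuffle_surjective : Function.Surjective (indToShuffle hr hζ hζr hop) := by
  rw [← LinearMap.range_eq_top]
  refine eq_top_of_stdIncl_mem hr hζ hζr hop ?_ ?_
  · rintro a _ ⟨x, rfl⟩
    exact ⟨a • x, indToShuffle_smul hr hζ hζr hop a x⟩
  · exact fun w => ⟨_, indToShuffle_indIncl hr hζ hζr hop w⟩

/-- The induced module is the module of functions on shuffles. -/
def indEquiv : Ind (parabolic q μ) (parabolicRep hr hζ hζr hop) ≃ₗ[K] (Shuffle μ → W) :=
  LinearEquiv.ofBijective (indToShuffle hr hζ hζr hop)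
    ⟨indToShuffle_injective hr hζ hζr hop, indToShuffle_surjective hr hζ hζr hop⟩

theorem indEquiv_smul (a : AffYok r q n)
    (x : Ind (parabolic q μ) (parabolicRep hr hζ hζr hop)) :
    indEquiv hr hζ hζr hop (a • x) =
      shuffleRep hr hζ hζr hop a (indEquiv hr hζ hζr hop x) :=
  indToShuffle_smul hr hζ hζr hop a x

theorem shuffleRep_Xinv (j : Fin n) :
    shuffleRep hr hζ hζr hop (AffYok.Xinv j j.2) = XiS op j := by
  have e1 := congrArg (shuffleRep hr hζ hζr hop) (AffYok.Xinv_X (r := r) (q := q) j j.2)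
  rw [map_mul, map_one, shuffleRep_X] at e1
  exact left_inv_eq_right_inv e1 (XS_XiS _)

/-- The operators of the Hecke algebras of the blocks on the functions supported at the standard
shuffle are given by elements of `Ŷ_{r,n}`, independently of the module. -/
theorem exists_shuffleRep_stdIncl {W' : Type v} [AddCommGroup W'] [Module K W']
    {op' : ∀ k, AffHecke q (μ.part k) →ₐ[K] Module.End K W'}
    (hop' : ∀ k l, k ≠ l → ∀ x y, Commute (op' k x) (op' l y)) (k : Fin r)
    (x : AffHecke q (μ.part k)) :
    ∃ a : AffYok r q n,
      (∀ w, shuffleRep hr hζ hζr hop a (stdIncl K μ W w) = stdIncl K μ W (op k x w)) ∧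
      (∀ w, shuffleRep hr hζ hζr hop' a (stdIncl K μ W' w) = stdIncl K μ W' (op' k x w)) := by
  induction x using AffHecke.induction with
  | hT i h =>
    refine ⟨AffYok.g r q _ (μ.pos_succ_lt k i h), fun w => ?_, fun w => ?_⟩ <;>
    · rw [shuffleRep_g, gS_stdIncl _ _ (μ.sameBlock_pos k i h)]
      simp [Top_succ h]
  | hY j =>
    refine ⟨AffYok.X r q _ (μ.pos ⟨k, j⟩).2, fun w => ?_, fun w => ?_⟩ <;>
    · rw [shuffleRep_X, XS_stdIncl, Fin.eta, Equiv.symm_apply_apply]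
      rfl
  | hYi j =>
    refine ⟨AffYok.Xinv _ (μ.pos ⟨k, j⟩).2, fun w => ?_, fun w => ?_⟩ <;>
    · rw [shuffleRep_Xinv, XiS_stdIncl, Equiv.symm_apply_apply]
      rfl
  | hc c =>
    refine ⟨algebraMap K _ c, fun w => ?_, fun w => ?_⟩ <;>
    · rw [AlgHom.commutes, AlgHom.commutes, Module.algebraMap_end_apply,
        Module.algebraMap_end_apply, map_smul]
  | hadd x y hx hy =>
    obtain ⟨a, ha, ha'⟩ := hx
    obtain ⟨b, hb, hb'⟩ := hy
    refine ⟨a + b, fun w => ?_, fun w => ?_⟩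
    · rw [map_add, map_add, LinearMap.add_apply, LinearMap.add_apply, map_add, ha, hb]
    · rw [map_add, map_add, LinearMap.add_apply, LinearMap.add_apply, map_add, ha', hb']
  | hmul x y hx hy =>
    obtain ⟨a, ha, ha'⟩ := hx
    obtain ⟨b, hb, hb'⟩ := hy
    refine ⟨a * b, fun w => ?_, fun w => ?_⟩
    · rw [map_mul, map_mul, Module.End.mul_apply, Module.End.mul_apply, hb, ha]
    · rw [map_mul, map_mul, Module.End.mul_apply, Module.End.mul_apply, hb', ha']

/-- If `W` is irreducible under the Hecke algebras of the blocks, so are the functions on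
shuffles under `Ŷ_{r,n}`. -/
theorem shuffleRep_irreducible [IsAlgClosed K] (hs : ∀ x : K, x ^ r = 1 → ∃ k, ζ k = x)
    (hW : ∀ U : Submodule K W, (∀ k x, ∀ w ∈ U, op k x w ∈ U) → U = ⊥ ∨ U = ⊤)
    {P : Submodule K (Shuffle μ → W)}
    (hP : ∀ a, ∀ f ∈ P, shuffleRep hr hζ hζr hop a f ∈ P) : P = ⊥ ∨ P = ⊤ := by
  by_cases hP0 : P = ⊥
  · exact .inl hP0
  right
  obtain ⟨c, hmon, f, hf, h0, hc⟩ := exists_mem_wtSpace_monotone hr hζ hζr hs hP0 hP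
  obtain ⟨σ, hσ⟩ := Function.ne_iff.1 h0
  obtain rfl := col_eq_of_mem_wtSpace hr hζ hζr hop hc hσ
  -- The increasing weight vector found in `P` is supported at the standard shuffle. Its value there
  -- is a nonzero vector of the stable subspace of `W` pulled back from `P`.
  obtain rfl := Shuffle.eq_std_of_monotone hmon
  have hf' := eq_stdIncl_of_mem_wtSpace hr hζ hζr hop hc
  rcases hW (P.comap (stdIncl K μ W)) (fun k x w hw => by
    obtain ⟨a, ha, -⟩ := exists_shuffleRep_stdIncl hr hζ hζr hop hop k x
    rw [Submodule.mem_comap, ← ha]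
    exact hP a _ hw) with hU | hU
  · exfalso
    have h1 : f (Shuffle.std μ) ∈ P.comap (stdIncl K μ W) := by
      rw [Submodule.mem_comap, ← hf']; exact hf
    rw [hU, Submodule.mem_bot] at h1
    rw [h1, map_zero] at hf'
    exact h0 hf'
  · refine eq_top_of_stdIncl_mem hr hζ hζr hop hP fun w => ?_
    have h1 : w ∈ P.comap (stdIncl K μ W) := by rw [hU]; trivial
    exact h1

end ShuffleModule

/-! ## Outer tensor products of simple modules -/

section OuterTensor

variable {K : Type u} [Field K]

/-- Burnside's theorem for a finite-dimensional simple module over an algebraically closed field. -/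
theorem exists_smul_eq_of_isSimpleModule [IsAlgClosed K] {A : Type v} [Ring A] [Algebra K A]
    {L : Type w} [AddCommGroup L] [Module K L] [Module A L] [IsScalarTower K A L]
    [IsSimpleModule A L] [FiniteDimensional K L] (u : Module.End K L) :
    ∃ a : A, Algebra.lsmul K K L a = u := by
  have hsurj := (IsSimpleModule.algebraMap_end_bijective_of_isAlgClosed (A := A) (V := L) K).2
  -- By Schur's lemma the `A`-endomorphisms are scalars, so every `K`-linear map commutes with them
  -- and the density theorem applies on a finite spanning set.
  let f : Module.End (Module.End A L) L :=
    { toFun := u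
      map_add' := map_add u
      map_smul' := fun φ z => by
        obtain ⟨c, rfl⟩ := hsurj φ
        simp }
  obtain ⟨s, hs⟩ := Module.Finite.fg_top (R := K) (M := L)
  obtain ⟨a, ha⟩ := jacobson_density f s
  refine ⟨a, LinearMap.ext_on hs fun m hm => ?_⟩
  exact (ha m hm).symm

variable {r : ℕ} {L : Fin r → Type w} [∀ k, AddCommGroup (L k)] [∀ k, Module K (L k)]

theorem map_mem_of_factorEnd_mem {P : Submodule K (⨂[K] k, L k)}
    (hP : ∀ k u, ∀ x ∈ P, factorEnd L k u x ∈ P) (u : ∀ k, Module.End K (L k))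
    {x : ⨂[K] k, L k} (hx : x ∈ P) : PiTensorProduct.map u x ∈ P := by
  have : ∀ s : Finset (Fin r),
      PiTensorProduct.map (fun k => if k ∈ s then u k else LinearMap.id) x ∈ P := by
    intro s
    induction s using Finset.induction_on with
    | empty => simpa using hx
    | insert k s hk ih =>
      convert hP k (u k) _ ih using 1
      change _ = PiTensorProduct.map _ _
      rw [← LinearMap.comp_apply, ← PiTensorProduct.map_comp]
      congr 2
      funext j
      by_cases h : j = k
      · subst h; simp [hk]
      · simp [h]
  simpa using this Finset.univ

/-- A tensor product of rank-one maps reads off one coefficient of `x` and multiplies a prescribed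
pure tensor by it. So a stable subspace containing some `x ≠ 0` contains all pure tensors, without
any finiteness of the factors. -/
theorem map_smulRight {κ : Fin r → Type*} (b : ∀ k, Module.Basis (κ k) K (L k)) (p : ∀ k, κ k)
    (z : ∀ k, L k) (x : ⨂[K] k, L k) :
    PiTensorProduct.map (fun k => ((b k).coord (p k)).smulRight (z k)) x =
      (Basis.piTensorProduct b).repr x p • PiTensorProduct.tprod K z := by
  have : PiTensorProduct.map (fun k => ((b k).coord (p k)).smulRight (z k)) =
      ((Basis.piTensorProduct b).coord p).smulRight (PiTensorProduct.tprod K z) := by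
    refine PiTensorProduct.ext (MultilinearMap.ext fun y => ?_)
    simp [MultilinearMap.map_smul_univ]
  rw [this]
  rfl

theorem eq_bot_or_eq_top_of_factorEnd_mem {P : Submodule K (⨂[K] k, L k)}
    (hP : ∀ k u, ∀ x ∈ P, factorEnd L k u x ∈ P) : P = ⊥ ∨ P = ⊤ := by
  by_cases h : P = ⊥
  · exact .inl h
  obtain ⟨x, hx, h0⟩ := P.ne_bot_iff.1 h
  let b := fun k => Module.Basis.ofVectorSpace K (L k)
  obtain ⟨p, hp⟩ : ∃ p, (Basis.piTensorProduct b).repr x p ≠ 0 := by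
    by_contra! hcon
    exact h0 ((Basis.piTensorProduct b).repr.map_eq_zero_iff.1 (Finsupp.ext hcon))
  right
  rw [eq_top_iff, ← PiTensorProduct.span_tprod_eq_top, Submodule.span_le]
  rintro _ ⟨z, rfl⟩
  have h1 := map_mem_of_factorEnd_mem hP (fun k => ((b k).coord (p k)).smulRight (z k)) hx
  rw [map_smulRight] at h1
  exact (P.smul_mem_iff hp).1 h1

variable {A : Fin r → Type v} [∀ k, Ring (A k)] [∀ k, Algebra K (A k)] [∀ k, Module (A k) (L k)]
  [∀ k, IsScalarTower K (A k) (L k)]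

/-- The outer tensor product of finite-dimensional simple modules is simple. -/
theorem outerTensor_irreducible [IsAlgClosed K] [∀ k, IsSimpleModule (A k) (L k)]
    [∀ k, FiniteDimensional K (L k)] {P : Submodule K (⨂[K] k, L k)}
    (hP : ∀ k (a : A k), ∀ x ∈ P, factorEnd L k (Algebra.lsmul K K (L k) a) x ∈ P) :
    P = ⊥ ∨ P = ⊤ := by
  refine eq_bot_or_eq_top_of_factorEnd_mem fun k u => ?_
  obtain ⟨a, rfl⟩ := exists_smul_eq_of_isSimpleModule (A := A k) u
  exact hP k a

theorem outerTensor_nontrivial [∀ k, Nontrivial (L k)] : Nontrivial (⨂[K] k, L k) := by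
  let b := fun k => Module.Basis.ofVectorSpace K (L k)
  have := fun k => (b k).index_nonempty
  exact ⟨_, _, (Basis.piTensorProduct b).ne_zero (fun k => Classical.arbitrary _)⟩

/-- The factors of an outer tensor product of simple modules are determined by it. -/
theorem nonempty_linearEquiv_of_outerTensor [∀ k, IsSimpleModule (A k) (L k)]
    {L' : Fin r → Type w} [∀ k, AddCommGroup (L' k)] [∀ k, Module K (L' k)]
    [∀ k, Module (A k) (L' k)] [∀ k, IsScalarTower K (A k) (L' k)]
    [∀ k, IsSimpleModule (A k) (L' k)] (e : (⨂[K] k, L k) ≃ₗ[K] (⨂[K] k, L' k))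
    (he : ∀ k (a : A k) x, e (factorEnd L k (Algebra.lsmul K K (L k) a) x) =
      factorEnd L' k (Algebra.lsmul K K (L' k) a) (e x)) (k : Fin r) :
    Nonempty (L k ≃ₗ[A k] L' k) := by
  classical
  have := fun k => IsSimpleModule.nontrivial (A k) (L k)
  let b := fun k => Module.Basis.ofVectorSpace K (L k)
  let b' := fun k => Module.Basis.ofVectorSpace K (L' k)
  have := fun k => (b k).index_nonempty
  let z : ∀ k, L k := fun k => b k (Classical.arbitrary _)
  have hz : PiTensorProduct.tprod K z ≠ 0 := by
    rw [← Basis.piTensorProduct_apply]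
    exact (Basis.piTensorProduct b).ne_zero _
  obtain ⟨p, hp⟩ : ∃ p, (Basis.piTensorProduct b').repr (e (PiTensorProduct.tprod K z)) p ≠ 0 := by
    by_contra! hcon
    exact hz (e.map_eq_zero_iff.1
      ((Basis.piTensorProduct b').repr.map_eq_zero_iff.1 (Finsupp.ext hcon)))
  have hinj : Function.Injective (fun i => Function.update p k i) := Function.update_injective p k
  -- `F` slices a tensor: it fixes the coordinates `p j` in all factors `j ≠ k` and keeps the `k`-th
  -- factor free. It is linear over `A k`, because `A k` acts on the `k`-th factor only.
  let F : (⨂[K] k, L' k) →ₗ[K] L' k := (b' k).repr.symm.toLinearMap ∘ₗ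
    Finsupp.lcomapDomain _ hinj ∘ₗ (Basis.piTensorProduct b').repr.toLinearMap
  have hF : ∀ y, F (PiTensorProduct.tprod K y) =
      (∏ j ∈ Finset.univ.erase k, (b' j).repr (y j) (p j)) • y k := by
    intro y
    apply (b' k).repr.injective
    ext i
    simp only [F, LinearMap.comp_apply, LinearEquiv.coe_coe, LinearEquiv.apply_symm_apply,
      map_smul, Finsupp.smul_apply, smul_eq_mul]
    change (Basis.piTensorProduct b').repr _ (Function.update p k i) = _
    rw [Basis.piTensorProduct_repr_tprod_apply, ← Finset.mul_prod_erase _ _ (Finset.mem_univ k),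
      Function.update_self, mul_comm]
    congr 1
    refine Finset.prod_congr rfl fun j hj => ?_
    rw [Function.update_of_ne (Finset.ne_of_mem_erase hj)]
  have hF' : ∀ (a : A k) x, F (factorEnd L' k (Algebra.lsmul K K (L' k) a) x) = a • F x := by
    intro a x
    induction x using PiTensorProduct.induction_on with
    | smul_tprod c y =>
      rw [map_smul, map_smul, factorEnd_tprod, map_smul, hF, hF, Function.update_self,
        smul_comm a c, smul_comm a]
      congr 2
      refine Finset.prod_congr rfl fun j hj => ?_
      rw [Function.update_of_ne (Finset.ne_of_mem_erase hj)]
    | add x y hx hy => rw [map_add, map_add, hx, hy, map_add, smul_add]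
  -- Insert `v` in the `k`-th slot of `z`, transport by `e`, and slice. The choice of `p` makes this
  -- nonzero at `z k`, so Schur's lemma applies.
  let φ : L k →ₗ[A k] L' k :=
    { toFun := fun v => F (e (PiTensorProduct.tprod K (Function.update z k v)))
      map_add' := fun v v' => by rw [MultilinearMap.map_update_add, map_add, map_add]
      map_smul' := fun a v => by
        rw [RingHom.id_apply, ← hF', ← he, factorEnd_tprod, Function.update_self,
          Function.update_idem]
        rfl }
  refine ⟨LinearEquiv.ofBijective φ (LinearMap.bijective_of_ne_zero fun h => hp ?_)⟩
  have h1 : F (e (PiTensorProduct.tprod K (Function.update z k (z k)))) = 0 :=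
    LinearMap.congr_fun h (z k)
  rw [Function.update_eq_self] at h1
  have h2 := congrArg (fun y => (b' k).repr y (p k)) h1
  simp only [F, LinearMap.comp_apply, LinearEquiv.coe_coe, LinearEquiv.apply_symm_apply] at h2
  change (Basis.piTensorProduct b').repr _ (Function.update p k (p k)) = _ at h2
  rw [Function.update_eq_self] at h2
  rw [h2, map_zero, Finsupp.zero_apply]

theorem mul_prod_ofFn {R : Type*} [Monoid R] {n : ℕ} (m : Fin n → R) (k : Fin n) (a : R)
    (h : ∀ j, j ≠ k → Commute a (m j)) :
    a * (List.ofFn m).prod = (List.ofFn (Function.update m k (a * m k))).prod := by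
  induction n with
  | zero => exact k.elim0
  | succ n ih =>
    rw [List.ofFn_succ, List.ofFn_succ, List.prod_cons, List.prod_cons]
    cases k using Fin.cases with
    | zero => simp [mul_assoc]
    | succ k =>
      have h0 := h 0 (Fin.succ_ne_zero k).symm
      rw [Function.update_of_ne (Fin.succ_ne_zero k).symm, ← mul_assoc, h0.eq, mul_assoc,
        ih (fun j => m j.succ) k fun j hj => h j.succ (by simpa using hj)]
      congr 3
      funext j
      by_cases hj : j = k
      · subst hj; simp
      · rw [Function.update_of_ne hj, Function.update_of_ne (by simpa using hj)]

/-- An irreducible module over commuting algebras is the outer tensor product of simple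
submodules for the single algebras. -/
theorem exists_outerTensor_equiv [IsAlgClosed K] [∀ k, IsSimpleModule (A k) (L k)]
    [∀ k, FiniteDimensional K (L k)] {W : Type*} [AddCommGroup W] [Module K W] [Nontrivial W]
    (op : ∀ k, A k →ₐ[K] Module.End K W)
    (hop : ∀ k l, k ≠ l → ∀ x y, Commute (op k x) (op l y))
    (hW : ∀ U : Submodule K W, (∀ k x, ∀ w ∈ U, op k x w ∈ U) → U = ⊥ ∨ U = ⊤)
    (ι : ∀ k, L k →ₗ[K] W) (hι : ∀ k (a : A k) z, ι k (a • z) = op k a (ι k z))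
    (hι0 : ∀ k, ι k ≠ 0) :
    ∃ e : (⨂[K] k, L k) ≃ₗ[K] W, ∀ k (a : A k) x,
      e (factorEnd L k (Algebra.lsmul K K (L k) a) x) = op k a (e x) := by
  have hsurj : ∀ k, Function.Surjective (Algebra.lsmul K K (L k) : A k →ₐ[K] _) :=
    fun k u => exists_smul_eq_of_isSimpleModule u
  -- the annihilator of `L k` annihilates the whole space
  have hann : ∀ k (a : A k), Algebra.lsmul K K (L k) a = 0 → op k a = 0 := by
    intro k a ha
    -- The subspace killed by this annihilator is stable under all the algebras and contains the
    -- nonzero image of `L k`, so it is everything.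
    let U : Submodule K W := ⨅ a : {a : A k // Algebra.lsmul K K (L k) a = 0},
      LinearMap.ker (op k a)
    have hU := hW U (by
      intro l x w hw
      simp only [U, Submodule.mem_iInf, LinearMap.mem_ker] at hw ⊢
      rintro ⟨b, hb⟩
      by_cases hkl : k = l
      · subst hkl
        have := hw ⟨b * x, by rw [map_mul, hb, zero_mul]⟩
        rwa [map_mul, Module.End.mul_apply] at this
      · rw [← Module.End.mul_apply, (hop k l hkl b x).eq, Module.End.mul_apply, hw ⟨b, hb⟩, map_zero])
    rcases hU with hU | hU
    · exfalso
      apply hι0 k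
      ext z
      have : ι k z ∈ U := by
        simp only [U, Submodule.mem_iInf, LinearMap.mem_ker]
        rintro ⟨b, hb⟩
        rw [← hι, show b • z = Algebra.lsmul K K (L k) b z from rfl, hb, LinearMap.zero_apply,
          map_zero]
      rw [hU] at this
      exact this
    · ext w
      have : w ∈ U := by rw [hU]; trivial
      exact (Submodule.mem_iInf _).1 this ⟨a, ha⟩
  -- Thus `op k` factors through the image of `A k` in `End (L k)`, which is all of `End (L k)` by
  -- Burnside; a linear section provides the factorisation.
  have hψ : ∀ k, ∃ ψ : Module.End K (L k) →ₗ[K] Module.End K W,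
      ∀ a : A k, ψ (Algebra.lsmul K K (L k) a) = op k a := by
    intro k
    obtain ⟨s, hs⟩ := LinearMap.exists_rightInverse_of_surjective
      (Algebra.lsmul K K (L k) : A k →ₐ[K] _).toLinearMap (LinearMap.range_eq_top.2 (hsurj k))
    refine ⟨(op k).toLinearMap ∘ₗ s, fun a => ?_⟩
    have h1 := hann k (s (Algebra.lsmul K K (L k) a) - a) (by
      rw [map_sub, sub_eq_zero]
      exact LinearMap.congr_fun hs _)
    rw [map_sub, sub_eq_zero] at h1
    exact h1
  choose ψ hψ using hψ
  -- The action of `⨂ End (L k)` on `W` as a multilinear map. The order of the product is immaterial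
  -- since the factors commute.
  let B : MultilinearMap K (fun k => Module.End K (L k)) (Module.End K W) :=
    (MultilinearMap.mkPiAlgebraFin K r (Module.End K W)).compLinearMap ψ
  have hB : ∀ u, B u = (List.ofFn fun k => ψ k (u k)).prod := fun u => rfl
  have hB1 : B (fun _ => 1) ≠ 0 := by
    have : (fun k => ψ k 1) = fun _ => 1 := by
      funext k
      have := hψ k 1
      rwa [map_one (Algebra.lsmul K K (L k)), map_one (op k)] at this
    rw [hB, this]
    simp
  have hBa : ∀ k (a : A k) u, B (Function.update u k (Algebra.lsmul K K (L k) a * u k)) =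
      op k a * B u := by
    intro k a u
    rw [hB, hB, mul_prod_ofFn _ k]
    · congr 2
      funext j
      by_cases hj : j = k
      · subst hj
        obtain ⟨b, hb⟩ := hsurj j (u j)
        rw [Function.update_self, Function.update_self, ← hb, ← map_mul, hψ, hψ, map_mul]
      · rw [Function.update_of_ne hj, Function.update_of_ne hj]
    · intro j hj
      obtain ⟨b, hb⟩ := hsurj j (u j)
      rw [← hb, hψ]
      exact hop k j hj.symm _ _
  let b := fun k => Module.finBasis K (L k)
  -- As `B` is the identity on a tuple of identities, it cannot vanish on all tuples of matrix
  -- units.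
  obtain ⟨p, hp⟩ : ∃ p : ∀ k, Fin (Module.finrank K (L k)) × Fin (Module.finrank K (L k)),
      B (fun k => (b k).linearMap (b k) (p k)) ≠ 0 := by
    by_contra! hcon
    apply hB1
    have : B = 0 := Module.Basis.ext_multilinear (fun k => (b k).linearMap (b k)) hcon
    rw [this]
    rfl
  obtain ⟨w, hw⟩ : ∃ w, B (fun k => (b k).linearMap (b k) (p k)) w ≠ 0 := by
    by_contra! hcon
    exact hp (LinearMap.ext hcon)
  have hrank : ∀ k, (b k).linearMap (b k) (p k) =
      LinearMap.smulRightₗ ((b k).coord (p k).2) (b k (p k).1) := by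
    intro k
    refine (b k).ext fun i => ?_
    rw [Module.Basis.linearMap_apply_apply]
    simp [Finsupp.single_apply, eq_comm]
  -- The rank-one maps with a fixed functional form a copy of `L k` as a left ideal of `End (L k)`;
  -- acting on `w` by a tuple of them gives the intertwiner. The matrix units chosen above show that
  -- it is nonzero.
  let Θ : (⨂[K] k, L k) →ₗ[K] W := PiTensorProduct.lift
    ((LinearMap.applyₗ w).compMultilinearMap (B.compLinearMap fun k =>
      LinearMap.smulRightₗ ((b k).coord (p k).2)))
  have hΘt : ∀ z, Θ (PiTensorProduct.tprod K z) =
      B (fun k => LinearMap.smulRightₗ ((b k).coord (p k).2) (z k)) w := by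
    intro z
    rw [PiTensorProduct.lift.tprod]
    rfl
  have hΘ : ∀ k (a : A k) x, Θ (factorEnd L k (Algebra.lsmul K K (L k) a) x) = op k a (Θ x) := by
    intro k a x
    induction x using PiTensorProduct.induction_on with
    | smul_tprod c z =>
      simp only [map_smul, factorEnd_tprod]
      rw [hΘt, hΘt, ← Module.End.mul_apply, ← hBa]
      congr 3
      funext j
      by_cases hj : j = k
      · subst hj
        rw [Function.update_self, Function.update_self]
        ext y
        simp
      · rw [Function.update_of_ne hj, Function.update_of_ne hj]
    | add x y hx hy => simp only [map_add, hx, hy]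
  have hΘ0 : Θ ≠ 0 := by
    intro h0
    apply hw
    have := LinearMap.congr_fun h0 (PiTensorProduct.tprod K fun k => b k (p k).1)
    rw [hΘt] at this
    simp only [hrank]
    exact this
  refine ⟨LinearEquiv.ofBijective Θ ⟨?_, ?_⟩, hΘ⟩
  · rw [← LinearMap.ker_eq_bot]
    refine (outerTensor_irreducible (A := A) fun k a x hx => ?_).resolve_right fun h =>
      hΘ0 (LinearMap.ker_eq_top.1 h)
    rw [LinearMap.mem_ker] at hx ⊢
    rw [hΘ, hx, map_zero]
  · rw [← LinearMap.range_eq_top]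
    refine (hW _ ?_).resolve_left fun h => hΘ0 (LinearMap.range_eq_bot.1 h)
    rintro k a _ ⟨x, rfl⟩
    exact ⟨_, hΘ k a x⟩

end OuterTensor

/-! ## Cyclotomic Hecke algebras are finite-dimensional -/

section Finiteness

variable {K : Type u} [Field K] {R : Type v} [Ring R] [Algebra K R]

theorem adjoin_le_of_mul_mem {s : Set R} {Q : Submodule K R} (h1 : 1 ∈ Q)
    (h : ∀ x ∈ s, ∀ y ∈ Q, x * y ∈ Q) : (Algebra.adjoin K s).toSubmodule ≤ Q := by
  have key : ∀ x ∈ Algebra.adjoin K s, ∀ y ∈ Q, x * y ∈ Q := by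
    intro x hx
    induction hx using Algebra.adjoin_induction with
    | mem x hx => exact h x hx
    | algebraMap c => intro y hy; rw [← Algebra.smul_def]; exact Q.smul_mem c hy
    | add a b _ _ ha hb => intro y hy; rw [add_mul]; exact Q.add_mem (ha y hy) (hb y hy)
    | mul a b _ _ ha hb => intro y hy; rw [mul_assoc]; exact ha _ (hb y hy)
  intro x hx
  have := key x hx 1 h1
  rwa [mul_one] at this

/-- An algebra generated by finitely many elements satisfying quadratic relations and the braid
relations of type `A` is finite-dimensional. -/
theorem finite_adjoin_of_braid {N : ℕ} {f : ℕ → R} {c : K}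
    (hq : ∀ i < N, f i * f i = 1 + c • f i)
    (hb : ∀ i, i + 1 < N → f i * f (i + 1) * f i = f (i + 1) * f i * f (i + 1))
    (hf : ∀ i j, i + 2 ≤ j → j < N → Commute (f j) (f i)) :
    Module.Finite K (Algebra.adjoin K (f '' Set.Iio N)) := by
  let S : ℕ → Subalgebra K R := fun k => Algebra.adjoin K (f '' Set.Iio k)
  -- With `S k` generated by `f 0, …, f (k-1)`, the aim is `S (k+1) = S k + S k · f k · S k`, the
  -- algebra version of there being two double cosets of `S_{k+1}` in `S_{k+2}`; finiteness then
  -- passes from `S k` to `S (k+1)`.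
  let Q : ℕ → Submodule K R := fun k => (S k).toSubmodule ⊔
    (S k).toSubmodule * Submodule.span K {f k} * (S k).toSubmodule
  have hmemG : ∀ k, ∀ a ∈ S k, ∀ b ∈ S k, a * f k * b ∈ Q k := fun k a ha b hb =>
    Submodule.mem_sup_right (Submodule.mul_mem_mul (Submodule.mem_mul_span_singleton.2 ⟨a, ha, rfl⟩) hb)
  have hmemS : ∀ k, ∀ a ∈ S k, a ∈ Q k := fun k a ha => Submodule.mem_sup_left ha
  have hind : ∀ k, ∀ P : Submodule K R, (∀ a ∈ S k, a ∈ P) →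
      (∀ a ∈ S k, ∀ b ∈ S k, a * f k * b ∈ P) → Q k ≤ P := by
    intro k P h1 h2
    refine sup_le h1 (Submodule.mul_le.2 fun x hx b hb => ?_)
    obtain ⟨a, ha, rfl⟩ := Submodule.mem_mul_span_singleton.1 hx
    exact h2 a ha b hb
  have hmono : ∀ k l, k ≤ l → S k ≤ S l := fun k l hkl =>
    Algebra.adjoin_mono (Set.image_mono (Set.Iio_subset_Iio hkl))
  have hfS : ∀ k l, k < l → f k ∈ S l := fun k l hkl =>
    Algebra.subset_adjoin ⟨k, hkl, rfl⟩
  have hQ : ∀ k < N, (S (k + 1)).toSubmodule ≤ Q k := by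
    intro k
    induction k with
    | zero =>
      intro hN
      have hbot : ∀ a ∈ S 0, ∃ d : K, algebraMap K R d = a := by
        intro a ha
        have : S 0 = ⊥ := by simp [S]
        rw [this] at ha
        exact Algebra.mem_bot.1 ha
      refine adjoin_le_of_mul_mem (hmemS 0 1 (one_mem _)) ?_
      rintro _ ⟨i, hi, rfl⟩
      obtain rfl : i = 0 := by have := Set.mem_Iio.1 hi; omega
      refine fun y hy => hind 0 ((Q 0).comap (LinearMap.mulLeft K (f 0))) ?_ ?_ hy
      · intro a ha
        have := hmemG 0 1 (one_mem _) a ha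
        rwa [one_mul] at this
      · intro a ha b hb
        obtain ⟨d, rfl⟩ := hbot a ha
        have e : f 0 * (algebraMap K R d * f 0 * b) =
            d • b + (c * d) • (1 * f 0 * b) := by
          rw [← Algebra.smul_def, smul_mul_assoc, mul_smul_comm, ← mul_assoc, hq 0 hN, add_mul,
            one_mul, one_mul, smul_add, smul_mul_assoc, smul_smul, mul_comm c d]
        change f 0 * _ ∈ Q 0
        rw [e]
        exact (Q 0).add_mem ((Q 0).smul_mem _ (hmemS 0 b hb))
          ((Q 0).smul_mem _ (hmemG 0 1 (one_mem _) b hb))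
    | succ k ih =>
      intro hN
      have hcomm : ∀ a ∈ S k, Commute (f (k + 1)) a := by
        intro a ha
        refine Subalgebra.mem_centralizer_iff K |>.1 ((Algebra.adjoin_le ?_ : S k ≤
          Subalgebra.centralizer K {f (k + 1)}) ha) _ rfl
        rintro _ ⟨i, hi, rfl⟩
        rw [SetLike.mem_coe, Subalgebra.mem_centralizer_iff]
        rintro _ rfl
        exact hf i (k + 1) (by have := Set.mem_Iio.1 hi; omega) hN
      -- Two occurrences of `f (k+1)` are reduced to at most one. Write the middle factor `a` in `S
      -- k + S k · f k · S k`; since `S k` commutes with `f (k+1)`, the first part is handled by the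
      -- quadratic relation and the second by the braid relation.
      have key : ∀ a ∈ S (k + 1), ∀ b ∈ S (k + 1), f (k + 1) * (a * f (k + 1) * b) ∈ Q (k + 1) := by
        intro a ha b hb'
        have hsub : Q k ≤ (Q (k + 1)).comap (LinearMap.mulLeft K (f (k + 1)) ∘ₗ
          LinearMap.mulRight K (f (k + 1) * b)) := hind k _ ?_ ?_
        · have := hsub (ih (by omega) ha)
          rw [mul_assoc a]
          exact this
        · intro x hx
          have e : f (k + 1) * (x * (f (k + 1) * b)) =
              x * b + c • (x * f (k + 1) * b) := by
            rw [← mul_assoc, (hcomm x hx).eq, mul_assoc, ← mul_assoc (f (k + 1)), hq _ hN, add_mul,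
              one_mul, mul_add, smul_mul_assoc, mul_smul_comm, mul_assoc]
          change f (k + 1) * (x * (f (k + 1) * b)) ∈ Q (k + 1)
          rw [e]
          have hx' := hmono k (k + 1) (by omega) hx
          exact (Q _).add_mem (hmemS _ _ (mul_mem hx' hb'))
            ((Q _).smul_mem _ (hmemG _ x hx' b hb'))
        · intro x hx y hy
          have e : f (k + 1) * (x * f k * y * (f (k + 1) * b)) =
              (x * f k) * f (k + 1) * (f k * y * b) := by
            calc f (k + 1) * (x * f k * y * (f (k + 1) * b))
                = (f (k + 1) * x) * f k * (y * f (k + 1)) * b := by noncomm_ring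
              _ = x * (f (k + 1) * f k * f (k + 1)) * y * b := by
                rw [(hcomm x hx).eq, ← (hcomm y hy).eq]; noncomm_ring
              _ = (x * f k) * f (k + 1) * (f k * y * b) := by
                rw [← hb k hN]; noncomm_ring
          change f (k + 1) * (x * f k * y * (f (k + 1) * b)) ∈ Q (k + 1)
          rw [e]
          have hk := hfS k (k + 1) (by omega)
          have hkk := hmono k (k + 1) (by omega)
          exact hmemG _ _ (mul_mem (hkk hx) hk) _ (mul_mem (mul_mem hk (hkk hy)) hb')
      refine adjoin_le_of_mul_mem (hmemS _ 1 (one_mem _)) ?_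
      rintro _ ⟨i, hi, rfl⟩ y hy
      rcases (Nat.lt_succ_iff.1 hi).lt_or_eq with hi | rfl
      · have hi' := hfS i (k + 1) hi
        refine hind (k + 1) ((Q (k + 1)).comap (LinearMap.mulLeft K (f i))) ?_ ?_ hy
        · exact fun a ha => hmemS _ _ (mul_mem hi' ha)
        · intro a ha b hb
          have := hmemG (k + 1) _ (mul_mem hi' ha) b hb
          change f i * (a * f (k + 1) * b) ∈ Q (k + 1)
          simpa only [mul_assoc] using this
      · refine hind (k + 1) ((Q (k + 1)).comap (LinearMap.mulLeft K (f (k + 1)))) ?_ key hy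
        intro a ha
        have := hmemG (k + 1) 1 (one_mem _) a ha
        rwa [one_mul] at this
  have hfin : ∀ k ≤ N, (S k).toSubmodule.FG := by
    intro k
    induction k with
    | zero =>
      intro _
      have : S 0 = ⊥ := by simp [S]
      rw [this, Algebra.toSubmodule_bot, Submodule.one_eq_span]
      exact Submodule.fg_span_singleton 1
    | succ k ih =>
      intro hk
      have h1 := ih (by omega)
      have h2 : (Q k).FG := h1.sup ((h1.mul (Submodule.fg_span_singleton _)).mul h1)
      have := Module.Finite.iff_fg.2 h2
      exact Module.Finite.iff_fg.1 (Submodule.finiteDimensional_of_le (hQ k (by omega)))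
  exact Module.Finite.iff_fg.2 (hfin N le_rfl)

/-- The hypothesis is a monic equation for `z` over `K[y]`, which is integral over `K`; integrality
is transitive. -/
theorem isIntegral_of_aeval_mul {B : Type*} [i : Ring B] [Algebra K B]
    (hcomm : ∀ x y : B, x * y = y * x) {y z : B} {p : Polynomial K} (hp : p.Monic) (hy : IsIntegral K y) (a b : K)
    (h : Polynomial.aeval z p * ((z - a • y) * (z - b • y)) = 0) : IsIntegral K z := by
  -- The given ring structure is promoted to a commutative one without changing it, so that
  -- commutative algebra applies.
  obtain ⟨c, rfl⟩ : ∃ c : CommRing B, c.toRing = i := ⟨{ i with mul_comm := hcomm }, rfl⟩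
  let A := Algebra.adjoin K {y}
  have hA : Algebra.IsIntegral K A := Algebra.IsIntegral.adjoin (by simpa using hy)
  let y' : A := ⟨y, Algebra.subset_adjoin rfl⟩
  refine isIntegral_trans (A := A) z ⟨p.map (algebraMap K A) *
    ((Polynomial.X - Polynomial.C (a • y')) * (Polynomial.X - Polynomial.C (b • y'))), ?_, ?_⟩
  · exact (hp.map _).mul ((Polynomial.monic_X_sub_C _).mul (Polynomial.monic_X_sub_C _))
  · rw [← Polynomial.aeval_def, map_mul, map_mul, map_sub, map_sub, Polynomial.aeval_X,
      Polynomial.aeval_C, Polynomial.aeval_C, Polynomial.aeval_map_algebraMap]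
    exact h

/-- The intertwiner `φ = t y - y t` satisfies `φ y = z φ` and `φ ^ 2 = -(z - q² y)(z - q⁻² y)`. If
`p(y) = 0`, then `p(z) φ ^ 2 = φ p(y) φ = 0`, a monic equation for `z` over `K[y]`. With `t = T_i`,
`y = Y_i`, `z = Y_{i+1}`, integrality spreads from `Y_1` to all `Y_j`. -/
theorem isIntegral_of_intertwiner {q : Kˣ} {t y z : R}
    (ht : t * t = 1 + ((q : K) - ((q⁻¹ : Kˣ) : K)) • t) (hz : t * y * t = z) (hyz : y * z = z * y)
    (hy : IsIntegral K y) : IsIntegral K z := by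
  obtain ⟨p, hp, hpy⟩ := hy
  rw [← Polynomial.aeval_def] at hpy
  have hy : IsIntegral K y := ⟨p, hp, hpy⟩
  set c := (q : K) - ((q⁻¹ : Kˣ) : K) with hc
  have h1 : t * y = z * t - c • z := by
    rw [← hz, mul_assoc (t * y), ht, mul_add, mul_one, mul_smul_comm]; abel
  have h2 : t * z = y * t + c • z := by
    rw [← hz, ← mul_assoc, ← mul_assoc, ht, add_mul, one_mul, add_mul, smul_mul_assoc,
      smul_mul_assoc]
  set φ := t * y - y * t with hφ
  have hφ1 : SemiconjBy φ y z := by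
    change φ * y = z * φ
    have e1 : φ * y = t * y * y - y * (t * y) := by rw [hφ]; noncomm_ring
    have e2 : z * φ = (z * t) * y - z * y * t := by rw [hφ]; noncomm_ring
    have e3 : z * t = t * y + c • z := by rw [h1]; abel
    rw [e1, e2, e3, add_mul, smul_mul_assoc, h1, ← hyz, mul_sub, mul_smul_comm, ← mul_assoc]
    rw [sub_mul, smul_mul_assoc, ← hyz]; abel
  have hφ2 : φ * φ = - ((z - ((q : K) ^ 2) • y) * (z - (((q⁻¹ : Kˣ) : K) ^ 2) • y)) := by
    have hφt : φ * t = z - y - c • (y * t) := by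
      rw [hφ, sub_mul, hz, mul_assoc, ht, mul_add, mul_one, mul_smul_comm]; abel
    have e1 : φ * φ = φ * t * y - z * (φ * t) := by
      nth_rewrite 2 [hφ]
      rw [mul_sub, ← mul_assoc, ← mul_assoc φ y t, hφ1.eq, mul_assoc z]
    have e2 : φ * φ = z * y + z * y + (c * c) • (y * z) - y * y - z * z := by
      rw [e1, hφt]
      have e3 : (z - y - c • (y * t)) * y = z * y - y * y - c • (y * (z * t) - c • (y * z)) := by
        rw [sub_mul, sub_mul, smul_mul_assoc, mul_assoc y t y, h1, mul_sub, mul_smul_comm]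
      have e4 : z * (z - y - c • (y * t)) = z * z - z * y - c • (y * (z * t)) := by
        rw [mul_sub, mul_sub, mul_smul_comm, ← mul_assoc, ← hyz, mul_assoc]
      rw [e3, e4, smul_sub, smul_smul]
      abel
    have hcc : c * c = (q : K) ^ 2 + ((q⁻¹ : Kˣ) : K) ^ 2 - 2 := by
      have := Units.mul_inv q
      rw [hc]; linear_combination (-2) * this
    have hqq : (q : K) ^ 2 * ((q⁻¹ : Kˣ) : K) ^ 2 = 1 := by
      rw [← mul_pow, Units.mul_inv, one_pow]
    rw [e2, hcc, hyz, sub_mul, mul_sub, mul_sub, mul_smul_comm, smul_mul_assoc, smul_mul_assoc,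
      mul_smul_comm, smul_smul, hqq, one_smul, hyz]
    module
  have hφ3 : φ * Polynomial.aeval y p = Polynomial.aeval z p * φ := by
    clear hpy hp
    induction p using Polynomial.induction_on' with
    | add p p' h h' => rw [map_add, map_add, mul_add, add_mul, h, h']
    | monomial d a =>
      rw [Polynomial.aeval_monomial, Polynomial.aeval_monomial, ← Algebra.smul_def,
        ← Algebra.smul_def, mul_smul_comm, smul_mul_assoc, (hφ1.pow_right d).eq]
  have hfin : Polynomial.aeval z p *
      ((z - ((q : K) ^ 2) • y) * (z - (((q⁻¹ : Kˣ) : K) ^ 2) • y)) = 0 := by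
    rw [← neg_eq_zero, ← mul_neg, ← hφ2, ← mul_assoc, ← hφ3, hpy, mul_zero, zero_mul]
  have hcomm : ∀ a b : Algebra.adjoin K ({y, z} : Set R), a * b = b * a := by
    have := Algebra.isMulCommutative_adjoin K (s := {y, z}) (by
      rintro a (rfl | rfl) b (rfl | rfl)
      exacts [rfl, hyz, hyz.symm, rfl])
    exact fun a b => mul_comm' a b
  let B := Algebra.adjoin K ({y, z} : Set R)
  let y' : B := ⟨y, Algebra.subset_adjoin (by simp)⟩
  let z' : B := ⟨z, Algebra.subset_adjoin (by simp)⟩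
  have h3 : IsIntegral K y' := (isIntegral_algHom_iff B.val Subtype.val_injective).1 hy
  have h4 : IsIntegral K z' := by
    refine isIntegral_of_aeval_mul hcomm hp h3 ((q : K) ^ 2) (((q⁻¹ : Kˣ) : K) ^ 2) ?_
    apply Subtype.val_injective
    change B.val (_ * _) = B.val 0
    rw [map_mul, ← Polynomial.aeval_algHom_apply, map_zero]
    exact hfin
  exact h4.map B.val

theorem finite_adjoin_of_mul_comm {B : Type*} [i : Ring B] [Algebra K B]
    (hcomm : ∀ x y : B, x * y = y * x) {s : Set B} (hs : s.Finite)
    (hint : ∀ x ∈ s, IsIntegral K x) : Module.Finite K (Algebra.adjoin K s) := by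
  obtain ⟨c, rfl⟩ : ∃ c : CommRing B, c.toRing = i := ⟨{ i with mul_comm := hcomm }, rfl⟩
  exact Algebra.finite_adjoin_of_finite_of_isIntegral hs hint

theorem finite_adjoin_of_commute {s : Set R} (hs : s.Finite)
    (hcomm : ∀ x ∈ s, ∀ y ∈ s, x * y = y * x) (hint : ∀ x ∈ s, IsIntegral K x) :
    Module.Finite K (Algebra.adjoin K s) := by
  have := Algebra.isMulCommutative_adjoin K hcomm
  have h1 : Module.Finite K (Algebra.adjoin K
      ((Subtype.val : Algebra.adjoin K s → R) ⁻¹' s)) :=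
    finite_adjoin_of_mul_comm (fun a b => mul_comm' a b)
      (hs.preimage Subtype.val_injective.injOn) fun x hx =>
        (isIntegral_algHom_iff (Algebra.adjoin K s).val Subtype.val_injective).1 (hint x hx)
  have h2 := Algebra.adjoin_adjoin_coe_preimage (R := K) (s := s)
  rw [h2] at h1
  exact Module.Finite.equiv (Subalgebra.topEquiv (R := K)
    (A := Algebra.adjoin K s)).toLinearEquiv

/-- Left multiplication by `y` is injective on the finite-dimensional space `D`, hence surjective,
so `y` has a right inverse in `D`, which must be `y'`. -/
theorem inv_mem_of_finite {D : Subalgebra K R} [Module.Finite K D] {y y' : R} (hy : y ∈ D)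
    (h : y' * y = 1) : y' ∈ D := by
  have hinj : Function.Injective (LinearMap.mulLeft K (⟨y, hy⟩ : D)) := by
    intro a b hab
    have h1 : y * a = y * b := congrArg Subtype.val hab
    apply Subtype.ext
    rw [← one_mul (a : R), ← one_mul (b : R), ← h, mul_assoc, h1, mul_assoc]
  obtain ⟨d, hd⟩ := LinearMap.injective_iff_surjective.1 hinj 1
  have h1 : y * d = 1 := congrArg Subtype.val hd
  rw [left_inv_eq_right_inv h h1]
  exact d.2

end Finiteness

/-! ### Finite-dimensionality of `H_m^λ` -/

section CycHecke

variable {K : Type u} [Field K] {q : Kˣ} {m : ℕ} {lam : residues q →₀ ℕ}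

theorem CycHecke.ev_surjective : Function.Surjective (CycHecke.ev (K := K) m lam) :=
  Quotient.mk_surjective

theorem monic_cycPoly : (cycPoly lam).Monic :=
  Polynomial.monic_prod_of_monic _ _ fun _ _ => (Polynomial.monic_X_sub_C _).pow _

theorem CycHecke.aeval_ev_Y (h : 0 < m) :
    Polynomial.aeval (CycHecke.ev m lam (AffHecke.Y q ⟨0, h⟩)) (cycPoly lam) = 0 := by
  rw [Polynomial.aeval_algHom_apply]
  have h1 : Polynomial.aeval (AffHecke.Y q ⟨0, h⟩) (cycPoly lam) ∈ heckeIdeal m lam :=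
    TwoSidedIdeal.subset_span ⟨h, rfl⟩
  exact (RingCon.eq _).2 h1

/-- The algebra is the product `D S`, with `D` generated by the images of the `Y_j` and `S` by those
of the `T_i`. `D` is finite-dimensional because its generators commute and are integral, starting
from `f_λ(Y_1) = 0`; `S` is so by the quadratic and braid relations. The product absorbs left
multiplication by the generators because `T_i D ⊆ D T_i + D`, and the `Y_j⁻¹` already lie in `D`. -/
instance finiteDimensional_cycHecke : FiniteDimensional K (CycHecke m lam) := by
  let ev := CycHecke.ev m lam
  let c := (q : K) - ((q⁻¹ : Kˣ) : K)
  -- The value `0` is never used: only the indices below `m - 1` enter `S`.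
  let f : ℕ → CycHecke m lam := fun i => if h : i + 1 < m then ev (AffHecke.T q i h) else 0
  have hf : ∀ i (h : i + 1 < m), f i = ev (AffHecke.T q i h) := fun i h => dif_pos h
  let S := Algebra.adjoin K (f '' Set.Iio (m - 1))
  have hS : Module.Finite K S := by
    refine finite_adjoin_of_braid (c := c) ?_ ?_ ?_
    · intro i hi
      rw [hf i (by omega), ← map_mul, AffHecke.T_mul_T, map_add, map_one, map_smul]
    · intro i hi
      rw [hf i (by omega), hf (i + 1) (by omega)]
      simp only [← map_mul, AffHecke.braid]
    · intro i j hij hj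
      rw [hf i (by omega), hf j (by omega)]
      change _ * _ = _ * _
      simp only [← map_mul]
      rw [AffHecke.far _ _ _ _ (by omega)]
  have hTS : ∀ i (h : i + 1 < m), ev (AffHecke.T q i h) ∈ S := fun i h =>
    Algebra.subset_adjoin ⟨i, Set.mem_Iio.2 (by omega), hf i h⟩
  let Y : Fin m → CycHecke m lam := fun j => ev (AffHecke.Y q j)
  have hYint : ∀ (j : ℕ) (h : j < m), IsIntegral K (Y ⟨j, h⟩) := by
    intro j
    induction j with
    | zero => exact fun h => ⟨cycPoly lam, monic_cycPoly, CycHecke.aeval_ev_Y h⟩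
    | succ j ih =>
      intro h
      refine isIntegral_of_intertwiner (q := q) (t := ev (AffHecke.T q j h)) ?_ ?_ ?_
        (ih (by omega))
      · rw [← map_mul, AffHecke.T_mul_T, map_add, map_one, map_smul]
      · simp only [Y, ← map_mul, AffHecke.T_Y_T]
      · simp only [Y, ← map_mul]
        rw [AffHecke.Y_comm]
  let D := Algebra.adjoin K (Set.range Y)
  have hD : Module.Finite K D := by
    refine finite_adjoin_of_commute (Set.finite_range Y) ?_ ?_
    · rintro _ ⟨i, rfl⟩ _ ⟨j, rfl⟩
      simp only [Y, ← map_mul]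
      rw [AffHecke.Y_comm]
    · rintro _ ⟨i, rfl⟩
      exact hYint i i.2
  have hYD : ∀ j, Y j ∈ D := fun j => Algebra.subset_adjoin ⟨j, rfl⟩
  have hYiD : ∀ j, ev (AffHecke.Yinv q j) ∈ D := fun j =>
    inv_mem_of_finite (hYD j) (by simp only [Y, ← map_mul, AffHecke.Yinv_Y, map_one])
  have hTD : ∀ i (h : i + 1 < m), ∀ d ∈ D, ∃ a ∈ D, ∃ b ∈ D,
      ev (AffHecke.T q i h) * d = a * ev (AffHecke.T q i h) + b := by
    intro i h d hd
    induction hd using Algebra.adjoin_induction with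
    | mem d hd =>
      obtain ⟨j, rfl⟩ := hd
      have hTT : ev (AffHecke.T q i h) * ev (AffHecke.T q i h) =
          1 + c • ev (AffHecke.T q i h) := by
        rw [← map_mul, AffHecke.T_mul_T, map_add, map_one, map_smul]
      have hTYT : ev (AffHecke.T q i h) * Y ⟨i, by omega⟩ * ev (AffHecke.T q i h) =
          Y ⟨i + 1, h⟩ := by
        simp only [Y, ← map_mul, AffHecke.T_Y_T]
      by_cases h1 : (j : ℕ) = i
      · rw [show j = ⟨i, by omega⟩ from Fin.ext h1]
        refine ⟨Y ⟨i + 1, h⟩, hYD _, -(c • Y ⟨i + 1, h⟩), neg_mem (D.smul_mem (hYD _) c), ?_⟩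
        rw [← hTYT, mul_assoc (_ * _), hTT, mul_add, mul_one, mul_smul_comm]
        abel
      by_cases h2 : (j : ℕ) = i + 1
      · rw [show j = ⟨i + 1, h⟩ from Fin.ext h2]
        refine ⟨Y ⟨i, by omega⟩, hYD _, c • Y ⟨i + 1, h⟩, D.smul_mem (hYD _) c, ?_⟩
        rw [← hTYT, ← mul_assoc, ← mul_assoc, hTT, add_mul, one_mul, add_mul, smul_mul_assoc,
          smul_mul_assoc]
      · refine ⟨Y j, hYD _, 0, zero_mem _, ?_⟩
        simp only [Y, ← map_mul, add_zero]
        rw [AffHecke.T_Y i h j h1 h2]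
    | algebraMap k =>
      exact ⟨_, D.algebraMap_mem k, 0, zero_mem _, by rw [add_zero, Algebra.commutes]⟩
    | add x y _ _ hx hy =>
      obtain ⟨a, ha, b, hb, e⟩ := hx
      obtain ⟨a', ha', b', hb', e'⟩ := hy
      exact ⟨_, add_mem ha ha', _, add_mem hb hb', by rw [mul_add, e, e', add_mul]; abel⟩
    | mul x y _ hyD hx hy =>
      obtain ⟨a, ha, b, hb, e⟩ := hx
      obtain ⟨a', ha', b', hb', e'⟩ := hy
      refine ⟨_, mul_mem ha ha', a * b' + b * y, add_mem (mul_mem ha hb') (mul_mem hb hyD), ?_⟩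
      rw [← mul_assoc, e, add_mul, mul_assoc, e', mul_add, mul_assoc]
      abel
  let E := D.toSubmodule * S.toSubmodule
  have hDE : ∀ d ∈ D, ∀ e ∈ E, d * e ∈ E := by
    intro d hd e he
    have : E ≤ E.comap (LinearMap.mulLeft K d) := Submodule.mul_le.2 fun x hx y hy => by
      change d * (x * y) ∈ E
      rw [← mul_assoc]
      exact Submodule.mul_mem_mul (D.mul_mem hd hx) hy
    exact this he
  have hTE : ∀ i (h : i + 1 < m), ∀ e ∈ E, ev (AffHecke.T q i h) * e ∈ E := by
    intro i h e he
    have : E ≤ E.comap (LinearMap.mulLeft K (ev (AffHecke.T q i h))) :=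
      Submodule.mul_le.2 fun x hx y hy => by
        change ev (AffHecke.T q i h) * (x * y) ∈ E
        obtain ⟨a, ha, b, hb, e⟩ := hTD i h x hx
        rw [← mul_assoc, e, add_mul, mul_assoc]
        exact E.add_mem (Submodule.mul_mem_mul ha (S.mul_mem (hTS i h) hy))
          (Submodule.mul_mem_mul hb hy)
    exact this he
  have hmul : ∀ x : AffHecke q m, ∀ e ∈ E, ev x * e ∈ E := by
    intro x
    induction x using AffHecke.induction with
    | hT i h => exact hTE i h
    | hY j => exact hDE _ (hYD j)
    | hYi j => exact hDE _ (hYiD j)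
    | hc k => intro e he; rw [AlgHom.commutes, ← Algebra.smul_def]; exact E.smul_mem k he
    | hadd a b ha hb => intro e he; rw [map_add, add_mul]; exact E.add_mem (ha e he) (hb e he)
    | hmul a b ha hb => intro e he; rw [map_mul, mul_assoc]; exact ha _ (hb e he)
  have hE : E = ⊤ := by
    refine eq_top_iff.2 fun x _ => ?_
    obtain ⟨x, rfl⟩ := CycHecke.ev_surjective x
    have h1 : (1 : CycHecke m lam) ∈ E := by
      rw [← mul_one (1 : CycHecke m lam)]
      exact Submodule.mul_mem_mul (one_mem D) (one_mem S)
    have := hmul x 1 h1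
    rwa [mul_one] at this
  have hEfg : E.FG := (Module.Finite.iff_fg.1 hD).mul (Module.Finite.iff_fg.1 hS)
  rw [hE] at hEfg
  exact ⟨hEfg⟩

end CycHecke

/-! ## Homomorphisms out of the cyclotomic quotients -/

theorem ringCon_span_le_ker {K : Type u} [Field K] {A : Type v} [Ring A] [Algebra K A]
    {B : Type w} [Ring B] [Algebra K B] (f : A →ₐ[K] B) {s : Set A} (h : ∀ x ∈ s, f x = 0) :
    (TwoSidedIdeal.span s).ringCon ≤ RingCon.ker f.toRingHom := by
  intro x y hxy
  have h1 : TwoSidedIdeal.span s ≤ TwoSidedIdeal.ker f.toRingHom :=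
    TwoSidedIdeal.span_le.2 fun x hx => (TwoSidedIdeal.mem_ker _).2 (h x hx)
  have h2 := h1 ((TwoSidedIdeal.rel_iff _ _ _).1 hxy)
  rw [TwoSidedIdeal.mem_ker, map_sub, sub_eq_zero] at h2
  exact h2

section Lift

variable {K : Type u} [Field K] {q : Kˣ} {lam : residues q →₀ ℕ} {B : Type w} [Ring B]
  [Algebra K B]

/-- A homomorphism which kills `f_λ(X_1)` factors through `Y_{r,n}^λ`. -/
def CycYok.lift {r n : ℕ} (f : AffYok r q n →ₐ[K] B)
    (h : ∀ h : 0 < n, Polynomial.aeval (f (AffYok.X r q 0 h)) (cycPoly lam) = 0) :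
    CycYok r n lam →ₐ[K] B :=
  RingCon.liftₐ (yokIdeal r n lam).ringCon f (ringCon_span_le_ker f (by
    rintro _ ⟨h0, rfl⟩
    rw [← Polynomial.aeval_algHom_apply, h]))

theorem CycYok.proj_surjective {r n : ℕ} :
    Function.Surjective (CycYok.proj (K := K) r n lam) :=
  Quotient.mk_surjective

theorem CycYok.aeval_proj_X {r n : ℕ} (h : 0 < n) :
    Polynomial.aeval (CycYok.proj r n lam (AffYok.X r q 0 h)) (cycPoly lam) = 0 := by
  rw [Polynomial.aeval_algHom_apply]
  have h1 : Polynomial.aeval (AffYok.X r q 0 h) (cycPoly lam) ∈ yokIdeal r n lam :=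
    TwoSidedIdeal.subset_span ⟨h, rfl⟩
  exact (RingCon.eq _).2 h1

/-- A homomorphism which kills `f_λ(Y_1)` factors through `H_m^λ`. -/
def CycHecke.lift {m : ℕ} (f : AffHecke q m →ₐ[K] B)
    (h : ∀ h : 0 < m, Polynomial.aeval (f (AffHecke.Y q ⟨0, h⟩)) (cycPoly lam) = 0) :
    CycHecke m lam →ₐ[K] B :=
  RingCon.liftₐ (heckeIdeal m lam).ringCon f (ringCon_span_le_ker f (by
    rintro _ ⟨h0, rfl⟩
    rw [← Polynomial.aeval_algHom_apply, h]))

end Lift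

/-! ## Isomorphisms between modules of functions on shuffles -/

section ShuffleIso

variable {K : Type u} [Field K] {r n : ℕ} {q : Kˣ} {μ μ' : Comp r n}
  {W : Type w} [AddCommGroup W] [Module K W] {W' : Type v} [AddCommGroup W'] [Module K W']
  {ζ : Fin r → K} {op : ∀ k, AffHecke q (μ.part k) →ₐ[K] Module.End K W}
  {op' : ∀ k, AffHecke q (μ'.part k) →ₐ[K] Module.End K W'}
  (hr : (r : K) ≠ 0) (hζ : Function.Injective ζ) (hζr : ∀ k, ζ k ^ r = 1)
  (hop : ∀ k l, k ≠ l → ∀ x y, Commute (op k x) (op l y))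
  (hop' : ∀ k l, k ≠ l → ∀ x y, Commute (op' k x) (op' l y))

theorem Shuffle.card_col (σ : Shuffle μ) (k : Fin r) :
    Fintype.card {j // σ.col j = k} = μ.part k := by
  rw [← Fintype.card_fin (μ.part k)]
  refine Fintype.card_congr (Equiv.symm (Equiv.ofBijective
    (fun a => ⟨σ.1.symm ⟨k, a⟩, by simp [col]⟩) ⟨fun a b h => ?_, ?_⟩))
  · simpa using h
  · rintro ⟨j, rfl⟩
    exact ⟨(σ.1 j).2, Subtype.ext (by simp [col])⟩

theorem map_mem_wtSpace {M : Type*} [AddCommGroup M] [Module K M] {M' : Type*} [AddCommGroup M']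
    [Module K M'] {ρ : AffYok r q n →ₐ[K] Module.End K M}
    {ρ' : AffYok r q n →ₐ[K] Module.End K M'} (Φ : M →ₗ[K] M')
    (hΦ : ∀ a m, Φ (ρ a m) = ρ' a (Φ m)) {c : Fin n → Fin r} {m : M} (hm : m ∈ wtSpace ρ ζ c) :
    Φ m ∈ wtSpace ρ' ζ c := fun j => by
  rw [← hΦ, hm j, map_smul]

/-- An isomorphism preserves weights, so the standard colouring of `μ` is the colouring of some
shuffle of type `μ'`; the number of positions of each colour gives the parts. -/
theorem comp_eq_of_shuffleRep_equiv [Nontrivial W]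
    (Φ : (Shuffle μ → W) ≃ₗ[K] (Shuffle μ' → W'))
    (hΦ : ∀ a f, Φ (shuffleRep hr hζ hζr hop a f) = shuffleRep hr hζ hζr hop' a (Φ f)) :
    μ = μ' := by
  obtain ⟨w, hw⟩ := exists_ne (0 : W)
  have h0 : Φ (stdIncl K μ W w) ≠ 0 := by
    rw [Ne, LinearEquiv.map_eq_zero_iff]
    intro h
    apply hw
    rw [← stdEval_stdIncl (K := K) (μ := μ) w, h, map_zero]
  obtain ⟨σ, hσ⟩ := Function.ne_iff.1 h0
  have h1 := col_eq_of_mem_wtSpace hr hζ hζr hop'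
    (map_mem_wtSpace Φ.toLinearMap hΦ (stdIncl_mem_wtSpace hr hζ hζr hop w)) hσ
  apply Subtype.ext
  funext k
  have h2 := (Shuffle.std μ).card_col k
  rw [← h1] at h2
  exact h2.symm.trans (σ.card_col k)

/-- Restrict to the weight spaces of the standard colouring, which are copies of `W` and `W'`. The
block operators there come from the same elements of `Ŷ_{r,n}` on both sides, so the restriction
respects them. -/
theorem exists_equiv_of_shuffleRep_equiv {op' : ∀ k, AffHecke q (μ.part k) →ₐ[K] Module.End K W'}
    (hop' : ∀ k l, k ≠ l → ∀ x y, Commute (op' k x) (op' l y))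
    (Φ : (Shuffle μ → W) ≃ₗ[K] (Shuffle μ → W'))
    (hΦ : ∀ a f, Φ (shuffleRep hr hζ hζr hop a f) = shuffleRep hr hζ hζr hop' a (Φ f)) :
    ∃ e : W ≃ₗ[K] W', ∀ k x w, e (op k x w) = op' k x (e w) := by
  have hΦ' : ∀ a f, Φ.symm (shuffleRep hr hζ hζr hop' a f) =
      shuffleRep hr hζ hζr hop a (Φ.symm f) := fun a f => by
    rw [LinearEquiv.symm_apply_eq, hΦ, LinearEquiv.apply_symm_apply]
  have h1 : ∀ w, Φ (stdIncl K μ W w) = stdIncl K μ W' (stdEval K μ W' (Φ (stdIncl K μ W w))) :=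
    fun w => eq_stdIncl_of_mem_wtSpace hr hζ hζr hop'
      (map_mem_wtSpace Φ.toLinearMap hΦ (stdIncl_mem_wtSpace hr hζ hζr hop w))
  have h2 : ∀ w, Φ.symm (stdIncl K μ W' w) =
      stdIncl K μ W (stdEval K μ W (Φ.symm (stdIncl K μ W' w))) :=
    fun w => eq_stdIncl_of_mem_wtSpace hr hζ hζr hop
      (map_mem_wtSpace Φ.symm.toLinearMap hΦ' (stdIncl_mem_wtSpace hr hζ hζr hop' w))
  refine ⟨LinearEquiv.ofLinearMap (stdEval K μ W' ∘ₗ Φ.toLinearMap ∘ₗ stdIncl K μ W)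
    (stdEval K μ W ∘ₗ Φ.symm.toLinearMap ∘ₗ stdIncl K μ W') ?_ ?_, fun k x w => ?_⟩
  · ext w
    simp only [LinearMap.comp_apply, LinearEquiv.coe_coe, LinearMap.id_apply]
    rw [← h2, LinearEquiv.apply_symm_apply, stdEval_stdIncl]
  · ext w
    simp only [LinearMap.comp_apply, LinearEquiv.coe_coe, LinearMap.id_apply]
    rw [← h1, LinearEquiv.symm_apply_apply, stdEval_stdIncl]
  · simp only [LinearEquiv.coe_ofLinearMap, LinearMap.comp_apply, LinearEquiv.coe_coe]
    obtain ⟨a, ha, ha'⟩ := exists_shuffleRep_stdIncl hr hζ hζr hop hop' k x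
    rw [← ha, hΦ, h1 w, ha', stdEval_stdIncl, stdEval_stdIncl]

theorem shuffleRep_map {op' : ∀ k, AffHecke q (μ.part k) →ₐ[K] Module.End K W'}
    (hop' : ∀ k l, k ≠ l → ∀ x y, Commute (op' k x) (op' l y))
    (e : W →ₗ[K] W') (he : ∀ k x w, e (op k x w) = op' k x (e w)) (a : AffYok r q n)
    (f : Shuffle μ → W) :
    e ∘ shuffleRep hr hζ hζr hop a f = shuffleRep hr hζ hζr hop' a (e ∘ f) := by
  induction a using AffYok.induction generalizing f with
  | ht j =>
    funext σ
    rw [shuffleRep_t, shuffleRep_t, Function.comp_apply, tS_apply, tS_apply, map_smul]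
    rfl
  | hg i h =>
    funext σ
    rw [shuffleRep_g, shuffleRep_g, Function.comp_apply]
    by_cases hc : (σ.1 ⟨i, by omega⟩).1 = (σ.1 ⟨i + 1, h⟩).1
    · rw [gS_same _ _ hc, gS_same _ _ hc, Top, Top]
      split_ifs
      · exact he _ _ _
      · exact map_zero e
    · rw [gS_diff _ _ hc, gS_diff _ _ hc]
      rfl
  | hX h =>
    funext σ
    rw [shuffleRep_X, shuffleRep_X, Function.comp_apply, XS_apply, XS_apply]
    exact he _ _ _
  | hXi h =>
    funext σ
    have h1 := AffYok.Xinv_zero (r := r) (q := q) h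
    rw [← h1, shuffleRep_Xinv hr hζ hζr hop ⟨0, h⟩, shuffleRep_Xinv hr hζ hζr hop' ⟨0, h⟩,
      Function.comp_apply, XiS_apply, XiS_apply]
    exact he _ _ _
  | hc c =>
    funext σ
    rw [AlgHom.commutes, AlgHom.commutes, Module.algebraMap_end_apply, Module.algebraMap_end_apply,
      Function.comp_apply, Pi.smul_apply, Pi.smul_apply, map_smul]
    rfl
  | hadd a b ha hb =>
    rw [map_add, map_add, LinearMap.add_apply, LinearMap.add_apply, ← ha, ← hb]
    funext σ
    exact map_add e _ _
  | hmul a b ha hb =>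
    rw [map_mul, map_mul, Module.End.mul_apply, Module.End.mul_apply, ha, hb]

theorem aeval_shuffleRep_X (p : Polynomial K) (j : Fin n) (f : Shuffle μ → W) (σ : Shuffle μ) :
    Polynomial.aeval (shuffleRep hr hζ hζr hop (AffYok.X r q j j.2)) p f σ =
      Polynomial.aeval (Yop op (σ.1 j)) p (f σ) := by
  rw [shuffleRep_X]
  induction p using Polynomial.induction_on' generalizing f with
  | add p p' hp hp' =>
    rw [map_add, map_add, LinearMap.add_apply, LinearMap.add_apply, Pi.add_apply, hp, hp']
  | monomial d c =>
    rw [Polynomial.aeval_monomial, Polynomial.aeval_monomial, Module.End.mul_apply,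
      Module.End.mul_apply, Module.algebraMap_end_apply, Module.algebraMap_end_apply,
      Pi.smul_apply]
    congr 1
    induction d generalizing f with
    | zero => rfl
    | succ d ih =>
      rw [pow_succ, pow_succ, Module.End.mul_apply, Module.End.mul_apply, ih, XS_apply]

/-- Blocks are listed in increasing order, so no entry of a block can precede its first one. Hence
`X_1` acts at every shuffle as the `Y_1` of some block, and `f_λ(X_1)` vanishes. -/
theorem Shuffle.apply_zero (σ : Shuffle μ) (h : 0 < n) :
    ∃ (k : Fin r) (hk : 0 < μ.part k), σ.1 ⟨0, h⟩ = ⟨k, ⟨0, hk⟩⟩ := by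
  rcases hp : σ.1 ⟨0, h⟩ with ⟨k, a⟩
  have hk : 0 < μ.part k := by have := a.2; omega
  refine ⟨k, hk, ?_⟩
  congr 1
  have h1 : σ.1.symm ⟨k, a⟩ = ⟨0, h⟩ := by rw [← hp]; simp
  have h2 : σ.1.symm ⟨k, a⟩ ≤ σ.1.symm ⟨k, ⟨0, hk⟩⟩ := by
    rw [h1]
    exact Fin.le_def.2 (Nat.zero_le _)
  have h3 := (σ.2 k).le_iff_le.1 h2
  exact le_antisymm h3 (Fin.le_def.2 (Nat.zero_le _))

end ShuffleIso

/-! ## The modules `S_μ(L.)` -/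

section SModules

variable {K : Type u} [Field K] {r n : ℕ} {q : Kˣ} {lam : residues q →₀ ℕ} {μ μ' : Comp r n}

theorem roots_injective (ζ : Fin r ≃ rootsOfUnity r K) :
    Function.Injective fun k => ((ζ k : Kˣ) : K) :=
  fun _ _ h => ζ.injective (Subtype.ext (Units.ext h))

theorem roots_pow (ζ : Fin r ≃ rootsOfUnity r K) (k : Fin r) : ((ζ k : Kˣ) : K) ^ r = 1 :=
  (mem_rootsOfUnity' r _).1 (ζ k).2

theorem roots_surjective (hr : (r : K) ≠ 0) (ζ : Fin r ≃ rootsOfUnity r K) (x : K)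
    (hx : x ^ r = 1) : ∃ k, ((ζ k : Kˣ) : K) = x := by
  have h0 : r ≠ 0 := by rintro rfl; exact hr Nat.cast_zero
  have hu : IsUnit x := IsUnit.of_pow_eq_one hx h0
  refine ⟨ζ.symm ⟨hu.unit, (mem_rootsOfUnity' r _).2 hx⟩, ?_⟩
  rw [Equiv.apply_symm_apply]
  rfl

instance finiteDimensional_of_isSimpleModule {m : ℕ} (L : ModuleCat.{w} (CycHecke m lam))
    [IsSimpleModule (CycHecke m lam) L] : FiniteDimensional K L :=
  Module.Finite.trans (CycHecke m lam) L

variable (L : ∀ k, ModuleCat.{w} (CycHecke (μ.part k) lam))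
  (L' : ∀ k, ModuleCat.{w} (CycHecke (μ.part k) lam))

/-- The action of the affine Hecke algebra of the block `k` on the outer tensor product. -/
def outerOp (k : Fin r) : AffHecke q (μ.part k) →ₐ[K] Module.End K (⨂[K] k, (L k : Type w)) :=
  (factorEnd (fun k => (L k : Type w)) k).comp (inflation (L k))

theorem outerOp_apply (k : Fin r) (x : AffHecke q (μ.part k)) :
    outerOp L k x = factorEnd (fun k => (L k : Type w)) k
      (Algebra.lsmul K K (L k : Type w) (CycHecke.ev _ lam x)) := rfl

theorem outerOp_commute (k l : Fin r) (h : k ≠ l) (x : AffHecke q (μ.part k))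
    (y : AffHecke q (μ.part l)) : Commute (outerOp L k x) (outerOp L l y) :=
  factorEnd_commute (fun k => (L k : Type w)) k l h _ _

theorem outerOp_irreducible [IsAlgClosed K]
    [∀ k, IsSimpleModule (CycHecke (μ.part k) lam) (L k)]
    (U : Submodule K (⨂[K] k, (L k : Type w))) (hU : ∀ k x, ∀ w ∈ U, outerOp L k x w ∈ U) :
    U = ⊥ ∨ U = ⊤ :=
  outerTensor_irreducible (A := fun k => CycHecke (μ.part k) lam) fun k a w hw => by
    obtain ⟨x, rfl⟩ := CycHecke.ev_surjective a
    exact hU k x w hw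

variable (hr : (r : K) ≠ 0) (ζ : Fin r ≃ rootsOfUnity r K)

/-- The action of `Ŷ_{r,n}` on functions on shuffles which is isomorphic to `S_μ(L.)`. -/
def sRep : AffYok r q n →ₐ[K] Module.End K (Shuffle μ → ⨂[K] k, (L k : Type w)) :=
  shuffleRep hr (roots_injective ζ) (roots_pow ζ) (outerOp_commute L)

/-- `S_μ(L.)` as a module of functions on shuffles. -/
def sEquiv : SMod hr ζ μ L ≃ₗ[K] (Shuffle μ → ⨂[K] k, (L k : Type w)) :=
  indEquiv hr (roots_injective ζ) (roots_pow ζ) (outerOp_commute L)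

theorem sEquiv_smul (a : AffYok r q n) (x : SMod hr ζ μ L) :
    sEquiv L hr ζ (a • x) = sRep L hr ζ a (sEquiv L hr ζ x) :=
  indEquiv_smul hr (roots_injective ζ) (roots_pow ζ) (outerOp_commute L) a x

theorem sMod_irreducible [IsAlgClosed K]
    [∀ k, IsSimpleModule (CycHecke (μ.part k) lam) (L k)] (P : Submodule K (SMod hr ζ μ L))
    (hP : ∀ a : AffYok r q n, ∀ x ∈ P, a • x ∈ P) : P = ⊥ ∨ P = ⊤ := by
  have h1 := shuffleRep_irreducible hr (roots_injective ζ) (roots_pow ζ) (outerOp_commute L)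
    (roots_surjective hr ζ) (outerOp_irreducible L)
    (P := P.map (sEquiv L hr ζ).toLinearMap) (by
      rintro a _ ⟨x, hx, rfl⟩
      exact ⟨a • x, hP a x hx, sEquiv_smul L hr ζ a x⟩)
  refine h1.imp (fun h => ?_) (fun h => ?_)
  · exact (Submodule.map_eq_bot_iff (e := sEquiv L hr ζ) (p := P)).1 h
  · exact (Submodule.map_eq_top_iff (e := sEquiv L hr ζ) (p := P)).1 h

theorem sMod_nontrivial [∀ k, IsSimpleModule (CycHecke (μ.part k) lam) (L k)] :
    Nontrivial (SMod hr ζ μ L) := by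
  have : ∀ k, Nontrivial (L k) := fun k => IsSimpleModule.nontrivial (CycHecke (μ.part k) lam) _
  have := outerTensor_nontrivial (K := K) (L := fun k => (L k : Type w))
  have : Nonempty (Shuffle μ) := ⟨Shuffle.std μ⟩
  exact (sEquiv L hr ζ).toEquiv.nontrivial

theorem aeval_sRep_X (h : 0 < n) :
    Polynomial.aeval (sRep L hr ζ (AffYok.X r q 0 h)) (cycPoly lam) = 0 := by
  refine LinearMap.ext fun f => funext fun σ => ?_
  refine (aeval_shuffleRep_X hr (roots_injective ζ) (roots_pow ζ) (outerOp_commute L)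
    (cycPoly lam) ⟨0, h⟩ f σ).trans ?_
  obtain ⟨k, hk, h1⟩ := σ.apply_zero h
  rw [h1, Yop, outerOp_apply, Polynomial.aeval_algHom_apply, Polynomial.aeval_algHom_apply,
    CycHecke.aeval_ev_Y, map_zero, map_zero]
  rfl

theorem aeval_lsmul_X (h : 0 < n) :
    Polynomial.aeval (Algebra.lsmul K K (SMod hr ζ μ L) (AffYok.X r q 0 h)) (cycPoly lam) = 0 := by
  refine LinearMap.ext fun x => (sEquiv L hr ζ).injective ?_
  rw [Polynomial.aeval_algHom_apply, Algebra.lsmul_coe, sEquiv_smul,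
    ← Polynomial.aeval_algHom_apply, aeval_sRep_X, LinearMap.zero_apply, LinearMap.zero_apply,
    map_zero]

/-- The action of `Ŷ_{r,n}` on `S_μ(L.)` factors through `Y_{r,n}^λ`. -/
theorem exists_module_sMod [IsAlgClosed K]
    [∀ k, IsSimpleModule (CycHecke (μ.part k) lam) (L k)] :
    ∃ _ : Module (CycYok r n lam) (SMod hr ζ μ L),
      (∀ (y : AffYok r q n) (s : SMod hr ζ μ L), CycYok.proj r n lam y • s = y • s) ∧
      IsSimpleModule (CycYok r n lam) (SMod hr ζ μ L) := by
  let τ := CycYok.lift (lam := lam) (Algebra.lsmul K K (SMod hr ζ μ L)) (aeval_lsmul_X L hr ζ)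
  let inst : Module (CycYok r n lam) (SMod hr ζ μ L) := Module.compHom _ τ.toRingHom
  have h1 : ∀ (y : AffYok r q n) (s : SMod hr ζ μ L), CycYok.proj r n lam y • s = y • s :=
    fun y s => rfl
  refine ⟨inst, h1, ?_⟩
  have := sMod_nontrivial L hr ζ
  rw [isSimpleModule_iff]
  refine { toNontrivial := inferInstance, eq_bot_or_eq_top := fun N => ?_ }
  let P : Submodule K (SMod hr ζ μ L) :=
    { N.toAddSubmonoid with
      smul_mem' := fun c x hx => by
        have h2 := N.smul_mem (CycYok.proj r n lam (algebraMap K _ c)) hx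
        rw [h1, algebraMap_smul] at h2
        exact h2 }
  have hmem : ∀ x, x ∈ P ↔ x ∈ N := fun x => Iff.rfl
  refine (sMod_irreducible L hr ζ P fun a x hx => ?_).imp (fun h => ?_) (fun h => ?_)
  · rw [← h1]
    exact N.smul_mem _ hx
  · refine (Submodule.eq_bot_iff _).2 fun x hx => ?_
    rw [← hmem, h] at hx
    exact hx
  · refine eq_top_iff.2 fun x _ => ?_
    rw [← hmem, h]
    trivial

theorem comp_eq_of_linearEquiv (L : ∀ k, ModuleCat.{w} (CycHecke (μ.part k) lam))
    (L' : ∀ k, ModuleCat.{w} (CycHecke (μ'.part k) lam))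
    [∀ k, IsSimpleModule (CycHecke (μ.part k) lam) (L k)]
    (E : SMod hr ζ μ L ≃ₗ[AffYok r q n] SMod hr ζ μ' L') : μ = μ' := by
  have : ∀ k, Nontrivial (L k) := fun k => IsSimpleModule.nontrivial (CycHecke (μ.part k) lam) _
  have := outerTensor_nontrivial (K := K) (L := fun k => (L k : Type w))
  refine comp_eq_of_shuffleRep_equiv hr (roots_injective ζ) (roots_pow ζ) (outerOp_commute L)
    (outerOp_commute L') ((sEquiv L hr ζ).symm.trans
      ((E.restrictScalars K).trans (sEquiv L' hr ζ))) fun a f => ?_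
  obtain ⟨x, rfl⟩ := (sEquiv L hr ζ).surjective f
  have h1 := sEquiv_smul L hr ζ a x
  rw [sRep] at h1
  simp only [LinearEquiv.trans_apply]
  rw [← h1, LinearEquiv.symm_apply_apply, LinearEquiv.symm_apply_apply,
    LinearEquiv.restrictScalars_apply, map_smul]
  exact sEquiv_smul L' hr ζ a (E x)

theorem nonempty_linearEquiv_of_linearEquiv
    [∀ k, IsSimpleModule (CycHecke (μ.part k) lam) (L k)]
    [∀ k, IsSimpleModule (CycHecke (μ.part k) lam) (L' k)]
    (E : SMod hr ζ μ L ≃ₗ[AffYok r q n] SMod hr ζ μ L') (k : Fin r) :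
    Nonempty (L k ≃ₗ[CycHecke (μ.part k) lam] L' k) := by
  obtain ⟨e, he⟩ := exists_equiv_of_shuffleRep_equiv hr (roots_injective ζ) (roots_pow ζ)
    (outerOp_commute L) (outerOp_commute L') ((sEquiv L hr ζ).symm.trans
      ((E.restrictScalars K).trans (sEquiv L' hr ζ))) fun a f => by
        obtain ⟨x, rfl⟩ := (sEquiv L hr ζ).surjective f
        have h1 := sEquiv_smul L hr ζ a x
        rw [sRep] at h1
        simp only [LinearEquiv.trans_apply]
        rw [← h1, LinearEquiv.symm_apply_apply, LinearEquiv.symm_apply_apply,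
          LinearEquiv.restrictScalars_apply, map_smul]
        exact sEquiv_smul L' hr ζ a (E x)
  refine nonempty_linearEquiv_of_outerTensor (A := fun k => CycHecke (μ.part k) lam) e
    (fun k a x => ?_) k
  obtain ⟨y, rfl⟩ := CycHecke.ev_surjective a
  exact he k y x

theorem exists_linearEquiv_of_linearEquiv
    (f : ∀ k, L k ≃ₗ[CycHecke (μ.part k) lam] L' k) :
    Nonempty (SMod hr ζ μ L ≃ₗ[AffYok r q n] SMod hr ζ μ L') := by
  let e : (⨂[K] k, (L k : Type w)) ≃ₗ[K] (⨂[K] k, (L' k : Type w)) :=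
    PiTensorProduct.congr fun k => (f k).restrictScalars K
  have he : ∀ k x w, e (outerOp L k x w) = outerOp L' k x (e w) := by
    intro k x w
    have : e.toLinearMap ∘ₗ outerOp L k x = outerOp L' k x ∘ₗ e.toLinearMap := by
      refine PiTensorProduct.ext (MultilinearMap.ext fun z => ?_)
      simp only [LinearMap.compMultilinearMap_apply, LinearMap.comp_apply, LinearEquiv.coe_coe, e]
      rw [outerOp_apply, outerOp_apply, factorEnd_tprod, PiTensorProduct.congr_tprod,
        PiTensorProduct.congr_tprod, factorEnd_tprod]
      congr 1
      funext l
      by_cases hl : l = k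
      · subst hl
        simp
      · simp [hl]
    exact LinearMap.congr_fun this w
  let Φ := (sEquiv L hr ζ).trans
    ((LinearEquiv.piCongrRight fun _ : Shuffle μ => e).trans (sEquiv L' hr ζ).symm)
  refine ⟨{ Φ with map_smul' := fun a x => ?_ }⟩
  change (sEquiv L' hr ζ).symm (e ∘ sEquiv L hr ζ (a • x)) =
    a • (sEquiv L' hr ζ).symm (e ∘ sEquiv L hr ζ x)
  rw [LinearEquiv.symm_apply_eq, sEquiv_smul, sEquiv_smul, LinearEquiv.apply_symm_apply]
  exact shuffleRep_map hr (roots_injective ζ) (roots_pow ζ) (outerOp_commute L)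
    (outerOp_commute L') e.toLinearMap he a _

end SModules

/-! ## Hecke algebras acting on weight spaces -/

theorem aeval_apply_of_intertwine {K : Type u} [Field K] {M : Type*} [AddCommGroup M] [Module K M]
    {M' : Type*} [AddCommGroup M'] [Module K M'] {T : Module.End K M} {S : Module.End K M'}
    (G : M →ₗ[K] M') {N : Submodule K M} (hT : ∀ m ∈ N, T m ∈ N)
    (h : ∀ m ∈ N, S (G m) = G (T m)) (p : Polynomial K) {m : M} (hm : m ∈ N) :
    Polynomial.aeval S p (G m) = G (Polynomial.aeval T p m) := by
  induction p using Polynomial.induction_on' generalizing m with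
  | add p p' hp hp' =>
    rw [map_add, map_add, LinearMap.add_apply, LinearMap.add_apply, map_add, hp hm, hp' hm]
  | monomial d c =>
    rw [Polynomial.aeval_monomial, Polynomial.aeval_monomial, Module.End.mul_apply,
      Module.End.mul_apply, Module.algebraMap_end_apply, Module.algebraMap_end_apply, map_smul]
    congr 1
    induction d generalizing m with
    | zero => rfl
    | succ d ih =>
      rw [pow_succ, pow_succ, Module.End.mul_apply, Module.End.mul_apply, h m hm, ih (hT m hm)]

theorem AffHecke.commute_of_generators {K : Type u} [Field K] {q : Kˣ} {m : ℕ} {B : Type*} [Ring B]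
    [Algebra K B] (φ : AffHecke q m →ₐ[K] B) {b : B} (hT : ∀ i h, Commute (φ (AffHecke.T q i h)) b)
    (hY : ∀ j, Commute (φ (AffHecke.Y q j)) b) (x : AffHecke q m) : Commute (φ x) b := by
  induction x using AffHecke.induction with
  | hT i h => exact hT i h
  | hY j => exact hY j
  | hYi j =>
    have h1 : φ (AffHecke.Yinv q j) * φ (AffHecke.Y q j) = 1 := by
      rw [← map_mul, AffHecke.Yinv_Y, map_one]
    have h2 : φ (AffHecke.Y q j) * φ (AffHecke.Yinv q j) = 1 := by
      rw [← map_mul, AffHecke.Y_Yinv, map_one]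
    let U : Bˣ := ⟨φ (AffHecke.Y q j), φ (AffHecke.Yinv q j), h2, h1⟩
    have h3 : Commute (U : B) b := hY j
    exact h3.units_inv_left
  | hc c => rw [AlgHom.commutes]; exact Algebra.commutes c b
  | hadd x y hx hy => rw [map_add]; exact hx.add_left hy
  | hmul x y hx hy => rw [map_mul]; exact hx.mul_left hy

section WeightHecke

variable {K : Type u} [Field K] {r n : ℕ} {q : Kˣ}

theorem AffYok.X_congr {i j : ℕ} (e : i = j) (hi : i < n) (hj : j < n) :
    AffYok.X r q i hi = AffYok.X r q j hj := by subst e; rfl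

theorem AffYok.Xinv_congr {i j : ℕ} (e : i = j) (hi : i < n) (hj : j < n) :
    (AffYok.Xinv i hi : AffYok r q n) = AffYok.Xinv j hj := by subst e; rfl

theorem AffYok.g_congr {i j : ℕ} (e : i = j) (hi : i + 1 < n) (hj : j + 1 < n) :
    AffYok.g r q i hi = AffYok.g r q j hj := by subst e; rfl

theorem Comp.val_pos_ne (μ : Comp r n) {k l : Fin r} {a : Fin (μ.part k)} {b : Fin (μ.part l)}
    (h : k = l → (a : ℕ) ≠ b) : (μ.pos ⟨k, a⟩ : ℕ) ≠ μ.pos ⟨l, b⟩ := by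
  intro h0
  have h1 := μ.pos.injective (Fin.ext h0)
  obtain rfl : k = l := congrArg Sigma.fst h1
  refine h rfl ?_
  have h2 := eq_of_heq (Sigma.mk.inj_iff.1 h1).2
  rw [h2]

theorem AffYok.g_pos_commute_g_pos (μ : Comp r n) {k l : Fin r} {a b : ℕ} (ha : a + 1 < μ.part k)
    (hb : b + 1 < μ.part l) (h : k = l → a + 2 ≤ b ∨ b + 2 ≤ a) :
    Commute (AffYok.g r q _ (μ.pos_succ_lt k a ha)) (AffYok.g r q _ (μ.pos_succ_lt l b hb)) := by
  have h1 : (μ.pos ⟨k, ⟨a, by omega⟩⟩ : ℕ) ≠ μ.pos ⟨l, ⟨b, by omega⟩⟩ :=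
    μ.val_pos_ne fun e => by have := h e; simp only; omega
  have h2 : (μ.pos ⟨k, ⟨a + 1, ha⟩⟩ : ℕ) ≠ μ.pos ⟨l, ⟨b, by omega⟩⟩ :=
    μ.val_pos_ne fun e => by have := h e; simp only; omega
  have h3 : (μ.pos ⟨k, ⟨a, by omega⟩⟩ : ℕ) ≠ μ.pos ⟨l, ⟨b + 1, hb⟩⟩ :=
    μ.val_pos_ne fun e => by have := h e; simp only; omega
  rw [μ.val_pos_succ k a ha] at h2
  rw [μ.val_pos_succ l b hb] at h3
  exact AffYok.far _ _ _ _ (by omega)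

theorem AffYok.g_pos_commute_X_pos (μ : Comp r n) {k l : Fin r} {a : ℕ} {b : Fin (μ.part l)}
    (ha : a + 1 < μ.part k) (h : k = l → (b : ℕ) ≠ a ∧ (b : ℕ) ≠ a + 1) :
    Commute (AffYok.g r q _ (μ.pos_succ_lt k a ha)) (AffYok.X r q _ (μ.pos ⟨l, b⟩).2) := by
  have h1 : (μ.pos ⟨k, ⟨a, by omega⟩⟩ : ℕ) ≠ μ.pos ⟨l, b⟩ :=
    μ.val_pos_ne fun e => (h e).1.symm
  have h2 : (μ.pos ⟨k, ⟨a + 1, ha⟩⟩ : ℕ) ≠ μ.pos ⟨l, b⟩ :=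
    μ.val_pos_ne fun e => (h e).2.symm
  rw [μ.val_pos_succ k a ha] at h2
  exact AffYok.g_commute_X _ _ _ _ h1.symm h2.symm

variable {M : Type w} [AddCommGroup M] [Module K M] (ρ : AffYok r q n →ₐ[K] Module.End K M)
  {ζ : Fin r → K} (hr : (r : K) ≠ 0) (hζ : Function.Injective ζ) (hζr : ∀ k, ζ k ^ r = 1)
  (μ : Comp r n)

variable (ζ) in
/-- The weight space of the standard colouring. -/
abbrev stdWt : Submodule K M := wtSpace ρ ζ (Shuffle.std μ).col

variable (ζ) in
/-- Values of the generators of the Hecke algebra of the block `k` on the standard weight space. -/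
def wtGen (k : Fin r) : HeckeGen (μ.part k) → Module.End K (stdWt ρ ζ μ)
  | .T a h => (ρ (AffYok.g r q _ (μ.pos_succ_lt k a h))).restrict fun _ hm =>
      g_mem_wtSpace_same hm (μ.sameBlock_pos k a h)
  | .Y j => (ρ (AffYok.X r q _ (μ.pos ⟨k, j⟩).2)).restrict fun _ hm => X_mem_wtSpace hm _ _
  | .Yinv j => (ρ (AffYok.Xinv _ (μ.pos ⟨k, j⟩).2)).restrict fun _ hm => Xinv_mem_wtSpace hm _ _

variable {ρ μ} in
theorem coe_wtGen_T (k : Fin r) (a : ℕ) (h : a + 1 < μ.part k) (w : stdWt ρ ζ μ) :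
    (wtGen ρ ζ μ k (.T a h) w : M) = ρ (AffYok.g r q _ (μ.pos_succ_lt k a h)) w := rfl

variable {ρ μ} in
theorem coe_wtGen_Y (k : Fin r) (j : Fin (μ.part k)) (w : stdWt ρ ζ μ) :
    (wtGen ρ ζ μ k (.Y j) w : M) = ρ (AffYok.X r q _ (μ.pos ⟨k, j⟩).2) w := rfl

variable {ρ μ} in
theorem coe_wtGen_Yinv (k : Fin r) (j : Fin (μ.part k)) (w : stdWt ρ ζ μ) :
    (wtGen ρ ζ μ k (.Yinv j) w : M) = ρ (AffYok.Xinv _ (μ.pos ⟨k, j⟩).2) w := rfl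

-- All relations but the quadratic one come directly from identities in `Ŷ_{r,n}` at the positions
-- of the block. The quadratic relation needs the weight: the colouring is constant on the block, so
-- `e_i` acts as `1`.
include hr hζ hζr in
theorem wtGen_rel (k : Fin r) ⦃x y : FreeAlgebra K (HeckeGen (μ.part k))⦄
    (h : HeckeRel q (μ.part k) x y) :
    FreeAlgebra.lift K (wtGen ρ ζ μ k) x = FreeAlgebra.lift K (wtGen ρ ζ μ k) y := by
  cases h with
  | quadratic i h =>
    simp only [map_mul, map_sub, map_add, map_zero, AlgHom.commutes, FreeAlgebra.lift_ι_apply]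
    set G := wtGen ρ ζ μ k (.T i h) with hG
    have h1 : G * G = 1 + ((q : K) - ((q⁻¹ : Kˣ) : K)) • G :=
      LinearMap.ext fun w => Subtype.ext
        (g_g_same hr hζ hζr w.2 (μ.sameBlock_pos k i h))
    rw [sub_mul, mul_add, mul_add, h1, ← map_mul, Units.mul_inv, map_one, ← Algebra.commutes,
      ← Algebra.smul_def, ← Algebra.smul_def]
    module
  | braid i h =>
    simp only [map_mul, FreeAlgebra.lift_ι_apply]
    refine LinearMap.ext fun w => Subtype.ext ?_
    simp only [Module.End.mul_apply, coe_wtGen_T]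
    simp only [← Module.End.mul_apply, ← map_mul]
    have e : (μ.pos ⟨k, ⟨i + 1, by omega⟩⟩ : ℕ) = μ.pos ⟨k, ⟨i, by omega⟩⟩ + 1 :=
      μ.val_pos_succ k i (by omega)
    have hlt : (μ.pos ⟨k, ⟨i, by omega⟩⟩ : ℕ) + 1 + 1 < n := by
      rw [← e]; exact μ.pos_succ_lt k (i + 1) h
    rw [AffYok.g_congr e (μ.pos_succ_lt k (i + 1) h) hlt, ← mul_assoc, AffYok.braid,
      mul_assoc]
  | far i j hi hj hij =>
    simp only [map_mul, FreeAlgebra.lift_ι_apply]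
    refine LinearMap.ext fun w => Subtype.ext ?_
    simp only [Module.End.mul_apply, coe_wtGen_T]
    simp only [← Module.End.mul_apply, ← map_mul]
    rw [(AffYok.g_pos_commute_g_pos μ hi hj fun _ => hij).eq]
  | Y_Yinv j =>
    simp only [map_mul, map_one, FreeAlgebra.lift_ι_apply]
    exact LinearMap.ext fun w => Subtype.ext (X_Xinv_apply _ _ _)
  | Yinv_Y j =>
    simp only [map_mul, map_one, FreeAlgebra.lift_ι_apply]
    exact LinearMap.ext fun w => Subtype.ext (Xinv_X_apply _ _ _)
  | Y_comm i j =>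
    simp only [map_mul, FreeAlgebra.lift_ι_apply]
    refine LinearMap.ext fun w => Subtype.ext ?_
    simp only [Module.End.mul_apply, coe_wtGen_Y]
    simp only [← Module.End.mul_apply, ← map_mul]
    rw [(AffYok.X_commute_X _ _ _ _).eq]
  | T_Y_T i h =>
    simp only [map_mul, FreeAlgebra.lift_ι_apply]
    refine LinearMap.ext fun w => Subtype.ext ?_
    simp only [Module.End.mul_apply, coe_wtGen_T, coe_wtGen_Y]
    simp only [← Module.End.mul_apply, ← map_mul]
    rw [AffYok.X_congr (μ.val_pos_succ k i h) _ (μ.pos_succ_lt k i h), AffYok.X_succ, mul_assoc]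
  | T_Y i h j h1 h2 =>
    simp only [map_mul, FreeAlgebra.lift_ι_apply]
    refine LinearMap.ext fun w => Subtype.ext ?_
    simp only [Module.End.mul_apply, coe_wtGen_T, coe_wtGen_Y]
    simp only [← Module.End.mul_apply, ← map_mul]
    rw [(AffYok.g_pos_commute_X_pos μ h fun _ => ⟨h1, h2⟩).eq]

/-- The action of the affine Hecke algebra of the block `k` on the standard weight space. -/
def wtOp (k : Fin r) : AffHecke q (μ.part k) →ₐ[K] Module.End K (stdWt ρ ζ μ) :=
  RingQuot.liftAlgHom K ⟨FreeAlgebra.lift K (wtGen ρ ζ μ k), wtGen_rel ρ hr hζ hζr μ k⟩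

theorem wtOp_mk (k : Fin r) (x : FreeAlgebra K (HeckeGen (μ.part k))) :
    wtOp ρ hr hζ hζr μ k (AffHecke.mk q _ x) = FreeAlgebra.lift K (wtGen ρ ζ μ k) x :=
  RingQuot.liftAlgHom_mkAlgHom_apply K _ _ x

theorem wtOp_T (k : Fin r) (a : ℕ) (h : a + 1 < μ.part k) :
    wtOp ρ hr hζ hζr μ k (AffHecke.T q a h) = wtGen ρ ζ μ k (.T a h) :=
  (wtOp_mk ..).trans (FreeAlgebra.lift_ι_apply ..)

theorem wtOp_Y (k : Fin r) (j : Fin (μ.part k)) :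
    wtOp ρ hr hζ hζr μ k (AffHecke.Y q j) = wtGen ρ ζ μ k (.Y j) :=
  (wtOp_mk ..).trans (FreeAlgebra.lift_ι_apply ..)

theorem wtOp_Yinv (k : Fin r) (j : Fin (μ.part k)) :
    wtOp ρ hr hζ hζr μ k (AffHecke.Yinv q j) = wtGen ρ ζ μ k (.Yinv j) :=
  (wtOp_mk ..).trans (FreeAlgebra.lift_ι_apply ..)

/-- Generators attached to different blocks already commute in `Ŷ_{r,n}`, because they involve
disjoint sets of positions. -/
theorem wtOp_commute (k l : Fin r) (hkl : k ≠ l) (x : AffHecke q (μ.part k))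
    (y : AffHecke q (μ.part l)) :
    Commute (wtOp ρ hr hζ hζr μ k x) (wtOp ρ hr hζ hζr μ l y) := by
  have key : ∀ {A B : Module.End K (stdWt ρ ζ μ)} {a b : AffYok r q n},
      (∀ w, (A w : M) = ρ a w) → (∀ w, (B w : M) = ρ b w) → Commute a b → Commute A B := by
    intro A B a b hA hB hab
    refine LinearMap.ext fun w => Subtype.ext ?_
    rw [Module.End.mul_apply, Module.End.mul_apply, hA, hB, hB, hA, ← Module.End.mul_apply,
      ← Module.End.mul_apply, ← map_mul, ← map_mul, hab.eq]
  refine AffHecke.commute_of_generators _ (fun a ha => ?_) (fun a => ?_) x <;>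
  refine (AffHecke.commute_of_generators _ (fun b hb => ?_) (fun b => ?_) y).symm <;>
  simp only [wtOp_T, wtOp_Y]
  · exact key (coe_wtGen_T l b hb) (coe_wtGen_T k a ha)
      (AffYok.g_pos_commute_g_pos μ hb ha fun h => absurd h.symm hkl)
  · exact (key (coe_wtGen_T k a ha) (coe_wtGen_Y l b)
      (AffYok.g_pos_commute_X_pos μ ha fun h => absurd h hkl)).symm
  · exact key (coe_wtGen_T l b hb) (coe_wtGen_Y k a)
      (AffYok.g_pos_commute_X_pos μ hb fun h => absurd h.symm hkl)
  · exact key (coe_wtGen_Y l b) (coe_wtGen_Y k a) (AffYok.X_commute_X _ _ _ _)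

variable {ρ}

include hr hζ hζr in
/-- A polynomial relation of `X_1` holds for `X_j` on the weight spaces in which the colour of `j`
does not occur before `j`. -/
theorem aeval_X_of_wtSpace {p : Polynomial K}
    (hp : ∀ h : 0 < n, Polynomial.aeval (ρ (AffYok.X r q 0 h)) p = 0) (j : ℕ) (hj : j < n)
    {c : Fin n → Fin r} (hc : ∀ i (h : i < j), c ⟨i, h.trans hj⟩ ≠ c ⟨j, hj⟩) {m : M}
    (hm : m ∈ wtSpace ρ ζ c) : Polynomial.aeval (ρ (AffYok.X r q j hj)) p m = 0 := by
  induction j generalizing c m with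
  | zero => rw [hp, LinearMap.zero_apply]
  | succ j ih =>
    have hne := hc j (by omega)
    set c' := c ∘ adj j hj with hc'
    have hc'j : c' ⟨j, by omega⟩ = c ⟨j + 1, hj⟩ := by
      rw [hc', Function.comp_apply, adj_left]
    have hc'j' : c' ⟨j + 1, hj⟩ = c ⟨j, by omega⟩ := by
      rw [hc', Function.comp_apply, adj_right]
    have hm' : ρ (AffYok.g r q j hj) m ∈ wtSpace ρ ζ c' := g_mem_wtSpace hm j hj
    have h0 := ih (by omega) (c := c') (fun i hi => by
      rw [hc'j, hc', Function.comp_apply, adj_of_ne (by omega) (by omega)]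
      exact hc i (by omega)) hm'
    -- Write `m = g_j (g_j m)`. The inner vector has the colour in question moved to position `j`,
    -- where induction applies, and `X_{j+1} g_j = g_j X_j` carries the polynomial relation back.
    rw [← g_g_diff hr hζ hζr hm hne]
    rw [aeval_apply_of_intertwine (T := ρ (AffYok.X r q j (by omega))) (N := wtSpace ρ ζ c')
      (ρ (AffYok.g r q j hj)) (fun m hm => X_mem_wtSpace hm _ _) ?_ p hm', h0, map_zero]
    intro m' hm'
    have h1 := X_g_diff hr hζ hζr hm' (i := j) (h := hj) (by rw [hc'j, hc'j']; exact hne.symm)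
      ⟨j + 1, hj⟩
    rw [h1]
    congr 3
    exact AffYok.X_congr (by rw [adj_right]) _ _

/-- The colour of the first position of a block does not occur earlier in the standard colouring, so
the relation for `X_1` transfers to that position. -/
theorem aeval_wtOp_Y {p : Polynomial K}
    (hp : ∀ h : 0 < n, Polynomial.aeval (ρ (AffYok.X r q 0 h)) p = 0) (k : Fin r)
    (h : 0 < μ.part k) :
    Polynomial.aeval (wtOp ρ hr hζ hζr μ k (AffHecke.Y q ⟨0, h⟩)) p = 0 := by
  refine LinearMap.ext fun w => Subtype.ext ?_
  rw [wtOp_Y]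
  have h1 := aeval_apply_of_intertwine (T := wtGen ρ ζ μ k (.Y ⟨0, h⟩))
    (S := ρ (AffYok.X r q _ (μ.pos ⟨k, ⟨0, h⟩⟩).2)) (stdWt ρ ζ μ).subtype (N := ⊤)
    (fun _ _ => trivial) (fun m _ => coe_wtGen_Y k _ m) p (m := w) trivial
  refine h1.symm.trans ?_
  refine aeval_X_of_wtSpace hr hζ hζr hp _ _ (c := (Shuffle.std μ).col) (fun i hi h0 => ?_) w.2
  have h2 : (Shuffle.std μ).col (μ.pos ⟨k, ⟨0, h⟩⟩) = k := by simp [Shuffle.col_std]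
  rw [Fin.eta, h2] at h0
  rcases hp : μ.pos.symm ⟨i, hi.trans (Fin.is_lt _)⟩ with ⟨k', a⟩
  have hk : k' = k := by
    rw [Shuffle.col_std] at h0
    simp only [hp] at h0
    exact h0
  subst hk
  have h3 := ((Shuffle.std μ).2 k').monotone (Fin.le_def.2 (Nat.zero_le a) : ⟨0, h⟩ ≤ a)
  have h4 : (Shuffle.std μ).1.symm ⟨k', a⟩ = ⟨i, hi.trans (Fin.is_lt _)⟩ := by
    rw [Equiv.symm_apply_eq]
    exact hp.symm
  simp only [h4] at h3
  exact absurd (Fin.le_def.1 h3) (not_le.2 hi)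

/-- The standard weight space of an irreducible module is irreducible under the Hecke algebras of
the blocks. -/
theorem wtOp_irreducible
    (hM : ∀ P : Submodule K M, (∀ a, ∀ m ∈ P, ρ a m ∈ P) → P = ⊥ ∨ P = ⊤)
    (U : Submodule K (stdWt ρ ζ μ)) (hU : ∀ k x, ∀ w ∈ U, wtOp ρ hr hζ hζr μ k x w ∈ U) :
    U = ⊥ ∨ U = ⊤ := by
  by_cases h0 : U = ⊥
  · exact .inl h0
  right
  let N := U.map (stdWt ρ ζ μ).subtype
  have hN : N ≤ stdWt ρ ζ μ := by
    rintro _ ⟨w, -, rfl⟩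
    exact w.2
  have hN0 : N ≠ ⊥ := by
    obtain ⟨w, hw, hw0⟩ := (Submodule.ne_bot_iff _).1 h0
    refine (Submodule.ne_bot_iff _).2 ⟨w, ⟨w, hw, rfl⟩, fun h => hw0 (Subtype.ext h)⟩
  -- By irreducibility `U` generates `M`, so `M` is spanned by vectors reached from `U`. At the
  -- standard colouring these are only the elements of `U`; projecting to that weight shows that `U`
  -- is the whole weight space.
  have htop := iSup_reachSpan (ρ := ρ) (N := N) hr hζ hζr hN Shuffle.monotone_col_std
    (by
      rintro i h hc _ ⟨w, hw, rfl⟩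
      obtain ⟨k, a, ha, h1, -⟩ := (Shuffle.std μ).next hc
      have h2 : ((μ.pos ⟨k, ⟨a, by omega⟩⟩ : Fin n) : ℕ) = i := by
        have := (Equiv.symm_apply_eq μ.pos).1 h1
        rw [← this]
      have h3 := hU k (AffHecke.T q a ha) w hw
      rw [wtOp_T] at h3
      refine ⟨_, h3, ?_⟩
      rw [AffYok.g_congr h2.symm h (μ.pos_succ_lt k a ha)]
      rfl)
    (by
      rintro j h _ ⟨w, hw, rfl⟩
      obtain ⟨⟨k, a⟩, ha⟩ := μ.pos.surjective ⟨j, h⟩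
      have h3 := hU k (AffHecke.Y q a) w hw
      rw [wtOp_Y] at h3
      refine ⟨_, h3, ?_⟩
      rw [AffYok.X_congr (by rw [ha]) h (μ.pos ⟨k, a⟩).2]
      rfl)
    (by
      rintro j h _ ⟨w, hw, rfl⟩
      obtain ⟨⟨k, a⟩, ha⟩ := μ.pos.surjective ⟨j, h⟩
      have h3 := hU k (AffHecke.Yinv q a) w hw
      rw [wtOp_Yinv] at h3
      refine ⟨_, h3, ?_⟩
      rw [AffYok.Xinv_congr (by rw [ha]) h (μ.pos ⟨k, a⟩).2]
      rfl)
    (fun P hP hNP => (hM P hP).resolve_left fun h => hN0 (le_bot_iff.1 (h ▸ hNP)))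
  refine eq_top_iff.2 fun w _ => ?_
  obtain ⟨a, ha⟩ := exists_projection ρ hr hζ hζr (Shuffle.std μ).col
  have hw : (w : M) ∈ ⨆ c, reachSpan ρ N (Shuffle.std μ).col c := by rw [htop]; trivial
  obtain ⟨f, hf, hfw⟩ := (Submodule.mem_iSup_iff_exists_finsupp _ _).1 hw
  have h1 : ρ a w = f (Shuffle.std μ).col := by
    rw [← hfw, Finsupp.sum, map_sum, Finset.sum_eq_single (Shuffle.std μ).col]
    · rw [ha _ _ (reachSpan_le_wtSpace hN _ (hf _)), if_pos rfl]
    · intro c _ hne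
      rw [ha _ _ (reachSpan_le_wtSpace hN _ (hf _)), if_neg hne]
    · intro h
      rw [Finsupp.notMem_support_iff.1 h, map_zero]
  rw [ha _ _ w.2, if_pos rfl] at h1
  have h2 : reachSpan ρ N (Shuffle.std μ).col (Shuffle.std μ).col ≤ N :=
    Submodule.span_le.2 fun m hm => Reach.mem_of_monotone hm Shuffle.monotone_col_std
  obtain ⟨w', hw', h3⟩ := h2 (hf (Shuffle.std μ).col)
  rw [← h1] at h3
  rwa [← Subtype.ext h3]

end WeightHecke

/-! ### Increasing colourings as compositions, and simple submodules -/

theorem exists_col_std_eq {r n : ℕ} {c : Fin n → Fin r} (hc : Monotone c) :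
    ∃ μ : Comp r n, (Shuffle.std μ).col = c := by
  have hsum : ∑ k, Fintype.card {j // c j = k} = n := by
    rw [← Fintype.card_sigma, Fintype.card_congr (Equiv.sigmaFiberEquiv c), Fintype.card_fin]
  let μ : Comp r n := ⟨fun k => Fintype.card {j // c j = k}, hsum⟩
  let π : Fin n ≃ Σ k, Fin (μ.part k) :=
    (Equiv.sigmaFiberEquiv c).symm.trans (Equiv.sigmaCongrRight fun k => Fintype.equivFin _)
  have hπ : ∀ j, (π j).1 = c j := fun j => rfl
  refine ⟨μ, ?_⟩
  have h1 : c = (Shuffle.std μ).col ∘ (π.trans μ.pos) := by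
    funext j
    simp [Shuffle.col_std, hπ]
  rw [h1] at hc
  rw [h1]
  exact (Tuple.unique_monotone (τ := 1) hc Shuffle.monotone_col_std).symm

/-- A cyclic submodule of `W` is a quotient of the Artinian ring `A`, so it contains a simple
submodule even if `W` is infinite-dimensional. Working inside the quotient of `A` places `L` in the
universe of `A` rather than that of `W`. -/
theorem exists_simple_hom {K : Type u} [Field K] {A : Type v} [Ring A] [Algebra K A]
    [FiniteDimensional K A] {W : Type w} [AddCommGroup W] [Module K W] [Nontrivial W]
    (op : A →ₐ[K] Module.End K W) :
    ∃ L : ModuleCat.{v} A, IsSimpleModule A L ∧ ∃ ι : L →ₗ[K] W,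
      (∀ (a : A) z, ι (a • z) = op a (ι z)) ∧ ι ≠ 0 := by
  let _ : Module A W := Module.compHom W op.toRingHom
  have hsmul : ∀ (a : A) (w : W), a • w = op a w := fun _ _ => rfl
  obtain ⟨w, hw⟩ := exists_ne (0 : W)
  let φ : A →ₗ[A] W := LinearMap.toSpanSingleton A W w
  have : IsArtinianRing A := IsArtinianRing.of_finite K A
  have : Nontrivial (A ⧸ LinearMap.ker φ) := by
    refine Submodule.Quotient.nontrivial_iff.2 fun h => hw ?_
    have h1 : (1 : A) ∈ LinearMap.ker φ := by rw [h]; trivial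
    rw [LinearMap.mem_ker, LinearMap.toSpanSingleton_apply, one_smul] at h1
    exact h1
  obtain ⟨S, hS⟩ := IsAtomic.exists_atom (Submodule A (A ⧸ LinearMap.ker φ))
  have hS' : IsSimpleModule A S := isSimpleModule_iff_isAtom.2 hS
  let ψ : S →ₗ[A] W := (LinearMap.ker φ).liftQ φ le_rfl ∘ₗ S.subtype
  have hφ : Function.Injective ((LinearMap.ker φ).liftQ φ le_rfl) :=
    LinearMap.ker_eq_bot.1 (Submodule.ker_liftQ_eq_bot _ _ le_rfl le_rfl)
  have hψ : Function.Injective ψ := hφ.comp Subtype.val_injective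
  obtain ⟨L, hL, ψ, hψ⟩ : ∃ L : ModuleCat.{v} A, IsSimpleModule A L ∧
      ∃ ψ : L →ₗ[A] W, Function.Injective ψ :=
    ⟨ModuleCat.of A S, hS', ψ, hψ⟩
  refine ⟨L, hL, ⟨⟨ψ, map_add ψ⟩, fun c z => ?_⟩, fun a z => map_smul ψ a z, fun h => ?_⟩
  · change ψ (c • z) = c • ψ z
    rw [← algebraMap_smul A c z, map_smul, hsmul, AlgHom.commutes, Module.algebraMap_end_apply]
  · have := hL.nontrivial
    obtain ⟨z, hz⟩ := exists_ne (0 : L)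
    exact hz (hψ ((LinearMap.congr_fun h z).trans (map_zero ψ).symm))

/-! ## Maps from the induced modules -/

section Frobenius

variable {K : Type u} [Field K] {r n : ℕ} {q : Kˣ} {μ : Comp r n}
  {M : Type v} [AddCommGroup M] [Module K M] {ρ : AffYok r q n →ₐ[K] Module.End K M}
  {W : Type w} [AddCommGroup W] [Module K W]
  {ζ : Fin r → K} {op : ∀ k, AffHecke q (μ.part k) →ₐ[K] Module.End K W}
  (hr : (r : K) ≠ 0) (hζ : Function.Injective ζ) (hζr : ∀ k, ζ k ^ r = 1)
  (hop : ∀ k l, k ≠ l → ∀ x y, Commute (op k x) (op l y))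

/-- The hypothesis needed for Frobenius reciprocity: compatibility with the block Hecke algebras
suffices for `Ŷ_{r,μ}`, as can be checked on its generators, the `t_j` acting on both sides by the
standard weight. -/
theorem parabolicRep_intertwine (θ : W →ₗ[K] stdWt ρ ζ μ)
    (hθ : ∀ k x z, θ (op k x z) = wtOp ρ hr hζ hζr μ k x (θ z)) (b : parabolic q μ) (z : W) :
    ρ b (θ z) = θ (parabolicRep hr hζ hζr hop b z) := by
  obtain ⟨b, hb⟩ := b
  rw [parabolicRep_apply]
  change ρ b (θ z) = θ (stdEval K μ W (shuffleRep hr hζ hζr hop b (stdIncl K μ W z)))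
  induction hb using Algebra.adjoin_induction generalizing z with
  | mem x hx =>
    obtain ((⟨j, rfl⟩ | ⟨j, h, rfl⟩) | ⟨j, h, h1, -⟩) | ⟨i, h, hs, rfl⟩ := hx
    · rw [shuffleRep_t, tS_stdIncl, stdEval_stdIncl, map_smul]
      exact (θ z).2 j
    · rw [shuffleRep_X, XS_stdIncl, stdEval_stdIncl]
      obtain ⟨⟨k, a⟩, ha⟩ := μ.pos.surjective ⟨j, h⟩
      rw [← ha, Equiv.symm_apply_apply, Yop, hθ, wtOp_Y, coe_wtGen_Y,
        AffYok.X_congr (by rw [ha]) h (μ.pos ⟨k, a⟩).2]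
    -- A generator described only as an inverse of `X_j` equals the chosen one by uniqueness of
    -- inverses.
    · rw [left_inv_eq_right_inv h1 (AffYok.X_Xinv j h), shuffleRep_Xinv hr hζ hζr hop ⟨j, h⟩,
        XiS_stdIncl, stdEval_stdIncl]
      obtain ⟨⟨k, a⟩, ha⟩ := μ.pos.surjective ⟨j, h⟩
      rw [← ha, Equiv.symm_apply_apply, Yiop, hθ, wtOp_Yinv, coe_wtGen_Yinv,
        AffYok.Xinv_congr (by rw [ha]) h (μ.pos ⟨k, a⟩).2]
    · rw [shuffleRep_g, gS_stdIncl _ _ hs, stdEval_stdIncl]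
      obtain ⟨k, a, ha, h1, -⟩ := (Shuffle.std μ).next hs
      have h2 : ((μ.pos ⟨k, ⟨a, by omega⟩⟩ : Fin n) : ℕ) = i := by
        have := (Equiv.symm_apply_eq μ.pos).1 h1
        rw [← this]
      have h1' : μ.pos.symm ⟨i, by omega⟩ = ⟨k, ⟨a, by omega⟩⟩ := h1
      rw [h1', Top_succ ha, hθ, wtOp_T, coe_wtGen_T,
        AffYok.g_congr h2.symm h (μ.pos_succ_lt k a ha)]
  | algebraMap c =>
    rw [AlgHom.commutes, AlgHom.commutes, Module.algebraMap_end_apply,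
      Module.algebraMap_end_apply, map_smul, stdEval_stdIncl, map_smul]
    rfl
  | add x y _ _ hx hy =>
    rw [map_add, map_add, LinearMap.add_apply, LinearMap.add_apply, hx, hy, map_add, map_add]
    rfl
  | mul x y _ hy ihx ihy =>
    have h1 : shuffleRep hr hζ hζr hop y (stdIncl K μ W z) = stdIncl K μ W (stdEval K μ W
        (shuffleRep hr hζ hζr hop y (stdIncl K μ W z))) :=
      shuffleRep_stdIncl hr hζ hζr hop ⟨y, hy⟩ z
    rw [map_mul, map_mul, Module.End.mul_apply, Module.End.mul_apply, ihy, ihx, ← h1]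

end Frobenius

/-- Every irreducible `Ŷ_{r,n}`-module on which `f_λ(X_1)` vanishes is some `S_μ(L.)`. -/
theorem exists_sMod_equiv {K : Type u} [Field K] [IsAlgClosed K] {r n : ℕ} {q : Kˣ}
    {lam : residues q →₀ ℕ} (hr : (r : K) ≠ 0) (ζ : Fin r ≃ rootsOfUnity r K)
    {M : Type v} [AddCommGroup M] [Module K M] [Nontrivial M]
    (ρ : AffYok r q n →ₐ[K] Module.End K M)
    (hp : ∀ h : 0 < n, Polynomial.aeval (ρ (AffYok.X r q 0 h)) (cycPoly lam) = 0)
    (hM : ∀ P : Submodule K M, (∀ a, ∀ m ∈ P, ρ a m ∈ P) → P = ⊥ ∨ P = ⊤) :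
    ∃ (μ : Comp r n) (L : ∀ k, ModuleCat.{u} (CycHecke (μ.part k) lam)),
      (∀ k, IsSimpleModule (CycHecke (μ.part k) lam) (L k)) ∧
      ∃ e : SMod hr ζ μ L ≃ₗ[K] M, ∀ (y : AffYok r q n) s, e (y • s) = ρ y (e s) := by
  have hζ := roots_injective ζ
  have hζr := roots_pow ζ
  obtain ⟨c, hc, m, -, hm0, hm⟩ := exists_mem_wtSpace_monotone (ρ := ρ) hr hζ hζr
    (roots_surjective hr ζ) (top_ne_bot (α := Submodule K M)) (fun _ _ _ => trivial)
  obtain ⟨μ, rfl⟩ := exists_col_std_eq hc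
  let W := stdWt ρ (fun k => ((ζ k : Kˣ) : K)) μ
  have : Nontrivial W := ⟨⟨⟨m, hm⟩, 0, fun h => hm0 (congrArg Subtype.val h)⟩⟩
  let op : ∀ k, CycHecke (μ.part k) lam →ₐ[K] Module.End K W := fun k =>
    CycHecke.lift (wtOp ρ hr hζ hζr μ k) (aeval_wtOp_Y hr hζ hζr μ hp k)
  choose L hL ι hι hι0 using fun k => exists_simple_hom (op k)
  obtain ⟨θ, hθ⟩ := exists_outerTensor_equiv (A := fun k => CycHecke (μ.part k) lam)
    (L := fun k => (L k : Type u)) op (fun k l hkl x y => by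
      obtain ⟨x, rfl⟩ := CycHecke.ev_surjective x
      obtain ⟨y, rfl⟩ := CycHecke.ev_surjective y
      exact wtOp_commute ρ hr hζ hζr μ k l hkl x y)
    (fun U hU => wtOp_irreducible hr hζ hζr μ hM U fun k x => hU k (CycHecke.ev _ lam x))
    ι hι hι0
  refine ⟨μ, L, hL, ?_⟩
  have hθ' := parabolicRep_intertwine hr hζ hζr (outerOp_commute L) θ.toLinearMap
    fun k x z => hθ k (CycHecke.ev _ lam x) z
  let Θ : SMod hr ζ μ L →ₗ[K] M := indLift ρ (W.subtype ∘ₗ θ.toLinearMap) hθ'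
  have hΘ : ∀ (y : AffYok r q n) s, Θ (y • s) = ρ y (Θ s) := indLift_smul ρ _ hθ'
  -- The nonzero weight vector `m` lies in the image, so `Θ ≠ 0`; irreducibility of source and
  -- target then makes it bijective.
  obtain ⟨z, hz⟩ := θ.surjective ⟨m, hm⟩
  have h1 : Θ (Submodule.Quotient.mk (1 ⊗ₜ[K] z)) = m := by
    refine (indLift_mk ρ (W.subtype ∘ₗ θ.toLinearMap) hθ' 1 z).trans ?_
    rw [map_one, Module.End.one_apply]
    exact congrArg Subtype.val hz
  have hker : LinearMap.ker Θ = ⊥ := by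
    refine (sMod_irreducible L hr ζ (LinearMap.ker Θ) fun a x hx => ?_).resolve_right fun h => ?_
    · rw [LinearMap.mem_ker, hΘ, LinearMap.mem_ker.1 hx, map_zero]
    · rw [LinearMap.ker_eq_top.1 h] at h1
      exact hm0 h1.symm
  have hrange : LinearMap.range Θ = ⊤ := by
    refine (hM (LinearMap.range Θ) ?_).resolve_left fun h => ?_
    · rintro a _ ⟨x, rfl⟩
      exact ⟨a • x, hΘ a x⟩
    · rw [LinearMap.range_eq_bot.1 h] at h1
      exact hm0 h1.symm
  exact ⟨LinearEquiv.ofBijective Θ ⟨LinearMap.ker_eq_bot.1 hker, LinearMap.range_eq_top.1 hrange⟩,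
    hΘ⟩

/-- Every simple `Y_{r,n}^λ`-module is some `S_μ(L.)`. -/
theorem exists_sMod_addEquiv {K : Type u} [Field K] [IsAlgClosed K] {r n : ℕ} {q : Kˣ}
    {lam : residues q →₀ ℕ} (hr : (r : K) ≠ 0) (ζ : Fin r ≃ rootsOfUnity r K)
    {M : Type v} [AddCommGroup M] [Module (CycYok r n lam) M]
    [IsSimpleModule (CycYok r n lam) M] :
    ∃ (μ : Comp r n) (L : ∀ k, ModuleCat.{u} (CycHecke (μ.part k) lam)),
      (∀ k, IsSimpleModule (CycHecke (μ.part k) lam) (L k)) ∧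
      ∃ e : M ≃+ SMod hr ζ μ L,
        ∀ (y : AffYok r q n) (m : M), e (CycYok.proj r n lam y • m) = y • e m := by
  -- `M` comes only with an action of the cyclotomic algebra; its vector space structure is the one
  -- through the scalars of that algebra.
  let _ : Module K M := Module.compHom M (algebraMap K (CycYok r n lam))
  have : IsScalarTower K (CycYok r n lam) M := IsScalarTower.of_algebraMap_smul fun _ _ => rfl
  have := IsSimpleModule.nontrivial (CycYok r n lam) M
  obtain ⟨μ, L, hL, e, he⟩ := exists_sMod_equiv (lam := lam) hr ζ
    ((Algebra.lsmul K K M).comp (CycYok.proj r n lam)) (fun h => by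
      rw [AlgHom.comp_apply, Polynomial.aeval_algHom_apply, CycYok.aeval_proj_X, map_zero])
    (fun P hP => by
      let N : Submodule (CycYok r n lam) M :=
        { P.toAddSubmonoid with
          smul_mem' := fun a x hx => by
            obtain ⟨y, rfl⟩ := CycYok.proj_surjective a
            exact hP y x hx }
      have hmem : ∀ x, x ∈ N ↔ x ∈ P := fun x => Iff.rfl
      refine (eq_bot_or_eq_top N).imp (fun h => ?_) (fun h => ?_)
      · refine (Submodule.eq_bot_iff _).2 fun x hx => ?_
        rw [← hmem, h] at hx
        exact hx
      · refine eq_top_iff.2 fun x _ => ?_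
        rw [← hmem, h]
        trivial)
  refine ⟨μ, L, hL, e.symm.toAddEquiv, fun y m => ?_⟩
  change e.symm (CycYok.proj r n lam y • m) = y • e.symm m
  rw [LinearEquiv.symm_apply_eq, he, LinearEquiv.apply_symm_apply]
  rfl

end YokonumaHecke

end

/-! ### The classification of simple modules -/

theorem theorem6p1 {K : Type u} [Field K] [IsAlgClosed K] (r n : ℕ) (hn : 1 ≤ n)
    (hr : (r : K) ≠ 0) (q : Kˣ) (ζ : Fin r ≃ rootsOfUnity r K) (lam : residues q →₀ ℕ) :
    -- each `S_μ(L.)` is a simple module over the cyclotomic Yokonuma-Hecke algebra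
    (∀ (μ : Comp r n) (L : ∀ k, ModuleCat.{w} (CycHecke (μ.part k) lam)),
      (∀ k, IsSimpleModule (CycHecke (μ.part k) lam) (L k)) →
      ∃ _ : Module (CycYok r n lam) (SMod hr ζ μ L),
        (∀ (y : AffYok r q n) (s : SMod hr ζ μ L), CycYok.proj r n lam y • s = y • s) ∧
        IsSimpleModule (CycYok r n lam) (SMod hr ζ μ L)) ∧
    -- each simple module over the cyclotomic Yokonuma-Hecke algebra is isomorphic to some `S_μ(L.)`
    (∀ (M : Type v) [AddCommGroup M] [Module (CycYok r n lam) M],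
      IsSimpleModule (CycYok r n lam) M →
      ∃ (μ : Comp r n) (L : ∀ k, ModuleCat.{u} (CycHecke (μ.part k) lam)),
        (∀ k, IsSimpleModule (CycHecke (μ.part k) lam) (L k)) ∧
        ∃ e : M ≃+ SMod hr ζ μ L,
          ∀ (y : AffYok r q n) (m : M), e (CycYok.proj r n lam y • m) = y • e m) ∧
    -- modules with different `μ` are not isomorphic
    (∀ (μ μ' : Comp r n) (L : ∀ k, ModuleCat.{w} (CycHecke (μ.part k) lam))
      (L' : ∀ k, ModuleCat.{w} (CycHecke (μ'.part k) lam)),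
      (∀ k, IsSimpleModule (CycHecke (μ.part k) lam) (L k)) →
      (∀ k, IsSimpleModule (CycHecke (μ'.part k) lam) (L' k)) →
      Nonempty (SMod hr ζ μ L ≃ₗ[AffYok r q n] SMod hr ζ μ' L') → μ = μ') ∧
    -- for the same `μ`, the modules are isomorphic exactly if all `L_k` are
    (∀ (μ : Comp r n) (L L' : ∀ k, ModuleCat.{w} (CycHecke (μ.part k) lam)),
      (∀ k, IsSimpleModule (CycHecke (μ.part k) lam) (L k)) →
      (∀ k, IsSimpleModule (CycHecke (μ.part k) lam) (L' k)) →
      (Nonempty (SMod hr ζ μ L ≃ₗ[AffYok r q n] SMod hr ζ μ L') ↔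
        ∀ k, Nonempty (L k ≃ₗ[CycHecke (μ.part k) lam] L' k))) := by
  refine ⟨fun μ L _ => exists_module_sMod L hr ζ, fun M _ _ _ => exists_sMod_addEquiv hr ζ,
    fun μ μ' L L' _ _ ⟨E⟩ => comp_eq_of_linearEquiv hr ζ L L' E,
    fun μ L L' _ _ => ⟨fun ⟨E⟩ k => nonempty_linearEquiv_of_linearEquiv L L' hr ζ E k,
      fun h => exists_linearEquiv_of_linearEquiv L L' hr ζ fun k => (h k).some⟩⟩
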